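/- Theorem. Graphs are finite and simple, with node set $\{0,\dots,n-1\}$, $n\ge 1$, and are given by incidence lists (for each node a list of its neighbours in arbitrary order). A randomized query algorithm knows $n$, may use any amount of private randomness (in particular it may draw uniformly random nodes), and adaptively makes queries of the two kinds "degree of $v$" and "$i$-th neighbour of $v$". The distance of a graph $G$ to a property $\mathcal P$ is the minimal number of edge insertions and deletions that turn $G$ into a (simple) graph on the same nodes that has $\mathcal P$. A graph is $k$-edge-connected if removing fewer than $k$ edges always leaves it connected, and eulerian if it is connected and has a closed walk that traverses each edge exactly once. For each of the properties connectivity, $2$-edge-connectivity and eulerianity there are a randomized query algorithm, with inputs $\delta\in(0,1]$, $p\in[0,1)$ and $n$, and a constant $K$ such that: (a) for all such $\delta,p,n$ for which at least one graph on $n$ nodes has the property, and for every graph $G$ on $n$ nodes, the output of the algorithm differs from the distance of $G$ to the property by at most $\delta n$ with probability at least $p$; (b) for all such $\delta,p,n$, every graph on $n$ nodes and every outcome of the random choices, the algorithm makes at most $$K\cdot\frac{1}{(1-p)\,\delta^{2}}\,\log_e\!\left(\frac1\delta\right)$$ queries. There are likewise an algorithm and a constant $K$ for $3$-edge-connectivity,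 with the same guarantee (a) and with the bound in (b) replaced by $K\cdot\frac{1}{(1-p)\delta^{3}}\log_e\left(\frac1\delta\right)$. -/

import Mathlib

/-! ### Graphs: eulerianity and edit distance -/

/-- A graph is eulerian if it is connected and has a closed walk that traverses each edge of the
graph exactly once. -/
def IsEulerianGraph {V : Type*} [DecidableEq V] (G : SimpleGraph V) : Prop :=
  G.Connected ∧ ∃ (v : V) (w : G.Walk v v), w.IsEulerian

/-- The number of edge modifications (insertions and deletions) that turn `G` into `H`. -/
noncomputable def editCount {V : Type*} (G H : SimpleGraph V) : ℕ :=
  (symmDiff G.edgeSet H.edgeSet).ncard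

/-- The distance of `G` to the property `P`: the minimal number of edge modifications that turn `G`
into a graph on the same nodes that has `P`. (Meaningful if some graph on these nodes has `P`.) -/
noncomputable def distanceTo {V : Type*} (P : SimpleGraph V → Prop) (G : SimpleGraph V) : ℕ :=
  sInf {m : ℕ | ∃ H : SimpleGraph V, P H ∧ editCount G H = m}

/-! ### The incidence-lists model -/

/-- A representation of the graph `G` by incidence lists: for every node a list of its neighbours,
each occurring once, in an arbitrary order. -/
structure IncidenceLists {n : ℕ} (G : SimpleGraph (Fin n)) where
  nbrs : Fin n → List (Fin n)
  nodup : ∀ v, (nbrs v).Nodup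
  mem_nbrs : ∀ v w, w ∈ nbrs v ↔ G.Adj v w

/-- A deterministic adaptive query algorithm with real output on graphs with node set `Fin n`.
The next action may depend on all earlier answers. The available queries are `degree v` (the degree
of `v`) and `neighbour v i` (the `i`-th neighbour of `v`, or `none` if `v` has at most `i`
neighbours, positions being counted from `0`). -/
inductive QueryAlg (n : ℕ) : Type
  | output (x : ℝ) : QueryAlg n
  | degree (v : Fin n) (next : ℕ → QueryAlg n) : QueryAlg n
  | neighbour (v : Fin n) (i : ℕ) (next : Option (Fin n) → QueryAlg n) : QueryAlg n

namespace QueryAlg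

/-- The output of the algorithm on the graph given by the incidence lists `L`. -/
def run {n : ℕ} {G : SimpleGraph (Fin n)} (L : IncidenceLists G) : QueryAlg n → ℝ
  | output x => x
  | degree v next => (next (L.nbrs v).length).run L
  | neighbour v i next => (next ((L.nbrs v)[i]?)).run L

/-- The number of queries the algorithm makes on the graph given by the incidence lists `L`. -/
def queries {n : ℕ} {G : SimpleGraph (Fin n)} (L : IncidenceLists G) : QueryAlg n → ℕ
  | output _ => 0
  | degree v next => (next (L.nbrs v).length).queries L + 1
  | neighbour v i next => (next ((L.nbrs v)[i]?)).queries L + 1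

end QueryAlg

/-- A randomized query algorithm: a random choice (which may comprise any number of uniformly random
nodes, the set of nodes `Fin n` being known) of a deterministic one. -/
abbrev RandomizedQueryAlg (n : ℕ) : Type := PMF (QueryAlg n)

/-- The law of the output of a randomized query algorithm on a given input. -/
noncomputable def RandomizedQueryAlg.outputLaw {n : ℕ} {G : SimpleGraph (Fin n)}
    (A : RandomizedQueryAlg n) (L : IncidenceLists G) : PMF ℝ :=
  PMF.map (QueryAlg.run L) A

/-- An algorithm with parameters `δ` and `p` and the number of nodes `n` as input, and with query
access to a graph on `n` nodes. -/
abbrev Estimator : Type := ℝ → ℝ → (n : ℕ) → RandomizedQueryAlg n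

/-- The algorithm `A` with parameters `0 < δ ≤ 1` and `0 ≤ p < 1` estimates the distance to the
property `P` up to an additive error of at most `δ n` with probability at least `p`, for every graph
(however its incidence lists are ordered) on `n ≥ 1` nodes, as soon as some graph on `n` nodes has
the property. -/
def Estimator.EstimatesDistanceTo (A : Estimator)
    (P : ∀ n : ℕ, SimpleGraph (Fin n) → Prop) : Prop :=
  ∀ (δ p : ℝ) (n : ℕ), 0 < δ → δ ≤ 1 → 0 ≤ p → p < 1 → 1 ≤ n →
    (∃ H : SimpleGraph (Fin n), P n H) →
    ∀ (G : SimpleGraph (Fin n)) (L : IncidenceLists G),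
      ENNReal.ofReal p ≤ ((A δ p n).outputLaw L).toMeasure
        {x : ℝ | |x - (distanceTo (P n) G : ℝ)| ≤ δ * (n : ℝ)}

/-- The worst-case query complexity of `A` is `O(f δ p)`: there is a constant `C` such that, for all
parameters, on all graphs and for all outcomes of the random choices, the algorithm makes at most
`C * f δ p` queries. -/
def Estimator.HasQueryComplexity (A : Estimator) (f : ℝ → ℝ → ℝ) : Prop :=
  ∃ C : ℝ, ∀ (δ p : ℝ) (n : ℕ), 0 < δ → δ ≤ 1 → 0 ≤ p → p < 1 → 1 ≤ n →
    ∀ (G : SimpleGraph (Fin n)) (L : IncidenceLists G), ∀ T ∈ (A δ p n).support,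
      (T.queries L : ℝ) ≤ C * f δ p

/-! Up to an additive constant, each distance is a sum of local quantities, and such sums can be
estimated by sampling uniform nodes.

For `k`-edge-connectivity, call `k` minus the cut of a set its demand. Each edge inserted meets at
most one unit of demand at each of its two ends, so half the largest total demand of a family of
disjoint sets is a lower bound for the distance, up to `k`. The recursive `gain` is nonzero only on
extreme sets, which form a laminar family, and its sum is this maximum (`sum_sub_le_sum_gain`,
`exists_pairwiseDisjoint_sum_eq_sum_gain`). Conversely, a minimal vector of node demands that covers
all cuts has total at most the sum of the gains (`sum_le_sum_gain_of_minimal`). Splitting off turns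
pairs of demands into edges until a bounded demand remains (`exists_covers_of_splitting`), which a
bounded number of edges meets (`exists_le_outCut_of_covers`). Connectivity is the case of
components: the distance is their number minus one. For eulerianity, a component needs two
half-edges or as many as it has odd nodes, whichever is more; half the total is the distance up to
one (`sum_parityDemand_le_editCount`, `exists_connected_of_merging`,
`exists_eulerian_of_connected`).

The weight of a set is shared equally among its nodes, and the sets are grouped in levels by size,
`2 ^ j ≤ |X| < 2 ^ (j + 1)`. A node lies in at most `k` extreme sets (`card_isExtreme_le`), so its
share on level `j` is `O(2 ^ (-j))`, and about `4 ^ (-j) / ((1 - p) δ²)` samples suffice there by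
Chebyshev. Sets with more than about `1 / δ` nodes can be ignored. Finding the extreme sets of at
most `t` nodes through a sampled node takes `O(t)` exploration steps when at most one arc leaves
them (`IsVertexExtreme.subset_search`) and `O(t²)` when at most two do
(`IsVertexExtreme.subset_search₂`). Each step reads only `t + k` entries of a list, because a node
of larger degree lies in no such set. Hence a level costs about `1 / ((1 - p) δ²)` queries in the
first case, which over `O(log (1 / δ))` levels gives the bound with `δ²`; in the second case the
costs form a geometric series with sum about `1 / ((1 - p) δ³)`.

Two regimes are exceptional in `exists_estimator`. If `n` is `O(1 / δ)`, the additive constant is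
not negligible and the whole graph is read. If `δ` is close to `1`, the query bound tends to `0`, so
a fixed number must be output without any query; this needs a bound on the distance by `2 δ₀ n` with
`δ₀ < 1`. -/

namespace GraphDistance

set_option linter.unusedSectionVars false

/-! ### Adaptive query procedures and their cost -/

/-- The function `F` of the incidence lists can be computed, in a form that can be continued with
further queries, by an adaptive deterministic procedure that makes at most `c` queries. -/
def QueryComputable {n : ℕ} {α : Type} (c : ℕ) (F : (Fin n → List (Fin n)) → α) : Prop :=
  ∃ P : (α → QueryAlg n) → QueryAlg n, ∀ (κ : α → QueryAlg n) (G : SimpleGraph (Fin n))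
    (L : IncidenceLists G), (P κ).run L = (κ (F L.nbrs)).run L ∧
      (P κ).queries L ≤ c + (κ (F L.nbrs)).queries L

namespace QueryComputable

variable {n : ℕ} {α β ι : Type}

theorem const (a : α) : QueryComputable 0 (fun _ : Fin n → List (Fin n) => a) :=
  ⟨fun κ => κ a, fun _ _ _ => ⟨rfl, by simp⟩⟩

theorem mono {c d : ℕ} {F : (Fin n → List (Fin n)) → α} (h : QueryComputable c F) (hcd : c ≤ d) :
    QueryComputable d F := by
  obtain ⟨P, hP⟩ := h
  exact ⟨P, fun κ G L => ⟨(hP κ G L).1, (hP κ G L).2.trans (by omega)⟩⟩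

/-- The second stage is required only at values that `F` attains, so its cost bound `d` may rely on
properties of the intermediate result, such as a bound on the size of an explored set. -/
theorem bind {c d : ℕ} {F : (Fin n → List (Fin n)) → α} {H : α → (Fin n → List (Fin n)) → β}
    (hF : QueryComputable c F) (hH : ∀ N, QueryComputable d (H (F N))) :
    QueryComputable (c + d) (fun N => H (F N) N) := by
  classical
  obtain ⟨P, hP⟩ := hF
  have key : ∀ a : α, ∃ Q : (β → QueryAlg n) → QueryAlg n, (∃ N, F N = a) →
      ∀ (κ : β → QueryAlg n) (G : SimpleGraph (Fin n)) (L : IncidenceLists G),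
        (Q κ).run L = (κ (H a L.nbrs)).run L ∧
          (Q κ).queries L ≤ d + (κ (H a L.nbrs)).queries L := by
    intro a
    by_cases h : ∃ N, F N = a
    · obtain ⟨N, rfl⟩ := h
      obtain ⟨Q, hQ⟩ := hH N
      exact ⟨Q, fun _ => hQ⟩
    -- A value that `F` never takes gets a dummy continuation, which is never run.
    · exact ⟨fun _ => .output 0, fun h' => absurd h' h⟩
  choose Q hQ using key
  refine ⟨fun κ => P (fun a => Q a κ), fun κ G L => ?_⟩
  obtain ⟨h1, h2⟩ := hP (fun a => Q a κ) G L
  obtain ⟨h3, h4⟩ := hQ (F L.nbrs) ⟨_, rfl⟩ κ G L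
  exact ⟨h1.trans h3, h2.trans (by simpa [add_assoc] using h4)⟩

theorem map {c : ℕ} {F : (Fin n → List (Fin n)) → α} (hF : QueryComputable c F) (f : α → β) :
    QueryComputable c (fun N => f (F N)) :=
  (hF.bind (H := fun a _ => f a) (d := 0) fun N => const (f (F N))).mono (by simp)

theorem neighbour (v : Fin n) (i : ℕ) :
    QueryComputable 1 (fun N : Fin n → List (Fin n) => (N v)[i]?) :=
  ⟨fun κ => .neighbour v i κ, fun κ G L => ⟨rfl, by simp [QueryAlg.queries, add_comm]⟩⟩

theorem degree (v : Fin n) :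
    QueryComputable 1 (fun N : Fin n → List (Fin n) => (N v).length) :=
  ⟨fun κ => .degree v κ, fun κ G L => ⟨rfl, by simp [QueryAlg.queries, add_comm]⟩⟩

theorem take (v : Fin n) (t : ℕ) :
    QueryComputable t (fun N : Fin n → List (Fin n) => (N v).take t) := by
  induction t with
  | zero => simpa using const ([] : List (Fin n))
  | succ t ih =>
    have := ih.bind (H := fun l N => l ++ ((N v)[t]?).toList) (d := 1)
      fun N => (neighbour v t).map fun o => (N v).take t ++ o.toList
    simpa [List.take_add_one] using this

theorem iterate {c : ℕ} {step : α → (Fin n → List (Fin n)) → α}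
    (h : ∀ a, QueryComputable c (step a)) (a : α) (m : ℕ) :
    QueryComputable (m * c) (fun N => (fun s => step s N)^[m] a) := by
  induction m with
  | zero => simpa using const a
  | succ m ih =>
    have := ih.bind (H := step) (d := c) fun N => h _
    simpa [Function.iterate_succ_apply', Nat.succ_mul] using this

theorem family [DecidableEq ι] {c : ι → ℕ} {F : ι → (Fin n → List (Fin n)) → α} (a : α)
    (s : Finset ι) (h : ∀ i, QueryComputable (c i) (F i)) :
    QueryComputable (∑ i ∈ s, c i) (fun N i => if i ∈ s then F i N else a) := by
  induction s using Finset.induction_on with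
  | empty => simpa using const (fun _ : ι => a)
  | insert i s hi ih =>
    rw [Finset.sum_insert hi, add_comm]
    have := ih.bind (H := fun f N => Function.update f i (F i N)) (d := c i)
      fun N => (h i).map (Function.update (fun j => if j ∈ s then F j N else a) i)
    convert this using 3 with N j
    by_cases hj : j = i
    · subst hj; simp
    · simp [hj]

theorem finset_sum [AddCommMonoid α] {c : ι → ℕ} {F : ι → (Fin n → List (Fin n)) → α}
    (s : Finset ι) (h : ∀ i, QueryComputable (c i) (F i)) :
    QueryComputable (∑ i ∈ s, c i) (fun N => ∑ i ∈ s, F i N) := by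
  classical
  refine ((family 0 s h).map fun f => ∑ i ∈ s, f i).mono le_rfl |> fun h => ?_
  convert h using 2
  exact Finset.sum_congr rfl fun i hi => by simp [hi]

theorem exists_queryAlg {c : ℕ} {F : (Fin n → List (Fin n)) → ℝ} (h : QueryComputable c F) :
    ∃ T : QueryAlg n, ∀ (G : SimpleGraph (Fin n)) (L : IncidenceLists G),
      T.run L = F L.nbrs ∧ T.queries L ≤ c := by
  obtain ⟨P, hP⟩ := h
  refine ⟨P .output, fun G L => ⟨(hP _ G L).1, (hP _ G L).2⟩⟩

end QueryComputable

/-! ### Estimation by sampling -/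

open MeasureTheory ProbabilityTheory in
-- Chebyshev's inequality: the variance of a sum of independent terms is at most the sum of their
-- second moments.
theorem measure_pi_abs_sum_sub_le {n : ℕ} [NeZero n] {I : Type} [Fintype I]
    (a : I → Fin n → ℝ) {ε p : ℝ} (hε : 0 < ε)
    (h : (∑ i, (∑ x, a i x ^ 2) / n) ≤ (1 - p) * ε ^ 2) :
    ENNReal.ofReal p ≤ (Measure.pi fun _ : I => (PMF.uniformOfFintype (Fin n)).toMeasure)
      {ω | |(∑ i, a i (ω i)) - ∑ i, (∑ x, a i x) / n| ≤ ε} := by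
  set ν := (PMF.uniformOfFintype (Fin n)).toMeasure with hν
  set μ := Measure.pi fun _ : I => ν with hμ
  have hint (b : Fin n → ℝ) : ∫ x, b x ∂ν = (∑ x, b x) / n := by
    rw [hν, PMF.integral_eq_sum]
    simp [Finset.mul_sum, div_eq_inv_mul]
  have hmem (i : I) : MemLp (a i) 2 ν := MemLp.of_discrete
  have hvar (i : I) : Var[a i; ν] ≤ (∑ x, a i x ^ 2) / n := by
    refine (variance_le_expectation_sq (hmem i).aestronglyMeasurable).trans_eq ?_
    simpa using hint fun x => a i x ^ 2
  have hsum : (∑ i, fun ω : I → Fin n => a i (ω i)) = fun ω => ∑ i, a i (ω i) := by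
    ext ω; simp
  have hmean : μ[fun ω => ∑ i, a i (ω i)] = ∑ i, (∑ x, a i x) / n := by
    rw [integral_finsetSum _ fun i _ => Integrable.of_finite]
    refine Finset.sum_congr rfl fun i _ => ?_
    rw [hμ, integral_comp_eval (μ := fun _ : I => ν) (f := a i) (hmem i).aestronglyMeasurable, hint]
  have hV : Var[fun ω => ∑ i, a i (ω i); μ] ≤ (1 - p) * ε ^ 2 := by
    rw [← hsum, variance_sum_pi hmem]
    exact (Finset.sum_le_sum fun i _ => hvar i).trans h
  have hcheb := meas_ge_le_variance_div_sq (μ := μ) (X := fun ω => ∑ i, a i (ω i))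
    MemLp.of_discrete hε
  rw [hmean] at hcheb
  have hbad : μ {ω | ε ≤ |(∑ i, a i (ω i)) - ∑ i, (∑ x, a i x) / n|} ≤ ENNReal.ofReal (1 - p) :=
    hcheb.trans (ENNReal.ofReal_le_ofReal (by rw [div_le_iff₀ (by positivity)]; exact hV))
  have hone : 1 ≤ μ {ω | |(∑ i, a i (ω i)) - ∑ i, (∑ x, a i x) / n| ≤ ε} +
      μ {ω | ε ≤ |(∑ i, a i (ω i)) - ∑ i, (∑ x, a i x) / n|} := by
    refine le_trans ?_ (measure_union_le _ _)
    rw [← measure_univ (μ := μ)]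
    exact measure_mono fun ω _ => by
      simp only [Set.mem_union, Set.mem_ofPred_eq]
      exact le_total _ _
  by_cases hp : p ≤ 0
  · simp [ENNReal.ofReal_of_nonpos hp]
  -- Here the hypothesis forces `p = 1` and the failure probability is zero.
  by_cases hp1 : 1 ≤ p
  · rw [ENNReal.ofReal_of_nonpos (by linarith : 1 - p ≤ 0), nonpos_iff_eq_zero] at hbad
    rw [hbad, add_zero] at hone
    have h0 : 0 ≤ ∑ i, (∑ x, a i x ^ 2) / n := by positivity
    have : p ≤ 1 := by nlinarith [sq_pos_of_pos hε]
    exact (ENNReal.ofReal_le_ofReal this).trans (by simpa using hone)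
  · have h1 : ENNReal.ofReal p = 1 - ENNReal.ofReal (1 - p) := by
      rw [← ENNReal.ofReal_one, ← ENNReal.ofReal_sub _ (by linarith)]
      congr 1; ring
    rw [h1]
    refine tsub_le_iff_right.2 (hone.trans ?_)
    gcongr

/-- Estimating a sum over all nodes of locally computable quantities, which are grouped in levels,
by independent uniform samples of `s j` nodes on level `j`. -/
theorem exists_sampling_algorithm {n : ℕ} [NeZero n] {ι : Type} [Fintype ι]
    (f : ι → Fin n → (Fin n → List (Fin n)) → ℝ) (c s : ι → ℕ) (hs : ∀ j, 0 < s j)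
    (hf : ∀ j v, QueryComputable (c j) (f j v)) (g : ℝ → ℝ) :
    ∃ A : RandomizedQueryAlg n,
      (∀ T ∈ A.support, ∀ (G : SimpleGraph (Fin n)) (L : IncidenceLists G),
        T.queries L ≤ ∑ j, s j * c j) ∧
      ∀ (G : SimpleGraph (Fin n)) (L : IncidenceLists G) (ε p : ℝ), 0 < ε →
        ∑ j, (n / s j : ℝ) * ∑ v, f j v L.nbrs ^ 2 ≤ (1 - p) * ε ^ 2 →
        ∀ S : Set ℝ, (∀ x, |x - ∑ j, ∑ v, f j v L.nbrs| ≤ ε → g x ∈ S) → MeasurableSet S →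
          ENNReal.ofReal p ≤ (A.outputLaw L).toMeasure S := by
  classical
  have halg (ω : (Σ j, Fin (s j)) → Fin n) : QueryComputable (∑ j, s j * c j)
      (fun N => g (∑ i : Σ j, Fin (s j), (n / s i.1 : ℝ) * f i.1 (ω i) N)) := by
    have := (QueryComputable.finset_sum Finset.univ fun i : Σ j, Fin (s j) =>
      (hf i.1 (ω i)).map fun x => (n / s i.1 : ℝ) * x).map g
    simpa [Fintype.sum_sigma] using this
  choose T hT using fun ω => (halg ω).exists_queryAlg
  -- One independent uniform node for each pair of a level and a sample number. The factor `n / s j`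
  -- makes the estimate of every level unbiased.
  let μ := MeasureTheory.Measure.pi fun _ : Σ j, Fin (s j) =>
    (PMF.uniformOfFintype (Fin n)).toMeasure
  refine ⟨μ.toPMF.map T, fun U hU G L => ?_, fun G L ε p hε h S hS hSm => ?_⟩
  · obtain ⟨ω, -, rfl⟩ := (PMF.mem_support_map_iff _ _ _).1 hU
    exact (hT ω G L).2
  · rw [RandomizedQueryAlg.outputLaw, PMF.map_comp,
      PMF.toMeasure_map_apply _ _ _ (measurable_of_countable _) hSm,
      MeasureTheory.Measure.toPMF_toMeasure]
    have hn : (n : ℝ) ≠ 0 := NeZero.ne _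
    have hs' (j : ι) : (s j : ℝ) ≠ 0 := by exact_mod_cast (hs j).ne'
    refine (measure_pi_abs_sum_sub_le (fun i : Σ j, Fin (s j) => fun v =>
      (n / s i.1 : ℝ) * f i.1 v L.nbrs) (ε := ε) (p := p) hε ?_).trans
      (MeasureTheory.measure_mono fun ω hω => ?_)
    · refine le_trans (le_of_eq ?_) h
      rw [Fintype.sum_sigma]
      refine Finset.sum_congr rfl fun j _ => ?_
      simp only [Finset.sum_const, Finset.card_univ, Fintype.card_fin, nsmul_eq_mul, mul_pow,
        ← Finset.mul_sum]
      have := hs' j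
      field_simp
    · simp only [Set.mem_ofPred_eq] at hω
      simp only [Set.mem_preimage, Function.comp_apply, (hT ω G L).1]
      refine hS _ ?_
      convert hω using 3
      rw [Fintype.sum_sigma]
      refine Finset.sum_congr rfl fun j _ => ?_
      simp only [Finset.sum_const, Finset.card_univ, Fintype.card_fin, nsmul_eq_mul,
        ← Finset.mul_sum]
      have := hs' j
      field_simp

/-! ### Extreme sets and their gains -/

section Extreme

variable {V : Type*} [DecidableEq V]

/-- The number of arcs of the digraph with out-neighbourhoods `N` that leave `X`. -/
def outCut (N : V → Finset V) (X : Finset V) : ℕ := ∑ x ∈ X, (N x \ X).card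

/-- A nonempty set `X` is extreme for the cut function `h` if `h X < k` and all its nonempty proper
subsets have larger cuts. -/
def IsExtreme (h : Finset V → ℕ) (k : ℕ) (X : Finset V) : Prop :=
  X.Nonempty ∧ h X < k ∧ ∀ Y, Y ⊂ X → Y.Nonempty → h X < h Y

open Classical in
/-- The amount by which the demand `k - h X` of an extreme set `X` exceeds the total gain of the
extreme proper subsets of `X`. -/
noncomputable def gain (h : Finset V → ℕ) (k : ℕ) (X : Finset V) : ℕ :=
  if IsExtreme h k X then (k - h X) - ∑ Y ∈ X.ssubsets.attach, gain h k Y.1 else 0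
termination_by X.card
decreasing_by exact Finset.card_lt_card (Finset.mem_ssubsets.1 Y.2)

theorem gain_of_isExtreme {h : Finset V → ℕ} {k : ℕ} {X : Finset V} (hX : IsExtreme h k X) :
    gain h k X = (k - h X) - ∑ Y ∈ X.ssubsets, gain h k Y := by
  rw [gain, if_pos hX, Finset.sum_attach _ (gain h k)]

theorem gain_of_not_isExtreme {h : Finset V → ℕ} {k : ℕ} {X : Finset V}
    (hX : ¬ IsExtreme h k X) : gain h k X = 0 := by
  rw [gain, if_neg hX]

theorem IsExtreme.of_gain_ne_zero {h : Finset V → ℕ} {k : ℕ} {X : Finset V}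
    (hX : gain h k X ≠ 0) : IsExtreme h k X :=
  not_not.1 fun H => hX (gain_of_not_isExtreme H)

theorem gain_le (h : Finset V → ℕ) (k : ℕ) (X : Finset V) : gain h k X ≤ k := by
  by_cases hX : IsExtreme h k X
  · rw [gain_of_isExtreme hX]; omega
  · simp [gain_of_not_isExtreme hX]

theorem gain_empty (h : Finset V → ℕ) (k : ℕ) : gain h k ∅ = 0 :=
  gain_of_not_isExtreme fun H => by simpa using H.1

theorem isExtreme_congr {h h' : Finset V → ℕ} {k : ℕ} {X : Finset V}
    (H : ∀ Y ⊆ X, min k (h Y) = min k (h' Y)) : IsExtreme h k X ↔ IsExtreme h' k X := by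
  unfold IsExtreme
  have h1 := H X le_rfl
  constructor
  · rintro ⟨h2, h3, h4⟩
    refine ⟨h2, by omega, fun Y hY hY' => ?_⟩
    have := h4 Y hY hY'
    have := H Y hY.subset
    omega
  · rintro ⟨h2, h3, h4⟩
    refine ⟨h2, by omega, fun Y hY hY' => ?_⟩
    have := h4 Y hY hY'
    have := H Y hY.subset
    omega

/-- Only cuts of subsets of `X`, truncated at `k`, enter the recursion. This is what makes gains
computable from truncated incidence lists. -/
theorem gain_congr {h h' : Finset V → ℕ} {k : ℕ} {X : Finset V}
    (H : ∀ Y ⊆ X, min k (h Y) = min k (h' Y)) : gain h k X = gain h' k X := by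
  induction X using Finset.strongInduction with
  | H X ih =>
    by_cases hX : IsExtreme h k X
    · rw [gain_of_isExtreme hX, gain_of_isExtreme ((isExtreme_congr H).1 hX)]
      congr 1
      · have := H X le_rfl
        omega
      · refine Finset.sum_congr rfl fun Y hY => ?_
        have hY := Finset.mem_ssubsets.1 hY
        exact ih Y hY fun Z hZ => H Z (hZ.trans hY.subset)
    · rw [gain_of_not_isExtreme hX, gain_of_not_isExtreme (mt (isExtreme_congr H).2 hX)]

theorem exists_isExtreme_subset {h : Finset V → ℕ} {k : ℕ} {X : Finset V} (hX : X.Nonempty)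
    (hk : h X < k) : ∃ Y ⊆ X, IsExtreme h k Y ∧ h Y ≤ h X := by
  induction X using Finset.strongInduction with
  | H X ih =>
    by_cases hE : IsExtreme h k X
    · exact ⟨X, le_rfl, hE, le_rfl⟩
    · have : ∃ Y, Y ⊂ X ∧ Y.Nonempty ∧ h Y ≤ h X := by
        by_contra hcon
        push Not at hcon
        exact hE ⟨hX, hk, fun Y hY hY' => hcon Y hY hY'⟩
      obtain ⟨Y, hY, hYn, hYh⟩ := this
      obtain ⟨Z, hZ, hZE, hZh⟩ := ih Y hY hYn (by omega)
      exact ⟨Z, hZ.trans hY.subset, hZE, hZh.trans hYh⟩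

/-- An extreme subset whose cut is no larger has at least the same demand, and by the recursion the
gains of its subsets sum to at least its demand. -/
theorem sub_le_sum_powerset_gain (h : Finset V → ℕ) (k : ℕ) {X : Finset V} (hX : X.Nonempty) :
    k - h X ≤ ∑ Y ∈ X.powerset, gain h k Y := by
  by_cases hk : h X < k
  · obtain ⟨Y, hYX, hY, hle⟩ := exists_isExtreme_subset hX hk
    calc k - h X ≤ k - h Y := by omega
      _ ≤ gain h k Y + ∑ Z ∈ Y.ssubsets, gain h k Z := by rw [gain_of_isExtreme hY]; omega
      _ = ∑ Z ∈ Y.powerset, gain h k Z := by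
        rw [Finset.ssubsets, Finset.add_sum_erase _ _ (by simp)]
      _ ≤ _ := Finset.sum_le_sum_of_subset (Finset.powerset_mono.2 hYX)
  · omega

/-- Disjoint sets have no nonempty subset in common, so their individual bounds add up. -/
theorem sum_sub_le_sum_gain [Fintype V] (h : Finset V → ℕ) (k : ℕ) (S : Finset (Finset V))
    (hS : ∀ X ∈ S, X.Nonempty) (hd : (S : Set (Finset V)).PairwiseDisjoint id) :
    ∑ X ∈ S, (k - h X) ≤ ∑ X, gain h k X := by
  classical
  calc ∑ X ∈ S, (k - h X) ≤ ∑ X ∈ S, ∑ Y ∈ X.powerset.erase ∅, gain h k Y := by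
        refine Finset.sum_le_sum fun X hX => (sub_le_sum_powerset_gain h k (hS X hX)).trans_eq ?_
        rw [Finset.sum_erase _ (gain_empty h k)]
    _ = ∑ Y ∈ S.biUnion fun X => X.powerset.erase ∅, gain h k Y := by
        rw [Finset.sum_biUnion]
        intro X hX Y hY hne
        refine Finset.disjoint_left.2 fun Z hZ hZ' => ?_
        simp only [Finset.mem_erase, Finset.mem_powerset] at hZ hZ'
        obtain ⟨z, hz⟩ := Finset.nonempty_iff_ne_empty.2 hZ.1
        exact Finset.disjoint_left.1 (hd hX hY hne) (hZ.2 hz) (hZ'.2 hz)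
    _ ≤ _ := Finset.sum_le_sum_of_subset (Finset.subset_univ _)

/-- If the two sets crossed, both differences would be nonempty proper subsets with strictly larger
cuts, against posimodularity. -/
theorem IsExtreme.laminar {h : Finset V → ℕ} {k : ℕ}
    (hp : ∀ X Y, h (X \ Y) + h (Y \ X) ≤ h X + h Y) {X Y : Finset V} (hX : IsExtreme h k X)
    (hY : IsExtreme h k Y) : X ⊆ Y ∨ Y ⊆ X ∨ Disjoint X Y := by
  by_contra hcon
  push Not at hcon
  obtain ⟨h1, h2, h3⟩ := hcon
  have key : ∀ A B : Finset V, ¬ A ⊆ B → ¬ Disjoint A B → A \ B ⊂ A ∧ (A \ B).Nonempty := by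
    intro A B h1 h2
    refine ⟨⟨Finset.sdiff_subset, fun H => h2 ?_⟩, Finset.sdiff_nonempty.2 h1⟩
    exact Finset.disjoint_left.2 fun a ha => (Finset.mem_sdiff.1 (H ha)).2
  obtain ⟨a1, a2⟩ := key X Y h1 h3
  obtain ⟨b1, b2⟩ := key Y X h2 (fun h => h3 h.symm)
  have := hX.2.2 _ a1 a2
  have := hY.2.2 _ b1 b2
  have := hp X Y
  omega

/-- Extreme sets through a common node form a chain by laminarity, and along a chain the cut values
in `{0, …, k - 1}` are distinct. -/
theorem card_isExtreme_le [Fintype V] {h : Finset V → ℕ} {k : ℕ}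
    (hp : ∀ X Y, h (X \ Y) + h (Y \ X) ≤ h X + h Y) (v : V) (S : Finset (Finset V))
    (hS : ∀ X ∈ S, v ∈ X ∧ IsExtreme h k X) : S.card ≤ k := by
  rw [← Finset.card_range k]
  refine Finset.card_le_card_of_injOn h (fun X hX => by simpa using (hS X hX).2.2.1) ?_
  intro X hX Y hY hXY
  obtain ⟨vX, eX⟩ := hS X hX
  obtain ⟨vY, eY⟩ := hS Y hY
  by_contra hne
  rcases eX.laminar hp eY with H | H | H
  · exact absurd hXY (eY.2.2 X (H.ssubset_of_ne hne) eX.1).ne'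
  · exact absurd hXY (eX.2.2 Y (H.ssubset_of_ne (Ne.symm hne)) eY.1).ne
  · exact Finset.disjoint_left.1 H vX vY

/-- Take a maximal member `M` of the laminar family. If its gain is zero, it can be dropped.
Otherwise the gains inside `M` sum exactly to its demand, so `M` is chosen and the induction
continues with the members disjoint from `M`. -/
theorem exists_pairwiseDisjoint_sum_eq_sum_gain {h : Finset V → ℕ} {k : ℕ}
    (hp : ∀ X Y, h (X \ Y) + h (Y \ X) ≤ h X + h Y) (F : Finset (Finset V))
    (hF : ∀ X ∈ F, IsExtreme h k X) (hF' : ∀ X ∈ F, ∀ Y ⊆ X, IsExtreme h k Y → Y ∈ F) :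
    ∃ S ⊆ F, (S : Set (Finset V)).PairwiseDisjoint id ∧
      ∑ X ∈ S, (k - h X) = ∑ X ∈ F, gain h k X := by
  induction F using Finset.strongInduction with
  | H F ih =>
    obtain rfl | hne := F.eq_empty_or_nonempty
    · exact ⟨∅, le_rfl, by simp, by simp⟩
    obtain ⟨M, hM⟩ := F.exists_maximal hne
    by_cases hg : gain h k M = 0
    · obtain ⟨S, hS, hd, hs⟩ := ih (F.erase M) (Finset.erase_ssubset hM.prop)
        (fun X hX => hF X (Finset.mem_of_mem_erase hX)) (fun X hX Y hY hYE => by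
          refine Finset.mem_erase.2 ⟨?_, hF' X (Finset.mem_of_mem_erase hX) Y hY hYE⟩
          rintro rfl
          exact Finset.ne_of_mem_erase hX
            (Finset.Subset.antisymm (hM.le_of_ge (Finset.mem_of_mem_erase hX) hY) hY))
      refine ⟨S, hS.trans (Finset.erase_subset _ _), hd, hs.trans ?_⟩
      rw [← Finset.add_sum_erase _ _ hM.prop, hg, zero_add]
    · have hME := hF M hM.prop
      obtain ⟨S, hS, hd, hs⟩ := ih (F.filter fun X => Disjoint X M)
        (Finset.filter_ssubset.2 ⟨M, hM.prop, fun H => hME.1.ne_empty (disjoint_self.1 H)⟩)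
        (fun X hX => hF X (Finset.mem_filter.1 hX).1) (fun X hX Y hY hYE => by
          rw [Finset.mem_filter] at hX ⊢
          exact ⟨hF' X hX.1 Y hY hYE, hX.2.mono_left hY⟩)
      have hSM : ∀ X ∈ S, Disjoint X M := fun X hX => (Finset.mem_filter.1 (hS hX)).2
      have hMS : M ∉ S := fun H => hME.1.ne_empty (disjoint_self.1 (hSM M H))
      refine ⟨insert M S, ?_, ?_, ?_⟩
      · exact Finset.insert_subset hM.prop (hS.trans (Finset.filter_subset _ _))
      · rw [Finset.coe_insert]
        exact hd.insert fun X hX _ => (hSM X hX).symm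
      · rw [Finset.sum_insert hMS, hs,
          ← Finset.sum_filter_add_sum_filter_not F (fun X => Disjoint X M), add_comm]
        congr 1
        have h1 : ∑ X ∈ F with ¬ Disjoint X M, gain h k X = ∑ X ∈ M.powerset, gain h k X := by
          refine Finset.sum_subset (fun X hX => ?_) (fun X hX hX' => ?_)
          · rw [Finset.mem_filter] at hX
            rw [Finset.mem_powerset]
            rcases (hF X hX.1).laminar hp hME with H | H | H
            · exact H
            · exact hM.le_of_ge hX.1 H
            · exact absurd H hX.2
          · by_contra hne
            have hXE := IsExtreme.of_gain_ne_zero hne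
            have hXM := Finset.mem_powerset.1 hX
            refine hX' (Finset.mem_filter.2 ⟨hF' M hM.prop X hXM hXE, fun H => ?_⟩)
            exact hXE.1.ne_empty (disjoint_self.1 (H.mono_right hXM))
        have h2 : ∑ X ∈ M.powerset, gain h k X = gain h k M + ∑ X ∈ M.ssubsets, gain h k X := by
          rw [Finset.ssubsets, Finset.add_sum_erase _ _ (by simp)]
        -- Since the gain of `M` is nonzero, the truncated subtraction is exact here.
        have h3 := gain_of_isExtreme hME
        omega

end Extreme

/-! ### Inequalities for cuts -/

section Cut

variable {V : Type*} [DecidableEq V]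

theorem outCut_congr {N N' : V → Finset V} {X : Finset V} (h : ∀ x ∈ X, N x = N' x) :
    outCut N X = outCut N' X :=
  Finset.sum_congr rfl fun x hx => by rw [h x hx]

variable [Fintype V]

/-- In this symmetric form, inequalities between cuts can be checked for each pair of nodes
separately. -/
theorem two_mul_outCut {N : V → Finset V} (hN : ∀ x y, y ∈ N x → x ∈ N y) (X : Finset V) :
    2 * outCut N X = ∑ a, ∑ b, if b ∈ N a ∧ ¬ (a ∈ X ↔ b ∈ X) then 1 else 0 := by
  have h1 : outCut N X = ∑ a, ∑ b, if b ∈ N a ∧ a ∈ X ∧ b ∉ X then 1 else 0 := by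
    rw [outCut, ← Finset.sum_filter_add_sum_filter_not Finset.univ (· ∈ X)]
    simp only [Finset.filter_mem_eq_inter, Finset.univ_inter]
    rw [Finset.sum_congr (s₁ := {x | x ∉ X}) (g := fun _ => 0) rfl]
    · simp only [Finset.sum_const_zero, add_zero]
      refine Finset.sum_congr rfl fun a ha => ?_
      rw [Finset.card_eq_sum_ones, ← Finset.sum_filter]
      refine Finset.sum_congr ?_ fun _ _ => rfl
      ext b; simp [ha]
    · intro a ha
      simp only [Finset.mem_filter] at ha
      simp [ha.2]
  have h2 : outCut N X = ∑ a, ∑ b, if b ∈ N a ∧ b ∈ X ∧ a ∉ X then 1 else 0 := by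
    rw [h1, Finset.sum_comm]
    refine Finset.sum_congr rfl fun a _ => Finset.sum_congr rfl fun b _ => ?_
    have : a ∈ N b ↔ b ∈ N a := ⟨hN _ _, hN _ _⟩
    simp only [this]
  rw [two_mul]
  nth_rw 1 [h1]
  rw [h2, ← Finset.sum_add_distrib]
  refine Finset.sum_congr rfl fun a _ => ?_
  rw [← Finset.sum_add_distrib]
  refine Finset.sum_congr rfl fun b _ => ?_
  by_cases h1 : b ∈ N a <;> by_cases h2 : a ∈ X <;> by_cases h3 : b ∈ X <;> simp [h1, h2, h3]

theorem outCut_sdiff_add_outCut_sdiff_le {N : V → Finset V} (hN : ∀ x y, y ∈ N x → x ∈ N y)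
    (X Y : Finset V) : outCut N (X \ Y) + outCut N (Y \ X) ≤ outCut N X + outCut N Y := by
  suffices 2 * outCut N (X \ Y) + 2 * outCut N (Y \ X) ≤ 2 * outCut N X + 2 * outCut N Y by omega
  simp only [two_mul_outCut hN, ← Finset.sum_add_distrib]
  refine Finset.sum_le_sum fun a _ => Finset.sum_le_sum fun b _ => ?_
  by_cases h1 : b ∈ N a <;> by_cases h2 : a ∈ X <;> by_cases h3 : b ∈ X <;>
    by_cases h4 : a ∈ Y <;> by_cases h5 : b ∈ Y <;> simp [h1, h2, h3, h4, h5]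

theorem outCut_inter_add_outCut_union_le {N : V → Finset V} (hN : ∀ x y, y ∈ N x → x ∈ N y)
    (X Y : Finset V) : outCut N (X ∩ Y) + outCut N (X ∪ Y) ≤ outCut N X + outCut N Y := by
  suffices 2 * outCut N (X ∩ Y) + 2 * outCut N (X ∪ Y) ≤ 2 * outCut N X + 2 * outCut N Y by omega
  simp only [two_mul_outCut hN, ← Finset.sum_add_distrib]
  refine Finset.sum_le_sum fun a _ => Finset.sum_le_sum fun b _ => ?_
  by_cases h1 : b ∈ N a <;> by_cases h2 : a ∈ X <;> by_cases h3 : b ∈ X <;>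
    by_cases h4 : a ∈ Y <;> by_cases h5 : b ∈ Y <;> simp [h1, h2, h3, h4, h5]

/-- The inequality for three sets that limits the number of dangerous sets in the splitting-off
argument. -/
theorem outCut_three_le {N : V → Finset V} (hN : ∀ x y, y ∈ N x → x ∈ N y)
    (X Y Z : Finset V) : outCut N (X ∩ Y ∩ Z) + outCut N (X \ (Y ∪ Z)) + outCut N (Y \ (X ∪ Z)) +
      outCut N (Z \ (X ∪ Y)) ≤ outCut N X + outCut N Y + outCut N Z := by
  suffices 2 * outCut N (X ∩ Y ∩ Z) + 2 * outCut N (X \ (Y ∪ Z)) + 2 * outCut N (Y \ (X ∪ Z)) +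
      2 * outCut N (Z \ (X ∪ Y)) ≤ 2 * outCut N X + 2 * outCut N Y + 2 * outCut N Z by omega
  simp only [two_mul_outCut hN, ← Finset.sum_add_distrib]
  refine Finset.sum_le_sum fun a _ => Finset.sum_le_sum fun b _ => ?_
  by_cases h1 : b ∈ N a
  · by_cases h2 : a ∈ X <;> by_cases h3 : b ∈ X <;>
    by_cases h4 : a ∈ Y <;> by_cases h5 : b ∈ Y <;> by_cases h6 : a ∈ Z <;> by_cases h7 : b ∈ Z <;>
    simp [h1, h2, h3, h4, h5, h6, h7]
  · simp [h1]

end Cut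

section Search

variable {V : Type} [DecidableEq V]

/-! ### Worklist exploration -/

/-- Explore the first node of the worklist: its out-neighbours are put in front of the worklist, and
explored nodes are removed from it. -/
noncomputable def worklistStep (N : V → Finset V) (s : List V × Finset V) : List V × Finset V :=
  match s.1 with
  | [] => s
  | x :: l => (((N x).toList ++ l).filter (· ∉ insert x s.2), insert x s.2)

/-- The nodes explored in `m` steps of a worklist exploration that starts with the list `l`. -/
noncomputable def worklist (N : V → Finset V) (l : List V) (m : ℕ) : Finset V :=
  ((worklistStep N)^[m] (l, ∅)).2

theorem subset_worklistStep (N : V → Finset V) (s : List V × Finset V) :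
    s.2 ⊆ (worklistStep N s).2 := by
  obtain ⟨_ | ⟨x, l⟩, D⟩ := s
  · simp [worklistStep]
  · simp [worklistStep, Finset.subset_insert]

theorem card_worklist_le (N : V → Finset V) (l : List V) (m : ℕ) : (worklist N l m).card ≤ m := by
  unfold worklist
  induction m with
  | zero => simp
  | succ m ih =>
    rw [Function.iterate_succ_apply']
    generalize (worklistStep N)^[m] (l, ∅) = s at ih
    obtain ⟨_ | ⟨x, l⟩, D⟩ := s
    · simp only [worklistStep] at ih ⊢; omega
    · simp only [worklistStep] at ih ⊢
      exact (Finset.card_insert_le _ _).trans (by omega)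

/-- A set `X` that no arc leaves is explored completely within `|X|` steps, if for every proper
subset that no arc leaves the first node of the initial worklist outside that subset is in `X`. -/
theorem subset_worklist {N : V → Finset V} {l : List V} {X : Finset V} {m : ℕ}
    (hcl : ∀ x ∈ X, N x ⊆ X) (hm : X.card ≤ m)
    (hX : ∀ S, S ⊂ X → (∀ x ∈ S, N x ⊆ S) →
      ∃ A z B, l = A ++ z :: B ∧ (∀ a ∈ A, a ∈ S) ∧ z ∉ S ∧ z ∈ X) :
    X ⊆ worklist N l m := by
  -- Invariant while `X` is not exhausted: every step explored a new node of `X`, and the worklist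
  -- consists of a part `Q` inside `X`, containing all pending out-neighbours, followed by the
  -- unexplored nodes of `l`.
  have key : ∀ m, X ⊆ ((worklistStep N)^[m] (l, ∅)).2 ∨
      (((worklistStep N)^[m] (l, ∅)).2.card = m ∧ ((worklistStep N)^[m] (l, ∅)).2 ⊂ X ∧
        ∃ Q : List V, ((worklistStep N)^[m] (l, ∅)).1 =
          Q ++ l.filter (· ∉ ((worklistStep N)^[m] (l, ∅)).2) ∧ (∀ q ∈ Q, q ∈ X) ∧
          (∀ q ∈ Q, q ∉ ((worklistStep N)^[m] (l, ∅)).2) ∧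
          ∀ x ∈ ((worklistStep N)^[m] (l, ∅)).2, ∀ y ∈ N x,
            y ∈ ((worklistStep N)^[m] (l, ∅)).2 ∨ y ∈ Q) := by
    intro m
    induction m with
    | zero =>
      by_cases h : X = ∅
      · left; simp [h]
      · right
        refine ⟨by simp, ?_, [], by simp, by simp, by simp, by simp⟩
        simpa using Finset.nonempty_iff_ne_empty.2 h
    | succ m ih =>
      rw [Function.iterate_succ_apply']
      generalize (worklistStep N)^[m] (l, ∅) = s at ih ⊢
      rcases ih with h | ⟨h1, h2, Q, h3, h4, h5, h6⟩
      · exact Or.inl (h.trans (subset_worklistStep N s))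
      obtain ⟨T, D⟩ := s
      simp only at h1 h2 h3 h4 h5 h6 ⊢
      -- The next node `x` is either the head of `Q` or, when `Q` is empty, the first unexplored
      -- node of `l`. The two cases differ only in the remainders `Q'` and `R`.
      have main : ∀ (x : V) (Q' R : List V), x ∈ X → x ∉ D → T = x :: (Q' ++ R) →
          (∀ q ∈ Q', q ∈ X) → R.filter (· ∉ insert x D) = l.filter (· ∉ insert x D) →
          (∀ q ∈ Q, q = x ∨ q ∈ Q') →
          X ⊆ (worklistStep N (T, D)).2 ∨ ((worklistStep N (T, D)).2.card = m + 1 ∧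
            (worklistStep N (T, D)).2 ⊂ X ∧ ∃ Q : List V, (worklistStep N (T, D)).1 =
            Q ++ l.filter (· ∉ (worklistStep N (T, D)).2) ∧ (∀ q ∈ Q, q ∈ X) ∧
            (∀ q ∈ Q, q ∉ (worklistStep N (T, D)).2) ∧
            ∀ x ∈ (worklistStep N (T, D)).2, ∀ y ∈ N x,
              y ∈ (worklistStep N (T, D)).2 ∨ y ∈ Q) := by
        rintro x Q' R hx hxD rfl hQ' hR hQQ
        simp only [worklistStep]
        by_cases hXD : X ⊆ insert x D
        · exact Or.inl hXD
        right
        refine ⟨by rw [Finset.card_insert_of_notMem hxD, h1],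
          ⟨Finset.insert_subset hx h2.subset, hXD⟩,
          ((N x).toList ++ Q').filter (· ∉ insert x D), ?_, ?_, ?_, ?_⟩
        · have e : ((N x).toList ++ (Q' ++ R)).filter (· ∉ insert x D) =
              ((N x).toList ++ Q').filter (· ∉ insert x D) ++ l.filter (· ∉ insert x D) := by
            rw [← hR, ← List.filter_append, List.append_assoc]
          exact e
        · intro q hq
          simp only [List.mem_filter, List.mem_append, Finset.mem_toList] at hq
          rcases hq.1 with h | h
          · exact hcl x hx h
          · exact hQ' q h
        · intro q hq
          simpa using (List.mem_filter.1 hq).2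
        · intro a ha y hy
          by_cases hyD : y ∈ insert x D
          · exact Or.inl hyD
          · right
            simp only [List.mem_filter, List.mem_append, Finset.mem_toList]
            refine ⟨?_, by simpa using hyD⟩
            rcases Finset.mem_insert.1 ha with rfl | ha
            · exact Or.inl hy
            · rcases h6 a ha y hy with h | h
              · exact absurd (Finset.mem_insert_of_mem h) hyD
              · rcases hQQ y h with rfl | h
                · simp at hyD
                · exact Or.inr h
      cases Q with
      | cons x Q' =>
        refine main x Q' (l.filter (· ∉ D)) (h4 x (by simp)) (h5 x (by simp)) (by simpa using h3)
          (fun q hq => h4 q (by simp [hq])) ?_ (by simp)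
        rw [List.filter_filter]
        refine List.filter_congr fun a _ => ?_
        simp
      | nil =>
        -- With `Q` empty no arc leaves the explored set, so the hypothesis on `l` supplies a next
        -- node inside `X`.
        obtain ⟨A, z, B, rfl, hA, hz, hzX⟩ := hX D h2 fun x hx y hy => by simpa using h6 x hx y hy
        have hA' : A.filter (· ∉ D) = [] := by simpa using hA
        refine main z [] (B.filter (· ∉ D)) hzX hz ?_ (by simp) ?_ (by simp)
        · rw [h3, List.filter_append, hA', List.filter_cons_of_pos (by simpa using hz)]
          simp
        · have : A.filter (· ∉ insert z D) = [] := by simp; tauto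
          rw [List.filter_append, this, List.filter_cons_of_neg (by simp), List.filter_filter]
          simp only [List.nil_append]
          refine List.filter_congr fun a _ => ?_
          simp
  rcases key m with h | ⟨h1, h2, -⟩
  · exact h
  · exact absurd (Finset.card_lt_card h2) (by omega)

/-! ### Depth first search -/

open Classical in
/-- A step of a depth first search that stops as soon as `M` nodes have been visited. A state
consists of the stack, the set of finished nodes, and the list of the tree arcs. -/
noncomputable def dfsStep (M : ℕ) (N : V → Finset V) (s : List V × Finset V × List (V × V)) :
    List V × Finset V × List (V × V) :=
  match s.1 with
  | [] => s
  | x :: l =>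
    if M ≤ s.2.1.card + (x :: l).length then s
    else if h : ∃ y ∈ N x, y ∉ s.2.1 ∧ y ∉ x :: l then
      (h.choose :: x :: l, s.2.1, (x, h.choose) :: s.2.2)
    else (l, insert x s.2.1, s.2.2)

/-- The invariant of depth first search from `v`. -/
structure DfsInv (M : ℕ) (N : V → Finset V) (v : V) (s : List V × Finset V × List (V × V)) :
    Prop where
  chain : s.1.IsChain fun a b => a ∈ N b
  nodup : s.1.Nodup
  root : s.1 = [] ∨ ∃ l, s.1 = l ++ [v]
  root_mem : v ∈ s.1 ∨ v ∈ s.2.1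
  finished : ∀ x ∈ s.2.1, ∀ y ∈ N x, y ∈ s.1 ∨ y ∈ s.2.1
  disj : ∀ x ∈ s.1, x ∉ s.2.1
  arcs_visited : ∀ a ∈ s.2.2, a.2 ∈ s.1 ∨ a.2 ∈ s.2.1
  arcs : ∀ X : Finset V, v ∈ X → (∃ y, (y ∈ s.1 ∨ y ∈ s.2.1) ∧ y ∉ X) →
    ∃ a ∈ s.2.2, a.1 ∈ X ∧ a.2 ∉ X ∧ a.2 ∈ N a.1
  length_arcs : s.2.2.length + 1 = s.2.1.card + s.1.length
  card_le : s.2.1.card + s.1.length ≤ M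

theorem DfsInv.init {M : ℕ} (hM : 1 ≤ M) (N : V → Finset V) (v : V) :
    DfsInv M N v ([v], ∅, []) where
  chain := by simp
  nodup := by simp
  root := Or.inr ⟨[], rfl⟩
  root_mem := by simp
  finished := by simp
  disj := by simp
  arcs_visited := by simp
  arcs := by
    rintro X hv ⟨y, hy, hyX⟩
    simp only [List.mem_singleton, Finset.notMem_empty, or_false] at hy
    exact absurd (hy ▸ hv) hyX
  length_arcs := by simp
  card_le := by simpa using hM

theorem DfsInv.step {M : ℕ} {N : V → Finset V} {v : V} {s : List V × Finset V × List (V × V)}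
    (h : DfsInv M N v s) : DfsInv M N v (dfsStep M N s) := by
  obtain ⟨_ | ⟨x, l⟩, F, A⟩ := s
  · simpa [dfsStep] using h
  simp only [dfsStep]
  split_ifs with h1 h2
  · exact h
  · obtain ⟨hy1, hy2, hy3⟩ := h2.choose_spec
    set y := h2.choose
    obtain ⟨i1, i2, i3, i4, i5, i6, i7, i8, i9, i10⟩ := h
    simp only at i1 i2 i3 i4 i5 i6 i7 i8 i9 i10
    refine ⟨?_, ?_, ?_, ?_, ?_, ?_, ?_, ?_, ?_, ?_⟩ <;> simp only
    · exact List.isChain_cons_cons.2 ⟨hy1, i1⟩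
    · exact List.nodup_cons.2 ⟨hy3, i2⟩
    · right
      rcases i3 with i3 | ⟨l', hl'⟩
      · simp at i3
      · exact ⟨y :: l', by rw [hl']; rfl⟩
    · exact i4.imp (List.mem_cons_of_mem _) id
    · intro a ha b hb
      exact (i5 a ha b hb).imp (List.mem_cons_of_mem _) id
    · intro a ha
      rcases List.mem_cons.1 ha with rfl | ha
      · exact hy2
      · exact i6 a ha
    · intro a ha
      rcases List.mem_cons.1 ha with rfl | ha
      · simp
      · exact (i7 a ha).imp (List.mem_cons_of_mem _) id
    · rintro X hv ⟨z, hz, hzX⟩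
      by_cases hold : ∃ z, (z ∈ x :: l ∨ z ∈ F) ∧ z ∉ X
      · obtain ⟨a, ha, ha'⟩ := i8 X hv hold
        exact ⟨a, List.mem_cons_of_mem _ ha, ha'⟩
      · push Not at hold
        have hzy : z = y := by
          rcases hz with hz | hz
          · rcases List.mem_cons.1 hz with rfl | hz
            · rfl
            · exact absurd (hold z (Or.inl hz)) hzX
          · exact absurd (hold z (Or.inr hz)) hzX
        exact ⟨(x, y), by simp, hold x (by simp), hzy ▸ hzX, hy1⟩
    · simp only [List.length_cons] at i9 ⊢; omega
    · simp only [List.length_cons] at h1 ⊢; omega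
  · push Not at h2
    obtain ⟨i1, i2, i3, i4, i5, i6, i7, i8, i9, i10⟩ := h
    simp only at i1 i2 i3 i4 i5 i6 i7 i8 i9 i10
    have hxF : x ∉ F := i6 x (by simp)
    have hvis : ∀ y, (y ∈ l ∨ y ∈ insert x F) ↔ (y ∈ x :: l ∨ y ∈ F) := by
      intro y; simp only [List.mem_cons, Finset.mem_insert]; tauto
    refine ⟨?_, ?_, ?_, ?_, ?_, ?_, ?_, ?_, ?_, ?_⟩ <;> simp only [hvis]
    · exact i1.tail
    · exact (List.nodup_cons.1 i2).2
    · rcases i3 with i3 | ⟨_ | ⟨b, l'⟩, hl'⟩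
      · simp at i3
      · simp only [List.nil_append, List.cons.injEq] at hl'
        exact Or.inl hl'.2
      · simp only [List.cons_append, List.cons.injEq] at hl'
        exact Or.inr ⟨l', hl'.2⟩
    · exact i4
    · intro a ha b hb
      rcases Finset.mem_insert.1 ha with rfl | ha
      · by_cases hbF : b ∈ F
        · exact Or.inr hbF
        · exact Or.inl (h2 b hb hbF)
      · exact i5 a ha b hb
    · intro a ha
      rw [Finset.mem_insert, not_or]
      exact ⟨fun e => (List.nodup_cons.1 i2).1 (e ▸ ha), i6 a (List.mem_cons_of_mem _ ha)⟩
    · exact i7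
    · exact i8
    · rw [Finset.card_insert_of_notMem hxF]
      simp only [List.length_cons] at i9; omega
    · rw [Finset.card_insert_of_notMem hxF]
      simp only [List.length_cons] at i10; omega

/-- The final state of a depth first search from `v` that stops when `M` nodes are visited. -/
noncomputable def dfs (M : ℕ) (N : V → Finset V) (v : V) : List V × Finset V × List (V × V) :=
  (dfsStep M N)^[2 * M] ([v], ∅, [])

theorem dfsInv_dfs {M : ℕ} (hM : 1 ≤ M) (N : V → Finset V) (v : V) :
    DfsInv M N v (dfs M N v) := by
  unfold dfs
  generalize 2 * M = m
  induction m with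
  | zero => exact DfsInv.init hM N v
  | succ m ih => rw [Function.iterate_succ_apply']; exact ih.step

/-- Twice the number of finished nodes plus the height of the stack grows by one in every effective
step, so `2 * M` steps are enough. -/
theorem dfs_stopped {M : ℕ} (hM : 1 ≤ M) (N : V → Finset V) (v : V) :
    (dfs M N v).1 = [] ∨ M ≤ (dfs M N v).2.1.card + (dfs M N v).1.length := by
  have key : ∀ m, DfsInv M N v ((dfsStep M N)^[m] ([v], ∅, [])) ∧
      (((dfsStep M N)^[m] ([v], ∅, [])).1 = [] ∨
      M ≤ ((dfsStep M N)^[m] ([v], ∅, [])).2.1.card +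
        ((dfsStep M N)^[m] ([v], ∅, [])).1.length ∨
      m + 1 ≤ 2 * ((dfsStep M N)^[m] ([v], ∅, [])).2.1.card +
        ((dfsStep M N)^[m] ([v], ∅, [])).1.length) := by
    intro m
    induction m with
    | zero => exact ⟨DfsInv.init hM N v, by simp⟩
    | succ m ih =>
      rw [Function.iterate_succ_apply']
      generalize (dfsStep M N)^[m] ([v], ∅, []) = s at ih ⊢
      obtain ⟨hI, ih⟩ := ih
      refine ⟨hI.step, ?_⟩
      obtain ⟨_ | ⟨x, l⟩, F, A⟩ := s
      · simp [dfsStep]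
      have hxF : x ∉ F := hI.disj x (by simp)
      simp only [dfsStep]
      split_ifs with h1 h2
      · exact Or.inr (Or.inl h1)
      · simp only [List.length_cons, reduceCtorEq, false_or] at ih h1 ⊢
        omega
      · simp only [List.length_cons, reduceCtorEq, false_or,
          Finset.card_insert_of_notMem hxF] at ih h1 ⊢
        omega
  rcases (key (2 * M)).2 with h | h | h
  · exact Or.inl h
  · exact Or.inr h
  · right
    unfold dfs
    omega

end Search

/-! ### Finding sets with at most one leaving arc -/

section Search

variable {V : Type} [DecidableEq V]

theorem eq_of_outCut_le_one {N : V → Finset V} {X : Finset V} (h : outCut N X ≤ 1) {a b a' b' : V}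
    (ha : a ∈ X) (hb : b ∈ N a) (hbX : b ∉ X) (ha' : a' ∈ X) (hb' : b' ∈ N a') (hbX' : b' ∉ X) :
    a = a' ∧ b = b' := by
  rw [outCut, ← Finset.card_sigma] at h
  have := Finset.card_le_one.1 h ⟨a, b⟩ (by simp [ha, hb, hbX]) ⟨a', b'⟩ (by simp [ha', hb', hbX'])
  simpa using this

theorem exists_leaving_arc_of_isChain {N : V → Finset V} {X : Finset V} {l : List V} {z : V}
    (hc : (z :: l).IsChain fun a b => a ∈ N b) (hz : z ∉ X) {w : V} (hw : w ∈ l) (hwX : w ∈ X) :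
    ∃ a b, [b, a] <:+: z :: l ∧ a ∈ X ∧ b ∉ X ∧ b ∈ N a := by
  induction l generalizing z with
  | nil => simp at hw
  | cons y l ih =>
    rw [List.isChain_cons_cons] at hc
    by_cases hy : y ∈ X
    · exact ⟨y, z, ⟨[], l, by simp⟩, hy, hz, hc.1⟩
    · have hwl : w ∈ l := by
        rcases List.mem_cons.1 hw with rfl | h
        · exact absurd hwX hy
        · exact h
      obtain ⟨a, b, h1, h2⟩ := ih hc.2 hy hwl
      exact ⟨a, b, h1.trans ⟨[z], [], by simp⟩, h2⟩

/-- A path that starts and ends in a set with a single leaving arc does not leave this set. -/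
theorem mem_of_isChain {N : V → Finset V} {X : Finset V} (hcut : outCut N X ≤ 1)
    (hsym : ∀ y ∈ X, ∀ x, y ∈ N x → x ∈ N y) {l : List V} {x v : V}
    (hc : (x :: l).IsChain fun a b => a ∈ N b) (hn : (x :: l).Nodup) (hx : x ∈ X)
    (hv : ∃ l', x :: l = l' ++ [v]) (hvX : v ∈ X) : ∀ w ∈ x :: l, w ∈ X := by
  induction l generalizing x with
  | nil => simpa using hx
  | cons y l ih =>
    obtain ⟨l', hl'⟩ := hv
    obtain _ | ⟨x', l'⟩ := l'
    · simp at hl'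
    simp only [List.cons_append, List.cons.injEq] at hl'
    rw [List.isChain_cons_cons] at hc
    rw [List.nodup_cons] at hn
    have hyX : y ∈ X := by
      by_contra hy
      have hyx := hsym x hx y hc.1
      have hvl : v ∈ l := by
        have : v ∈ y :: l := by rw [hl'.2]; simp
        rcases List.mem_cons.1 this with rfl | h
        · exact absurd hvX hy
        · exact h
      obtain ⟨a, b, h1, h2, h3, h4⟩ := exists_leaving_arc_of_isChain hc.2 hy hvl hvX
      -- By symmetry the arc from `x` to `y` leaves `X`. Returning to `X` would use the reverse of a
      -- leaving arc, hence of the same one, and `x` would occur twice on the path.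
      obtain ⟨rfl, rfl⟩ := eq_of_outCut_le_one hcut hx hyx hy h2 h4 h3
      exact hn.1 (h1.subset (by simp))
    intro w hw
    rcases List.mem_cons.1 hw with rfl | hw
    · exact hx
    · exact ih hc.2 hn.2 hyX ⟨l', hl'.2⟩ w hw

open Classical in
/-- The nodes that can be reached from `v`. -/
noncomputable def reachSet [Fintype V] (N : V → Finset V) (v : V) : Finset V :=
  {y | Relation.ReflTransGen (fun a b => b ∈ N a) v y}

theorem self_mem_reachSet [Fintype V] (N : V → Finset V) (v : V) : v ∈ reachSet N v := by
  simpa [reachSet] using Relation.ReflTransGen.refl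

theorem reachSet_closed [Fintype V] {N : V → Finset V} {v x : V} (hx : x ∈ reachSet N v) :
    N x ⊆ reachSet N v := by
  intro y hy
  simp only [reachSet, Finset.mem_filter, Finset.mem_univ, true_and] at hx ⊢
  exact hx.tail hy

theorem reachSet_subset [Fintype V] {N : V → Finset V} {v : V} {S : Finset V} (hv : v ∈ S)
    (hS : ∀ x ∈ S, N x ⊆ S) : reachSet N v ⊆ S := by
  intro y hy
  simp only [reachSet, Finset.mem_filter, Finset.mem_univ, true_and] at hy
  induction hy with
  | refl => exact hv
  | tail _ h ih => exact hS _ ih h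

theorem reachSet_subset_worklist [Fintype V] {N : V → Finset V} {v : V} {m : ℕ}
    (hm : (reachSet N v).card ≤ m) : reachSet N v ⊆ worklist N [v] m := by
  refine subset_worklist (fun x hx => reachSet_closed hx) hm fun S hS hcl => ?_
  refine ⟨[], v, [], rfl, by simp, fun hv => ?_, self_mem_reachSet N v⟩
  exact hS.2 (reachSet_subset hv hcl)

open Classical in
/-- The digraph without the arcs between consecutive nodes of the list `s`. -/
noncomputable def offPath (s : List V) (N : V → Finset V) (x : V) : Finset V :=
  (N x).filter fun y => ¬ [x, y] <:+: s ∧ ¬ [y, x] <:+: s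

/-- The nodes explored from `v` when looking for sets of at most `t` nodes with at most one leaving
arc. -/
noncomputable def search (N : V → Finset V) (v : V) (t : ℕ) : Finset V :=
  worklist N [v] (2 * t + 1) ∪
    worklist (offPath (dfs (t + 1) N v).1 N) (dfs (t + 1) N v).1.reverse t

/-- `X` contains `v`, has arcs in both directions between its nodes and their neighbours, and has
a smaller cut than each of its proper subsets that contain `v`. -/
structure IsVertexExtreme (N : V → Finset V) (v : V) (X : Finset V) : Prop where
  mem : v ∈ X
  symm : ∀ y ∈ X, ∀ x, y ∈ N x → x ∈ N y
  lt : ∀ Y, Y ⊂ X → v ∈ Y → outCut N X < outCut N Y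

/-- No arc leaves `reachSet N v`, so intersecting `X` with it does not increase the cut. -/
theorem IsVertexExtreme.subset_reachSet [Fintype V] {N : V → Finset V} {v : V} {X : Finset V}
    (h : IsVertexExtreme N v X) : X ⊆ reachSet N v := by
  by_contra hcon
  have hlt := h.lt (X ∩ reachSet N v)
    ⟨Finset.inter_subset_left, fun H => hcon fun x hx => (Finset.mem_inter.1 (H hx)).2⟩
    (by simp [h.mem, self_mem_reachSet])
  refine absurd hlt (not_lt.2 ?_)
  unfold outCut
  refine (Finset.sum_le_sum fun x hx => Finset.card_le_card ?_).trans
    (Finset.sum_le_sum_of_subset Finset.inter_subset_left)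
  intro y hy
  rw [Finset.mem_inter] at hx
  rw [Finset.mem_sdiff] at hy ⊢
  exact ⟨hy.1, fun hyX => hy.2 (Finset.mem_inter.2 ⟨hyX, reachSet_closed hx.2 hy.1⟩)⟩

/-- A small reachable set is explored completely. Otherwise depth first search stops with a path
from `v` that leaves `X` through its only leaving arc. Without the arcs of this path `X` is closed,
and an exploration that uses the path nodes, in order from `v`, as its worklist exhausts `X` before
it touches anything else. -/
theorem IsVertexExtreme.subset_search [Fintype V] {N : V → Finset V} {v : V} {X : Finset V}
    {t : ℕ} (h : IsVertexExtreme N v X) (ht : X.card ≤ t) (hcut : outCut N X ≤ 1) :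
    X ⊆ search N v t := by
  have hXC := h.subset_reachSet
  by_cases hC : (reachSet N v).card ≤ 2 * t + 1
  · exact (hXC.trans (reachSet_subset_worklist hC)).trans Finset.subset_union_left
  push Not at hC
  refine Finset.Subset.trans ?_ Finset.subset_union_right
  have hI := dfsInv_dfs (Nat.le_add_left 1 t) N v
  have hfull := dfs_stopped (Nat.le_add_left 1 t) N v
  generalize dfs (t + 1) N v = s at hI hfull ⊢
  obtain ⟨s, F, A⟩ := s
  simp only at hfull ⊢
  -- An empty stack would mean that everything reachable was finished, hence at most `t + 1` nodes.
  obtain _ | ⟨x, l⟩ := s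
  · exfalso
    have hsub : reachSet N v ⊆ F := by
      refine reachSet_subset (by simpa using hI.root_mem) fun a ha b hb => ?_
      simpa using hI.finished a ha b hb
    have := Finset.card_le_card hsub
    have := hI.card_le
    simp only [List.length_nil, add_zero] at this
    omega
  replace hfull : t + 1 ≤ F.card + (x :: l).length := by simpa using hfull
  have hroot : ∃ l', x :: l = l' ++ [v] := by simpa using hI.root
  have hchain := hI.chain
  have hnodup := hI.nodup
  simp only at hchain hnodup
  set W : Finset V := F ∪ (x :: l).toFinset with hW
  have hWmem (y : V) : y ∈ W ↔ y ∈ x :: l ∨ y ∈ F := by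
    rw [hW, Finset.mem_union, List.mem_toFinset, or_comm]
  have hWcard : W.card = F.card + (x :: l).length := by
    rw [hW, Finset.card_union_of_disjoint, List.toFinset_card_of_nodup hnodup]
    rw [Finset.disjoint_left]
    exact fun a ha ha' => hI.disj a (List.mem_toFinset.1 ha') ha
  -- the end of the path is outside `X`
  have hxX : x ∉ X := by
    intro hxX
    have hstack := mem_of_isChain hcut h.symm hchain hnodup hxX hroot h.mem
    have hWX : ∃ y, (y ∈ x :: l ∨ y ∈ F) ∧ y ∉ X := by
      by_contra hcon
      push Not at hcon
      have := Finset.card_le_card (fun y hy => hcon y ((hWmem y).1 hy) : W ⊆ X)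
      omega
    obtain ⟨⟨a, b⟩, hab, haX, hbX, hba⟩ := hI.arcs X h.mem hWX
    simp only at haX hbX hba
    have hbW : b ∈ W := (hWmem b).2 (hI.arcs_visited _ hab)
    -- The leaving arc of `X` is a tree arc and ends in `W`. Visited nodes outside `X` are not on
    -- the stack, so they are finished. Hence `X ∪ W` is closed, but it has at most `2 * t + 1`
    -- nodes.
    have hsub : reachSet N v ⊆ X ∪ W := by
      refine reachSet_subset (Finset.mem_union_left _ h.mem) fun c hc d hd => ?_
      by_cases hcX : c ∈ X
      · by_cases hdX : d ∈ X
        · exact Finset.mem_union_left _ hdX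
        · obtain ⟨-, rfl⟩ := eq_of_outCut_le_one hcut haX hba hbX hcX hd hdX
          exact Finset.mem_union_right _ hbW
      · have hcW : c ∈ W := by simpa [hcX] using hc
        have hcF : c ∈ F := by
          rcases (hWmem c).1 hcW with h' | h'
          · exact absurd (hstack c h') hcX
          · exact h'
        exact Finset.mem_union_right _ ((hWmem d).2 (hI.finished c hcF d hd))
    have h1 := Finset.card_le_card hsub
    have h2 := Finset.card_union_le X W
    have h3 := hI.card_le
    simp only at h3
    omega
  obtain ⟨l', hl'⟩ := hroot
  have hvl : v ∈ l := by
    have : v ∈ x :: l := by rw [hl']; simp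
    rcases List.mem_cons.1 this with rfl | h'
    · exact absurd h.mem hxX
    · exact h'
  obtain ⟨a, b, habs, haX, hbX, hba⟩ := exists_leaving_arc_of_isChain hchain hxX hvl h.mem
  refine subset_worklist ?_ ht ?_
  · intro c hc d hd
    by_contra hdX
    simp only [offPath, Finset.mem_filter] at hd
    obtain ⟨rfl, rfl⟩ := eq_of_outCut_le_one hcut haX hba hbX hc hd.1 hdX
    exact hd.2.2 habs
  · intro S hSX hScl
    have hfirst : ∀ p : List V, (∃ z ∈ p, z ∉ S) →
        ∃ A z B, p = A ++ z :: B ∧ (∀ a ∈ A, a ∈ S) ∧ z ∉ S := by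
      intro p
      induction p with
      | nil => simp
      | cons y p ih =>
        intro hz
        by_cases hy : y ∈ S
        · obtain ⟨A, z, B, rfl, hA, hz⟩ := ih (by simpa [hy] using hz)
          exact ⟨y :: A, z, B, rfl, by simpa [hy] using hA, hz⟩
        · exact ⟨[], y, p, rfl, by simp, hy⟩
    obtain ⟨A, z, B, hp, hA, hz⟩ := hfirst (x :: l).reverse
      ⟨x, by simp, fun hx => hxX (hSX.subset hx)⟩
    refine ⟨A, z, B, hp, hA, hz, ?_⟩
    -- If the first path node outside `S` were outside `X` too, then `S` would contain all path
    -- nodes of `X`, since the path does not return to `X`. Being closed off the path, `S` would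
    -- then contain `v` and have no larger cut than `X`.
    by_contra hzX
    have hs : x :: l = B.reverse ++ z :: A.reverse := by
      rw [← List.reverse_reverse (x :: l), hp]; simp
    -- the nodes of the path that are in `X` come before `z`
    have hpath : ∀ w ∈ x :: l, w ∈ X → w ∈ S := by
      intro w hw hwX
      by_cases hwA : w ∈ A
      · exact hA w hwA
      exfalso
      have hwB : w ∈ B.reverse := by
        rw [hs, List.mem_append, List.mem_cons, List.mem_reverse (as := A)] at hw
        rcases hw with hw | rfl | hw
        · exact hw
        · exact absurd hwX hzX
        · exact absurd hw hwA
      obtain ⟨B1, B2, hB⟩ := List.append_of_mem hwB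
      have hs' : x :: l = B1 ++ (w :: (B2 ++ z :: A.reverse)) := by rw [hs, hB]; simp
      have hsuf : (w :: (B2 ++ z :: A.reverse)) <:+ x :: l := ⟨B1, hs'.symm⟩
      refine hzX (mem_of_isChain hcut h.symm (hchain.suffix hsuf) (hnodup.sublist hsuf.sublist)
        hwX ?_ h.mem z (by simp))
      obtain ⟨A', hA'⟩ : ∃ A', z :: A.reverse = A' ++ [v] := by
        have h1 : (x :: l).getLast (by simp) = v := by simp [hl']
        have h2 : (x :: l).getLast (by simp) = (z :: A.reverse).getLast (by simp) := by
          simp only [hs]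
          rw [List.getLast_append_of_right_ne_nil]
        exact ⟨(z :: A.reverse).dropLast, by
          conv_lhs => rw [← List.dropLast_append_getLast (by simp : z :: A.reverse ≠ []), ← h2, h1]⟩
      exact ⟨w :: (B2 ++ A'), by rw [hA']; simp⟩
    have hvS : v ∈ S := hpath v (by rw [hl']; simp) h.mem
    refine absurd (h.lt S hSX hvS) (not_lt.2 ?_)
    unfold outCut
    refine (Finset.sum_le_sum fun c hc => Finset.card_le_card ?_).trans
      (Finset.sum_le_sum_of_subset hSX.subset)
    intro d hd
    rw [Finset.mem_sdiff] at hd ⊢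
    refine ⟨hd.1, fun hdX => hd.2 ?_⟩
    by_cases hin : [c, d] <:+: x :: l ∨ [d, c] <:+: x :: l
    · refine hpath d ?_ hdX
      rcases hin with hin | hin <;> exact hin.subset (by simp)
    · push Not at hin
      exact hScl c hc (by simp [offPath, hd.1, hin])

/-! ### Sets with at most two leaving arcs -/

/-- The digraph without the arc `a` and its reverse. -/
def removeArc (a : V × V) (N : V → Finset V) (x : V) : Finset V :=
  (N x).filter fun y => (x, y) ≠ a ∧ (y, x) ≠ a

/-- The nodes explored from `v` when looking for sets of at most `t` nodes with at most two leaving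
arcs. -/
noncomputable def search₂ (N : V → Finset V) (v : V) (t : ℕ) : Finset V :=
  search N v t ∪ (dfs (t + 1) N v).2.2.toFinset.biUnion fun a => search (removeArc a N) v t

/-- Of an arc and its reverse at most one leaves `Y`. -/
theorem outCut_le_outCut_removeArc (N : V → Finset V) (a : V × V) (Y : Finset V) :
    outCut N Y ≤ outCut (removeArc a N) Y + 1 := by
  rw [outCut, outCut, ← Finset.card_sigma, ← Finset.card_sigma]
  have hsub : (Y.sigma fun x => N x \ Y) ⊆ (Y.sigma fun x => removeArc a N x \ Y) ∪
      (if a.1 ∈ Y then {⟨a.1, a.2⟩} else {⟨a.2, a.1⟩} : Finset (Σ _ : V, V)) := by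
    rintro ⟨x, y⟩ hxy
    simp only [Finset.mem_sigma, Finset.mem_sdiff, removeArc, Finset.mem_union,
      Finset.mem_filter] at hxy ⊢
    by_cases h1 : (x, y) = a
    · subst h1; simp [hxy.1]
    by_cases h2 : (y, x) = a
    · subst h2; simp [hxy.2.2]
    · exact Or.inl ⟨hxy.1, ⟨hxy.2.1, h1, h2⟩, hxy.2.2⟩
  refine (Finset.card_le_card hsub).trans ((Finset.card_union_le _ _).trans ?_)
  gcongr
  split_ifs <;> simp

theorem outCut_removeArc_lt {N : V → Finset V} {a : V × V} {X : Finset V} (h1 : a.1 ∈ X)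
    (h2 : a.2 ∉ X) (h3 : a.2 ∈ N a.1) : outCut (removeArc a N) X < outCut N X := by
  refine Finset.sum_lt_sum (fun x _ => Finset.card_le_card ?_) ⟨a.1, h1, Finset.card_lt_card ?_⟩
  · exact Finset.sdiff_subset_sdiff (Finset.filter_subset _ _) le_rfl
  · refine ⟨Finset.sdiff_subset_sdiff (Finset.filter_subset _ _) le_rfl, fun H => ?_⟩
    have := H (Finset.mem_sdiff.2 ⟨h3, h2⟩)
    simp [removeArc] at this

/-- If depth first search visits a node outside `X`, one of its at most `t` tree arcs leaves `X`.
Removing it lowers the cut of `X`, and other cuts by at most one, so `X` stays extreme and has at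
most one leaving arc. If no node outside `X` is visited, the whole reachable set has at most `t`
nodes. -/
theorem IsVertexExtreme.subset_search₂ [Fintype V] {N : V → Finset V} {v : V} {X : Finset V}
    {t : ℕ} (h : IsVertexExtreme N v X) (ht : X.card ≤ t) (hcut : outCut N X ≤ 2) :
    X ⊆ search₂ N v t := by
  by_cases hcut1 : outCut N X ≤ 1
  · exact (h.subset_search ht hcut1).trans Finset.subset_union_left
  have hI := dfsInv_dfs (Nat.le_add_left 1 t) N v
  have hfull := dfs_stopped (Nat.le_add_left 1 t) N v
  unfold search₂
  generalize dfs (t + 1) N v = s at hI hfull ⊢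
  obtain ⟨s, F, A⟩ := s
  simp only at hfull ⊢
  by_cases hvis : ∃ y, (y ∈ s ∨ y ∈ F) ∧ y ∉ X
  · obtain ⟨a, ha, h1, h2, h3⟩ := hI.arcs X h.mem hvis
    have hlt := outCut_removeArc_lt h1 h2 h3
    have h' : IsVertexExtreme (removeArc a N) v X := by
      refine ⟨h.mem, fun y hy x hx => ?_, fun Y hY hv => ?_⟩
      · simp only [removeArc, Finset.mem_filter] at hx ⊢
        exact ⟨h.symm y hy x hx.1, hx.2.2, hx.2.1⟩
      · have := h.lt Y hY hv
        have := outCut_le_outCut_removeArc N a Y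
        omega
    refine (h'.subset_search ht (by omega)).trans (Finset.Subset.trans ?_ Finset.subset_union_right)
    exact Finset.subset_biUnion_of_mem (fun a => search (removeArc a N) v t)
      (List.mem_toFinset.2 ha)
  · push Not at hvis
    have hcard : F.card + s.length ≤ X.card := by
      rw [← List.toFinset_card_of_nodup hI.nodup, ← Finset.card_union_of_disjoint]
      · refine Finset.card_le_card fun y hy => hvis y ?_
        simpa [or_comm] using hy
      · rw [Finset.disjoint_left]
        exact fun a ha ha' => hI.disj a (List.mem_toFinset.1 ha') ha
    obtain rfl : s = [] := by
      rcases hfull with h' | h'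
      · exact h'
      · omega
    have hsub : reachSet N v ⊆ F := by
      refine reachSet_subset (by simpa using hI.root_mem) fun a ha b hb => ?_
      simpa using hI.finished a ha b hb
    have := Finset.card_le_card hsub
    refine Finset.Subset.trans ?_ Finset.subset_union_left
    refine Finset.Subset.trans ?_ Finset.subset_union_left
    simp only [List.length_nil] at hcard
    exact h.subset_reachSet.trans (reachSet_subset_worklist (by omega))

theorem card_search_le (N : V → Finset V) (v : V) (t : ℕ) : (search N v t).card ≤ 3 * t + 1 := by
  refine (Finset.card_union_le _ _).trans ?_
  have h1 := card_worklist_le N [v] (2 * t + 1)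
  have h2 := card_worklist_le (offPath (dfs (t + 1) N v).1 N) (dfs (t + 1) N v).1.reverse t
  omega

theorem length_dfs_arcs_le (N : V → Finset V) (v : V) (t : ℕ) :
    (dfs (t + 1) N v).2.2.length ≤ t := by
  have hI := dfsInv_dfs (Nat.le_add_left 1 t) N v
  have := hI.length_arcs
  have := hI.card_le
  omega

theorem card_search₂_le (N : V → Finset V) (v : V) (t : ℕ) :
    (search₂ N v t).card ≤ (t + 1) * (3 * t + 1) := by
  refine (Finset.card_union_le _ _).trans ?_
  have h1 := card_search_le N v t
  have h2 : ((dfs (t + 1) N v).2.2.toFinset.biUnion fun a => search (removeArc a N) v t).card ≤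
      t * (3 * t + 1) := by
    refine (Finset.card_biUnion_le_card_mul _ _ _ fun a _ => card_search_le _ v t).trans ?_
    gcongr
    exact (List.toFinset_card_le _).trans (length_dfs_arcs_le N v t)
  linarith

end Search

/-! ### Query complexity of the exploration -/

section Queries

variable {n : ℕ}

/-- The set of the first `c` neighbours of `v`. -/
def firstNbrs (c : ℕ) (L : Fin n → List (Fin n)) (v : Fin n) : Finset (Fin n) :=
  ((L v).take c).toFinset

variable {c : ℕ} {N : (Fin n → List (Fin n)) → Fin n → Finset (Fin n)}

/-- A step looks at the neighbourhood of the head of the worklist only, so it is unchanged when `N`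
is replaced by the constant function with that value. -/
theorem queryComputable_worklistStep (hN : ∀ v, QueryComputable c fun L => N L v)
    (s : List (Fin n) × Finset (Fin n)) :
    QueryComputable c (fun L => worklistStep (N L) s) := by
  obtain ⟨_ | ⟨x, l⟩, D⟩ := s
  · exact (QueryComputable.const _).mono (Nat.zero_le _)
  · exact (hN x).map fun K => worklistStep (fun _ => K) (x :: l, D)

theorem queryComputable_worklist (hN : ∀ v, QueryComputable c fun L => N L v) (l : List (Fin n))
    (m : ℕ) : QueryComputable (m * c) (fun L => worklist (N L) l m) :=
  (QueryComputable.iterate (step := fun s L => worklistStep (N L) s)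
    (queryComputable_worklistStep hN) (l, ∅) m).map Prod.snd

theorem queryComputable_dfsStep (M : ℕ) (hN : ∀ v, QueryComputable c fun L => N L v)
    (s : List (Fin n) × Finset (Fin n) × List (Fin n × Fin n)) :
    QueryComputable c (fun L => dfsStep M (N L) s) := by
  obtain ⟨_ | ⟨x, l⟩, F, A⟩ := s
  · exact (QueryComputable.const _).mono (Nat.zero_le _)
  · exact (hN x).map fun K => dfsStep M (fun _ => K) (x :: l, F, A)

theorem queryComputable_dfs (M : ℕ) (hN : ∀ v, QueryComputable c fun L => N L v) (v : Fin n) :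
    QueryComputable (2 * M * c) (fun L => dfs M (N L) v) :=
  QueryComputable.iterate (step := fun s L => dfsStep M (N L) s)
    (queryComputable_dfsStep M hN) ([v], ∅, []) (2 * M)

/-- The exploration steps are `2 * t + 1` for the first worklist, `2 * (t + 1)` for depth first
search and `t` for the second worklist. -/
theorem queryComputable_search (hN : ∀ v, QueryComputable c fun L => N L v) (v : Fin n) (t : ℕ) :
    QueryComputable ((5 * t + 3) * c) (fun L => search (N L) v t) := by
  have h1 := queryComputable_worklist hN [v] (2 * t + 1)
  have h2 := queryComputable_dfs (t + 1) hN v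
  have h3 := h1.bind (H := fun S L => S ∪
      worklist (offPath (dfs (t + 1) (N L) v).1 (N L)) (dfs (t + 1) (N L) v).1.reverse t)
    (d := 2 * (t + 1) * c + t * c) fun L0 => by
      have h4 := h2.bind (H := fun s L => worklist (offPath s.1 (N L)) s.1.reverse t)
        (d := t * c) fun L1 => queryComputable_worklist
          (fun x => (hN x).map fun K => K.filter fun y => ¬ [x, y] <:+: (dfs (t + 1) (N L1) v).1 ∧
            ¬ [y, x] <:+: (dfs (t + 1) (N L1) v).1) _ t
      exact h4.map fun S => worklist (N L0) [v] (2 * t + 1) ∪ S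
  exact h3.mono (by ring_nf; omega)

theorem queryComputable_search₂ (hN : ∀ v, QueryComputable c fun L => N L v) (v : Fin n)
    (t : ℕ) : QueryComputable ((t + 2) * (5 * t + 3) * c) (fun L => search₂ (N L) v t) := by
  have h1 := queryComputable_search hN v t
  have h2 := queryComputable_dfs (t + 1) hN v
  have hfold (A : List (Fin n × Fin n)) : QueryComputable (A.length * ((5 * t + 3) * c))
      (fun L => A.toFinset.biUnion fun a => search (removeArc a (N L)) v t) := by
    induction A with
    | nil => simpa using QueryComputable.const (∅ : Finset (Fin n))
    | cons a A ih =>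
      have := ih.bind (d := (5 * t + 3) * c)
        (H := fun S L => search (removeArc a (N L)) v t ∪ S) fun L0 =>
        (queryComputable_search (N := fun L => removeArc a (N L))
          (fun x => (hN x).map fun K => K.filter fun y => (x, y) ≠ a ∧ (y, x) ≠ a) v t).map
          fun S => S ∪ _
      simpa [Finset.biUnion_insert, Nat.succ_mul] using this
  have h3 := h1.bind (d := 2 * (t + 1) * c + t * ((5 * t + 3) * c)) (H := fun S L => S ∪
      (dfs (t + 1) (N L) v).2.2.toFinset.biUnion fun a => search (removeArc a (N L)) v t)
    fun L0 => by
      have h4 := h2.bind (d := t * ((5 * t + 3) * c)) (H := fun s L =>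
        s.2.2.toFinset.biUnion fun a => search (removeArc a (N L)) v t) fun L1 =>
          (hfold _).mono (Nat.mul_le_mul_right _ (length_dfs_arcs_le _ v t))
      exact h4.map fun S => search (N L0) v t ∪ S
  refine h3.mono ?_
  have : 2 * (t + 1) * c ≤ (5 * t + 3) * c := Nat.mul_le_mul_right _ (by omega)
  calc (5 * t + 3) * c + (2 * (t + 1) * c + t * ((5 * t + 3) * c))
      ≤ (5 * t + 3) * c + ((5 * t + 3) * c + t * ((5 * t + 3) * c)) := by gcongr
    _ = (t + 2) * (5 * t + 3) * c := by ring

end Queries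

/-! ### Truncated incidence lists -/

/-- The sets of neighbours given by incidence lists. -/
def allNbrs {n : ℕ} (L : Fin n → List (Fin n)) (v : Fin n) : Finset (Fin n) := (L v).toFinset

theorem mem_allNbrs {n : ℕ} {G : SimpleGraph (Fin n)} (L : IncidenceLists G) {v w : Fin n} :
    w ∈ allNbrs L.nbrs v ↔ G.Adj v w := by
  simp [allNbrs, L.mem_nbrs]

theorem allNbrs_symm {n : ℕ} {G : SimpleGraph (Fin n)} (L : IncidenceLists G) (x y : Fin n)
    (h : y ∈ allNbrs L.nbrs x) : x ∈ allNbrs L.nbrs y := by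
  rw [mem_allNbrs] at h ⊢
  exact h.symm

theorem firstNbrs_subset {n : ℕ} (c : ℕ) (L : Fin n → List (Fin n)) (v : Fin n) :
    firstNbrs c L v ⊆ allNbrs L v := by
  intro x hx
  simp only [firstNbrs, allNbrs, List.mem_toFinset] at hx ⊢
  exact List.mem_of_mem_take hx

theorem firstNbrs_eq_or {n : ℕ} {c : ℕ} {L : Fin n → List (Fin n)} {v : Fin n} (h : (L v).Nodup) :
    firstNbrs c L v = allNbrs L v ∨
      (c ≤ (firstNbrs c L v).card ∧ c ≤ (allNbrs L v).card) := by
  by_cases hc : c ≤ (L v).length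
  · right
    rw [firstNbrs, allNbrs, List.toFinset_card_of_nodup h,
      List.toFinset_card_of_nodup (h.sublist (List.take_sublist _ _))]
    simpa using hc
  · left
    rw [firstNbrs, allNbrs, List.take_of_length_le (by omega)]

/-- At most `|X|` neighbours of `x` lie inside `X`. Hence reading `|X| + k` neighbours either shows
the whole list or certifies that the cut is at least `k`. -/
theorem le_outCut_of_le_card {V : Type*} [DecidableEq V] {N : V → Finset V} {X : Finset V} {x : V}
    (hx : x ∈ X) {k : ℕ} (h : X.card + k ≤ (N x).card) : k ≤ outCut N X := by
  have h1 : (N x \ X).card ≤ outCut N X :=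
    Finset.single_le_sum (f := fun x => (N x \ X).card) (fun _ _ => Nat.zero_le _) hx
  have h2 := Finset.le_card_sdiff X (N x)
  omega

/-- Cuts of small sets are determined, up to truncation at `k`, by the first neighbours. -/
theorem min_outCut_firstNbrs {n : ℕ} {k c : ℕ} {L : Fin n → List (Fin n)} (hL : ∀ v, (L v).Nodup)
    {X : Finset (Fin n)} (hc : X.card + k ≤ c) :
    min k (outCut (firstNbrs c L) X) = min k (outCut (allNbrs L) X) := by
  by_cases h : ∀ x ∈ X, firstNbrs c L x = allNbrs L x
  · rw [outCut_congr h]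
  · push Not at h
    obtain ⟨x, hx, hne⟩ := h
    rcases firstNbrs_eq_or (c := c) (hL x) with h | ⟨h1, h2⟩
    · exact absurd h hne
    · rw [min_eq_left (le_outCut_of_le_card hx (by omega)),
        min_eq_left (le_outCut_of_le_card hx (by omega))]

/-! ### Local weights, shared among nodes -/

/-- A local weight on sets of nodes: it is determined by the neighbourhoods of the nodes in the
set, and nonzero only for extreme sets. -/
structure LocalWeight (n k : ℕ) (B : ℝ) where
  /-- The weight of a set. -/
  w : (Fin n → Finset (Fin n)) → Finset (Fin n) → ℝ
  congr : ∀ N N' X, (∀ x ∈ X, N x = N' x) → w N X = w N' X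
  first : ∀ (c : ℕ) (L : Fin n → List (Fin n)) (X : Finset (Fin n)), (∀ v, (L v).Nodup) →
    X.card + k ≤ c → w (firstNbrs c L) X = w (allNbrs L) X
  extreme : ∀ N X, w N X ≠ 0 → IsExtreme (outCut N) k X
  nonneg : ∀ N X, 0 ≤ w N X
  le : ∀ N X, w N X ≤ B

namespace LocalWeight

variable {n k : ℕ} {B : ℝ} (W : LocalWeight n k B)

/-- The share of the node `v` in the weights of the sets `X` with `2 ^ j ≤ |X| < 2 ^ (j + 1)`. -/
noncomputable def share (N : Fin n → Finset (Fin n)) (j : ℕ) (v : Fin n) : ℝ :=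
  ∑ X : Finset (Fin n) with v ∈ X ∧ Nat.log 2 X.card = j, W.w N X / X.card

theorem w_empty (N : Fin n → Finset (Fin n)) : W.w N ∅ = 0 := by
  by_contra h
  simpa using (W.extreme N ∅ h).1

/-- Nodes of an extreme set have degree below `|X| + k ≤ c`, so truncation leaves their lists
complete. The truncated digraph need not be symmetric elsewhere, which is why `IsVertexExtreme` asks
for symmetry at `X` only. -/
theorem isVertexExtreme {G : SimpleGraph (Fin n)} (L : IncidenceLists G) {X : Finset (Fin n)}
    {c : ℕ} (hX : IsExtreme (outCut (allNbrs L.nbrs)) k X) (hc : X.card + k ≤ c) {v : Fin n}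
    (hv : v ∈ X) : IsVertexExtreme (firstNbrs c L.nbrs) v X ∧
      outCut (firstNbrs c L.nbrs) X < k := by
  have heq : ∀ x ∈ X, firstNbrs c L.nbrs x = allNbrs L.nbrs x := by
    intro x hx
    rcases firstNbrs_eq_or (c := c) (L.nodup x) with h | ⟨-, h2⟩
    · exact h
    · exact absurd (le_outCut_of_le_card hx (hc.trans h2)) (not_le.2 hX.2.1)
  have hcut : ∀ Y ⊆ X, outCut (firstNbrs c L.nbrs) Y = outCut (allNbrs L.nbrs) Y :=
    fun Y hY => outCut_congr fun x hx => heq x (hY hx)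
  refine ⟨⟨hv, fun y hy x hyx => ?_, fun Y hY hvY => ?_⟩, ?_⟩
  · rw [heq y hy]
    exact allNbrs_symm L _ _ (firstNbrs_subset _ _ _ hyx)
  · rw [hcut X le_rfl, hcut Y hY.subset]
    exact hX.2.2 Y hY ⟨v, hvY⟩
  · rw [hcut X le_rfl]
    exact hX.2.1

/-- Every relevant set through `v` lies inside the explored set, so it suffices to explore, to read
the truncated lists of the explored nodes and to sum over the sets inside. -/
theorem exists_queryComputable_share
    (srch : (Fin n → Finset (Fin n)) → Fin n → ℕ → Finset (Fin n)) (a b : ℕ → ℕ)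
    (hsub : ∀ N v X t, IsVertexExtreme N v X → X.card ≤ t → outCut N X < k → X ⊆ srch N v t)
    (hcomp : ∀ (c : ℕ) (N : (Fin n → List (Fin n)) → Fin n → Finset (Fin n)),
      (∀ v, QueryComputable c fun L => N L v) → ∀ v t,
        QueryComputable (a t * c) fun L => srch (N L) v t)
    (hcard : ∀ N v t, (srch N v t).card ≤ b t) (j : ℕ) (v : Fin n) :
    ∃ f : (Fin n → List (Fin n)) → ℝ,
      QueryComputable ((a (2 ^ (j + 1)) + b (2 ^ (j + 1))) * (2 ^ (j + 1) + k)) f ∧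
      ∀ (G : SimpleGraph (Fin n)) (L : IncidenceLists G),
        f L.nbrs = W.share (allNbrs L.nbrs) j v := by
  classical
  set t := 2 ^ (j + 1) with ht
  have hread : ∀ v : Fin n, QueryComputable (t + k) fun L => firstNbrs (t + k) L v :=
    fun v => (QueryComputable.take v (t + k)).map List.toFinset
  -- Nodes outside `S` get the empty neighbourhood as a default; the weights of subsets of `S` do
  -- not depend on it.
  let M (L : Fin n → List (Fin n)) (S : Finset (Fin n)) (x : Fin n) : Finset (Fin n) :=
    if x ∈ S then firstNbrs (t + k) L x else ∅
  let val (S : Finset (Fin n)) (N : Fin n → Finset (Fin n)) : ℝ :=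
    ∑ X : Finset (Fin n) with (v ∈ X ∧ Nat.log 2 X.card = j) ∧ X ⊆ S, W.w N X / X.card
  refine ⟨fun L => val (srch (firstNbrs (t + k) L) v t)
    (M L (srch (firstNbrs (t + k) L) v t)), ?_, fun G L => ?_⟩
  · have h1 := hcomp (t + k) (fun L => firstNbrs (t + k) L) hread v t
    have h2 := h1.bind (d := b t * (t + k)) (H := fun S L => val S (M L S)) fun L0 => by
      have h3 := QueryComputable.family (c := fun _ => t + k) (∅ : Finset (Fin n))
        (srch (firstNbrs (t + k) L0) v t) hread
      refine (h3.map (val (srch (firstNbrs (t + k) L0) v t))).mono ?_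
      rw [Finset.sum_const, smul_eq_mul]
      exact Nat.mul_le_mul_right _ (hcard _ _ _)
    exact h2.mono (by rw [Nat.add_mul])
  · simp only [val, share]
    rw [← Finset.filter_filter]
    refine Finset.sum_subset_zero_on_sdiff (Finset.filter_subset _ _) ?_ ?_
    · intro X hX
      simp only [Finset.mem_sdiff, Finset.mem_filter, Finset.mem_univ, true_and, not_and] at hX
      obtain ⟨⟨hvX, hlog⟩, hnot⟩ := hX
      have hXt : X.card < t := by
        rw [ht, ← hlog]
        exact Nat.lt_pow_succ_log_self (by norm_num) _
      by_contra hne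
      have hw : W.w (allNbrs L.nbrs) X ≠ 0 := fun h => hne (by simp [h])
      obtain ⟨h1, h2⟩ := isVertexExtreme L (W.extreme _ _ hw) (c := t + k) (by omega) hvX
      exact hnot ⟨hvX, hlog⟩ (hsub _ _ _ _ h1 hXt.le h2)
    · intro X hX
      simp only [Finset.mem_filter, Finset.mem_univ, true_and] at hX
      obtain ⟨⟨hvX, hlog⟩, hXS⟩ := hX
      have hXt : X.card < t := by
        rw [ht, ← hlog]
        exact Nat.lt_pow_succ_log_self (by norm_num) _
      rw [← W.first (t + k) L.nbrs X L.nodup (by omega)]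
      congr 1
      refine W.congr _ _ _ fun x hx => ?_
      simp only [M, if_pos (hXS hx)]

theorem share_nonneg (N : Fin n → Finset (Fin n)) (j : ℕ) (v : Fin n) : 0 ≤ W.share N j v :=
  Finset.sum_nonneg fun X _ => div_nonneg (W.nonneg N X) (Nat.cast_nonneg _)

section Sums

variable {N : Fin n → Finset (Fin n)}

theorem card_weight_ne_zero_le (hN : ∀ x y, y ∈ N x → x ∈ N y) (v : Fin n) :
    (Finset.univ.filter fun X : Finset (Fin n) => v ∈ X ∧ W.w N X ≠ 0).card ≤ k := by
  refine card_isExtreme_le (h := outCut N) (outCut_sdiff_add_outCut_sdiff_le hN) v _ ?_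
  intro X hX
  simp only [Finset.mem_filter, Finset.mem_univ, true_and] at hX
  exact ⟨hX.1, W.extreme N X hX.2⟩

/-- After scaling, each set through `v` contributes at most `B`, and at most `k` sets contribute on
all levels together. -/
theorem sum_two_pow_mul_share_le (hN : ∀ x y, y ∈ N x → x ∈ N y) (hB : 0 ≤ B) (J : ℕ) (v : Fin n) :
    ∑ j ∈ Finset.range J, 2 ^ j * W.share N j v ≤ k * B := by
  classical
  have h1 : ∀ j, 2 ^ j * W.share N j v ≤
      ∑ X : Finset (Fin n) with v ∈ X ∧ Nat.log 2 X.card = j, if W.w N X ≠ 0 then B else 0 := by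
    intro j
    rw [share, Finset.mul_sum]
    refine Finset.sum_le_sum fun X hX => ?_
    simp only [Finset.mem_filter, Finset.mem_univ, true_and] at hX
    by_cases hw : W.w N X = 0
    · simp [hw]
    · rw [if_pos hw]
      have hpos : 0 < X.card := Finset.card_pos.2 ⟨v, hX.1⟩
      have h2 : (2 : ℝ) ^ j ≤ X.card := by
        have := Nat.pow_log_le_self 2 hpos.ne'
        rw [hX.2] at this
        exact_mod_cast this
      have h3 : (0 : ℝ) < X.card := by exact_mod_cast hpos
      rw [← mul_div_assoc, div_le_iff₀ h3]
      nlinarith [W.nonneg N X, W.le N X]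
  calc ∑ j ∈ Finset.range J, 2 ^ j * W.share N j v
      ≤ ∑ j ∈ Finset.range J, ∑ X : Finset (Fin n) with v ∈ X ∧ Nat.log 2 X.card = j,
          (if W.w N X ≠ 0 then B else 0) := Finset.sum_le_sum fun j _ => h1 j
    _ ≤ ∑ X : Finset (Fin n) with v ∈ X, (if W.w N X ≠ 0 then B else 0) := by
        simp only [← Finset.filter_filter]
        rw [Finset.sum_fiberwise_eq_sum_filter]
        refine Finset.sum_le_sum_of_subset_of_nonneg (Finset.filter_subset _ _) fun X _ _ => ?_
        split_ifs <;> simp [hB]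
    _ = (Finset.univ.filter fun X : Finset (Fin n) => v ∈ X ∧ W.w N X ≠ 0).card * B := by
        rw [← Finset.sum_filter, Finset.filter_filter, Finset.sum_const, nsmul_eq_mul]
    _ ≤ k * B := by
        gcongr
        exact W.card_weight_ne_zero_le hN v

/-- This bounds the variance of all levels together independently of their number `J`, so the sample
sizes need no additional logarithm. -/
theorem sum_four_pow_mul_share_sq_le (hN : ∀ x y, y ∈ N x → x ∈ N y) (hB : 0 ≤ B) (J : ℕ) (v : Fin n) :
    ∑ j ∈ Finset.range J, 4 ^ j * W.share N j v ^ 2 ≤ (k * B) ^ 2 := by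
  have h0 : ∀ j ∈ Finset.range J, 0 ≤ 2 ^ j * W.share N j v :=
    fun j _ => mul_nonneg (by positivity) (W.share_nonneg N j v)
  calc ∑ j ∈ Finset.range J, 4 ^ j * W.share N j v ^ 2
      = ∑ j ∈ Finset.range J, (2 ^ j * W.share N j v) ^ 2 := by
        refine Finset.sum_congr rfl fun j _ => ?_
        rw [mul_pow, ← pow_mul, mul_comm j 2, pow_mul]; norm_num
    _ ≤ (∑ j ∈ Finset.range J, 2 ^ j * W.share N j v) ^ 2 :=
        Finset.sum_sq_le_sq_sum_of_nonneg h0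
    _ ≤ _ := by
        gcongr
        · exact Finset.sum_nonneg h0
        · exact W.sum_two_pow_mul_share_le hN hB J v

/-- Double counting: the shares of a set sum to its weight. Only sets of at least `2 ^ J` nodes are
missing, at most `k` through each node, with a share of at most `B / 2 ^ J` each. -/
theorem abs_sum_share_sub_le (hN : ∀ x y, y ∈ N x → x ∈ N y) (hB : 0 ≤ B) (J : ℕ) :
    |∑ j ∈ Finset.range J, ∑ v, W.share N j v - ∑ X, W.w N X| ≤ k * B * n / 2 ^ J := by
  classical
  have hswap : ∀ p : Finset (Fin n) → Prop, ∀ [DecidablePred p],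
      ∑ v, ∑ X : Finset (Fin n) with v ∈ X ∧ p X, W.w N X / X.card =
        ∑ X : Finset (Fin n) with p X, W.w N X := by
    intro p _
    simp only [Finset.sum_filter]
    rw [Finset.sum_comm]
    refine Finset.sum_congr rfl fun X _ => ?_
    by_cases hp : p X
    · simp only [hp, and_true, if_true, ← Finset.sum_filter, Finset.sum_const, nsmul_eq_mul]
      rw [Finset.filter_mem_eq_inter, Finset.univ_inter]
      obtain rfl | hX := X.eq_empty_or_nonempty
      · simp [W.w_empty]
      · have : (X.card : ℝ) ≠ 0 := by exact_mod_cast (Finset.card_pos.2 hX).ne'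
        field_simp
    · simp [hp]
  have h1 : ∑ j ∈ Finset.range J, ∑ v, W.share N j v =
      ∑ X : Finset (Fin n) with Nat.log 2 X.card ∈ Finset.range J, W.w N X := by
    simp only [share, hswap]
    rw [Finset.sum_fiberwise_eq_sum_filter]
  have h2 : ∑ X, W.w N X - ∑ j ∈ Finset.range J, ∑ v, W.share N j v =
      ∑ v, ∑ X : Finset (Fin n) with v ∈ X ∧ Nat.log 2 X.card ∉ Finset.range J,
        W.w N X / X.card := by
    rw [h1, hswap, ← Finset.sum_filter_add_sum_filter_not Finset.univ
      (fun X : Finset (Fin n) => Nat.log 2 X.card ∈ Finset.range J)]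
    ring
  have h3 : ∀ v, ∑ X : Finset (Fin n) with v ∈ X ∧ Nat.log 2 X.card ∉ Finset.range J,
      W.w N X / X.card ≤ k * B / 2 ^ J := by
    intro v
    calc ∑ X : Finset (Fin n) with v ∈ X ∧ Nat.log 2 X.card ∉ Finset.range J, W.w N X / X.card
        ≤ ∑ X : Finset (Fin n) with v ∈ X ∧ Nat.log 2 X.card ∉ Finset.range J,
          (if W.w N X ≠ 0 then B / 2 ^ J else 0) := by
          refine Finset.sum_le_sum fun X hX => ?_
          simp only [Finset.mem_filter, Finset.mem_univ, true_and, Finset.mem_range, not_lt] at hX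
          by_cases hw : W.w N X = 0
          · simp [hw]
          · rw [if_pos hw]
            have hpos : 0 < X.card := Finset.card_pos.2 ⟨v, hX.1⟩
            have h4 : (2 : ℝ) ^ J ≤ X.card := by
              have := (Nat.pow_le_pow_right (by norm_num : 0 < 2) hX.2).trans
                (Nat.pow_log_le_self 2 hpos.ne')
              exact_mod_cast this
            exact div_le_div₀ hB (W.le N X) (by positivity) h4
      _ ≤ ∑ X : Finset (Fin n) with v ∈ X, (if W.w N X ≠ 0 then B / 2 ^ J else 0) := by
          rw [← Finset.filter_filter]
          refine Finset.sum_le_sum_of_subset_of_nonneg (Finset.filter_subset _ _) fun X _ _ => ?_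
          split_ifs
          · positivity
          · exact le_rfl
      _ = (Finset.univ.filter fun X : Finset (Fin n) => v ∈ X ∧ W.w N X ≠ 0).card *
            (B / 2 ^ J) := by
          rw [← Finset.sum_filter, Finset.filter_filter, Finset.sum_const, nsmul_eq_mul]
      _ ≤ k * (B / 2 ^ J) := by
          gcongr
          exact W.card_weight_ne_zero_le hN v
      _ = k * B / 2 ^ J := by ring
  rw [abs_sub_comm, h2, abs_of_nonneg (Finset.sum_nonneg fun v _ => Finset.sum_nonneg fun X _ =>
    div_nonneg (W.nonneg N X) (Nat.cast_nonneg _))]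
  refine (Finset.sum_le_sum fun v _ => h3 v).trans_eq ?_
  rw [Finset.sum_const, Finset.card_univ, Fintype.card_fin, nsmul_eq_mul]
  ring

end Sums

end LocalWeight

/-! ### Query budgets -/

theorem sum_pow_range_le {b : ℝ} (hb : 2 ≤ b) (J : ℕ) : ∑ j ∈ Finset.range J, b ^ j ≤ b ^ J := by
  induction J with
  | zero => simp
  | succ J ih =>
    rw [Finset.sum_range_succ, pow_succ]
    have : 0 < b ^ J := by positivity
    nlinarith

/-- The summands `+ 1` come from rounding the sample sizes up. As `δ < δ₀ < 1`, the logarithm is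
bounded below by a positive constant, so terms without a logarithm are absorbed. -/
theorem exists_sampling_budget {d : ℕ} (hd : d = 2 ∨ d = 3) {δ₀ R M D : ℝ} (h0 : 0 < δ₀)
    (h1 : δ₀ < 1) (hR : 1 ≤ R) (hM : 0 ≤ M) (hD : 0 ≤ D) :
    ∃ K : ℝ, ∀ (δ p : ℝ) (J : ℕ), 0 < δ → δ < δ₀ → 0 ≤ p → p < 1 → (2 : ℝ) ^ J ≤ 4 * R / δ →
      (M / ((1 - p) * δ ^ 2) + 1) + ∑ j ∈ Finset.range J,
        (M / ((1 - p) * δ ^ 2) / 4 ^ j + 1) * (D * (2 ^ d) ^ j) ≤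
      K * (Real.log (1 / δ) / ((1 - p) * δ ^ d)) := by
  set l0 := Real.log (1 / δ₀) with hl0
  have hl0pos : 0 < l0 := Real.log_pos (by rw [lt_div_iff₀ h0]; linarith)
  have hlog2 : 0 < Real.log 2 := Real.log_pos (by norm_num)
  have hlogR : 0 ≤ Real.log (4 * R) := Real.log_nonneg (by linarith)
  -- common facts
  have common : ∀ δ p : ℝ, 0 < δ → δ < δ₀ → 0 ≤ p → p < 1 → ∀ e : ℕ, e ≤ d →
      l0 ≤ Real.log (1 / δ) ∧ 1 / δ ^ e ≤ 1 / ((1 - p) * δ ^ d) ∧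
      1 / ((1 - p) * δ ^ e) ≤ 1 / ((1 - p) * δ ^ d) ∧
      1 / ((1 - p) * δ ^ d) ≤ (1 / l0) * (Real.log (1 / δ) / ((1 - p) * δ ^ d)) := by
    intro δ p hδ hδ0 hp hp1 e he
    have hq : 0 < 1 - p := by linarith
    have hpow : δ ^ d ≤ δ ^ e := pow_le_pow_of_le_one hδ.le (by linarith) he
    have hdpos : 0 < δ ^ d := by positivity
    have hl : l0 ≤ Real.log (1 / δ) :=
      Real.log_le_log (by positivity) (one_div_le_one_div_of_le hδ hδ0.le)
    refine ⟨hl, ?_, ?_, ?_⟩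
    · refine one_div_le_one_div_of_le (by positivity) ?_
      nlinarith
    · exact one_div_le_one_div_of_le (by positivity) (by gcongr)
    · rw [div_mul_div_comm, one_mul, div_le_div_iff₀ (by positivity) (by positivity)]
      have : 0 < (1 - p) * δ ^ d := by positivity
      nlinarith
  rcases hd with rfl | rfl
  · refine ⟨M * (1 / l0) + 1 / l0 + D * ((Real.log (4 * R) / l0 + 1) / Real.log 2 * M) +
      D * (16 * R ^ 2 * (1 / l0)), fun δ p J hδ hδ0 hp hp1 hJ => ?_⟩
    obtain ⟨hl, e1, -, e3⟩ := common δ p hδ hδ0 hp hp1 0 (by norm_num)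
    obtain ⟨-, e2, -, -⟩ := common δ p hδ hδ0 hp hp1 2 le_rfl
    have hq : 0 < 1 - p := by linarith
    set E := 1 / ((1 - p) * δ ^ 2) with hE
    have hEpos : 0 < E := by positivity
    set lam := Real.log (1 / δ) with hlam
    have hu : Real.log (1 / δ) / ((1 - p) * δ ^ 2) = lam * E := by rw [hE, hlam]; ring
    have hσ : M / ((1 - p) * δ ^ 2) = M * E := by rw [hE]; ring
    rw [hu] at e3 ⊢
    rw [hσ]
    have hJle : (J : ℝ) ≤ (Real.log (4 * R) / l0 + 1) / Real.log 2 * lam := by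
      have h2 := Real.log_le_log (by positivity) hJ
      rw [Real.log_pow, show 4 * R / δ = 4 * R * (1 / δ) by ring,
        Real.log_mul (by positivity) (by positivity)] at h2
      rw [div_mul_eq_mul_div, le_div_iff₀ hlog2]
      have h3 : Real.log (4 * R) ≤ Real.log (4 * R) / l0 * lam := by
        rw [div_mul_eq_mul_div, le_div_iff₀ hl0pos]
        gcongr
      linarith
    -- Sample size and cost of a sample cancel, so every level costs the same; the number `J` of
    -- levels is the source of the logarithm.
    have hsum : ∑ j ∈ Finset.range J, (M * E / 4 ^ j + 1) * (D * (2 ^ 2) ^ j) ≤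
        D * (J * (M * E)) + D * (16 * R ^ 2 * E) := by
      have h3 : ∀ j ∈ Finset.range J, (M * E / 4 ^ j + 1) * (D * (2 ^ 2) ^ j) =
          D * (M * E) + D * 4 ^ j := by
        intro j _
        norm_num
        field_simp
      rw [Finset.sum_congr rfl h3, Finset.sum_add_distrib, ← Finset.mul_sum _ (fun j => 4 ^ j)]
      simp only [Finset.sum_const, Finset.card_range, nsmul_eq_mul]
      have h4 := sum_pow_range_le (b := 4) (by norm_num) J
      have h5 : (4 : ℝ) ^ J ≤ 16 * R ^ 2 * E := by
        calc (4 : ℝ) ^ J = (2 ^ J) ^ 2 := by rw [← pow_mul, mul_comm, pow_mul]; norm_num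
          _ ≤ (4 * R / δ) ^ 2 := by gcongr
          _ = 16 * R ^ 2 * (1 / δ ^ 2) := by ring
          _ ≤ _ := by gcongr
      have h6 := mul_le_mul_of_nonneg_left (h4.trans h5) hD
      linarith
    have hfin : D * (J * (M * E)) ≤
        D * ((Real.log (4 * R) / l0 + 1) / Real.log 2 * M) * (lam * E) := by
      calc D * (J * (M * E)) ≤ D * (((Real.log (4 * R) / l0 + 1) / Real.log 2 * lam) * (M * E)) := by
            gcongr
        _ = _ := by ring
    have h7 : (1 : ℝ) ≤ E := by simpa using e1
    have h8 := mul_le_mul_of_nonneg_left e3 hM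
    have h9 : D * (16 * R ^ 2 * E) ≤ D * (16 * R ^ 2 * (1 / l0 * (lam * E))) := by gcongr
    linarith
  · refine ⟨M * (1 / l0) + 1 / l0 + D * (4 * R * M * (1 / l0)) + D * (64 * R ^ 3 * (1 / l0)),
      fun δ p J hδ hδ0 hp hp1 hJ => ?_⟩
    obtain ⟨hl, e1, -, e3⟩ := common δ p hδ hδ0 hp hp1 0 (by norm_num)
    obtain ⟨-, -, e4, -⟩ := common δ p hδ hδ0 hp hp1 2 (by norm_num)
    obtain ⟨-, e2, -, -⟩ := common δ p hδ hδ0 hp hp1 3 le_rfl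
    have hq : 0 < 1 - p := by linarith
    set E := 1 / ((1 - p) * δ ^ 3) with hE
    have hEpos : 0 < E := by positivity
    set E' := 1 / ((1 - p) * δ ^ 2) with hE'
    have hE'pos : 0 < E' := by positivity
    set lam := Real.log (1 / δ) with hlam
    have hu : Real.log (1 / δ) / ((1 - p) * δ ^ 3) = lam * E := by rw [hE, hlam]; ring
    have hσ : M / ((1 - p) * δ ^ 2) = M * E' := by rw [hE']; ring
    rw [hu] at e3 ⊢
    rw [hσ]
    -- The costs `8 ^ j / 4 ^ j = 2 ^ j` form a geometric series with sum `O(1 / δ)`.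
    have hsum : ∑ j ∈ Finset.range J, (M * E' / 4 ^ j + 1) * (D * (2 ^ 3) ^ j) ≤
        D * (4 * R * M * E) + D * (64 * R ^ 3 * E) := by
      have h3 : ∀ j ∈ Finset.range J, (M * E' / 4 ^ j + 1) * (D * (2 ^ 3) ^ j) =
          D * (M * E') * 2 ^ j + D * 8 ^ j := by
        intro j _
        have : (2 ^ 3 : ℝ) ^ j = 4 ^ j * 2 ^ j := by rw [← mul_pow]; norm_num
        have h8 : (8 : ℝ) ^ j = 4 ^ j * 2 ^ j := by rw [← mul_pow]; norm_num
        rw [this, h8]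
        field_simp
      rw [Finset.sum_congr rfl h3, Finset.sum_add_distrib, ← Finset.mul_sum, ← Finset.mul_sum]
      have h4 := sum_pow_range_le (b := 2) (by norm_num) J
      have h4' := sum_pow_range_le (b := 8) (by norm_num) J
      have h5 : (8 : ℝ) ^ J ≤ 64 * R ^ 3 * E := by
        calc (8 : ℝ) ^ J = (2 ^ J) ^ 3 := by rw [← pow_mul, mul_comm, pow_mul]; norm_num
          _ ≤ (4 * R / δ) ^ 3 := by gcongr
          _ = 64 * R ^ 3 * (1 / δ ^ 3) := by ring
          _ ≤ _ := by gcongr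
      have h6 := mul_le_mul_of_nonneg_left (h4'.trans h5) hD
      have h7 : D * (M * E') * ∑ j ∈ Finset.range J, 2 ^ j ≤ D * (4 * R * M * E) := by
        calc D * (M * E') * ∑ j ∈ Finset.range J, 2 ^ j ≤ D * (M * E') * (4 * R / δ) := by
              gcongr
              exact h4.trans hJ
          _ = D * (4 * R * M * E) := by
              rw [hE, hE']
              field_simp
      linarith
    have h7 : (1 : ℝ) ≤ E := by simpa using e1
    have h8 : M * E' ≤ M * (1 / l0 * (lam * E)) := by gcongr; linarith
    have h9 : D * (64 * R ^ 3 * E) ≤ D * (64 * R ^ 3 * (1 / l0 * (lam * E))) := by gcongr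
    have h10 : D * (4 * R * M * E) ≤ D * (4 * R * M * (1 / l0 * (lam * E))) := by gcongr
    linarith

theorem exists_reading_budget {d : ℕ} (hd : 2 ≤ d) {δ₀ C : ℝ} (h0 : 0 < δ₀)
    (h1 : δ₀ < 1) : ∃ K : ℝ, ∀ (δ p : ℝ) (n : ℕ), 0 < δ → δ < δ₀ → 0 ≤ p → p < 1 →
      (n : ℝ) ≤ C / δ → (n : ℝ) * n ≤ K * (Real.log (1 / δ) / ((1 - p) * δ ^ d)) := by
  set l0 := Real.log (1 / δ₀) with hl0
  have hl0pos : 0 < l0 := Real.log_pos (by rw [lt_div_iff₀ h0]; linarith)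
  refine ⟨C ^ 2 / l0, fun δ p n hδ hδ0 hp hp1 hn => ?_⟩
  have hq : 0 < 1 - p := by linarith
  have hpow : δ ^ d ≤ δ ^ 2 := pow_le_pow_of_le_one hδ.le (by linarith) hd
  have hl : l0 ≤ Real.log (1 / δ) :=
    Real.log_le_log (by positivity) (one_div_le_one_div_of_le hδ hδ0.le)
  have hle : (1 - p) * δ ^ d ≤ δ ^ 2 := by
    have : 0 < δ ^ d := by positivity
    nlinarith
  calc (n : ℝ) * n ≤ (C / δ) * (C / δ) := by
        have := (Nat.cast_nonneg n).trans hn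
        gcongr
    _ = C ^ 2 / l0 * (l0 / δ ^ 2) := by field_simp
    _ ≤ C ^ 2 / l0 * (Real.log (1 / δ) / ((1 - p) * δ ^ d)) := by
        gcongr
        exact hl0pos.le.trans hl

/-! ### From a local formula for the distance to an estimator -/

/-- The distance to a property can be computed by reading the whole input. -/
theorem exists_exact_algorithm {n : ℕ} (P : SimpleGraph (Fin n) → Prop) :
    ∃ T : QueryAlg n, ∀ (G : SimpleGraph (Fin n)) (L : IncidenceLists G),
      T.run L = distanceTo P G ∧ T.queries L ≤ n * n := by
  have h := (QueryComputable.family (c := fun _ => n) ([] : List (Fin n)) Finset.univ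
    fun v : Fin n => QueryComputable.take v n).map
    fun N => (distanceTo P (SimpleGraph.fromRel fun v w => w ∈ N v) : ℝ)
  obtain ⟨T, hT⟩ := h.exists_queryAlg
  refine ⟨T, fun G L => ⟨(hT G L).1.trans ?_, by simpa using (hT G L).2⟩⟩
  congr 2
  ext v w
  have htake : ∀ v, (L.nbrs v).take n = L.nbrs v := fun v =>
    List.take_of_length_le (by simpa using (L.nodup v).length_le_card)
  simp only [SimpleGraph.fromRel_adj, Finset.mem_univ, if_true, htake, L.mem_nbrs]
  constructor
  · rintro ⟨-, h | h⟩
    exacts [h, h.symm]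
  · exact fun h => ⟨h.ne, Or.inl h⟩

/-- The error `δ n` is divided into three equal parts: for sampling, for the omitted large sets and
for the constant `C` of the distance formula. -/
theorem exists_estimator {P : ∀ n, SimpleGraph (Fin n) → Prop} {k d D : ℕ} {B C δ₀ : ℝ}
    (hd : d = 2 ∨ d = 3) (hB : 0 ≤ B) (W : ∀ n, LocalWeight n k B)
    (srch : ∀ n, (Fin n → Finset (Fin n)) → Fin n → ℕ → Finset (Fin n)) (a b : ℕ → ℕ)
    (hsub : ∀ n N v X t, IsVertexExtreme N v X → X.card ≤ t → outCut N X < k → X ⊆ srch n N v t)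
    (hcomp : ∀ (n c : ℕ) (N : (Fin n → List (Fin n)) → Fin n → Finset (Fin n)),
      (∀ v, QueryComputable c fun L => N L v) → ∀ v t,
        QueryComputable (a t * c) fun L => srch n (N L) v t)
    (hcard : ∀ n N v t, (srch n N v t).card ≤ b t)
    (hcost : ∀ j, (a (2 ^ (j + 1)) + b (2 ^ (j + 1))) * (2 ^ (j + 1) + k) ≤ D * (2 ^ d) ^ j)
    (x : ∀ n, Fin n → (Fin n → List (Fin n)) → ℝ) (hx : ∀ n v, QueryComputable 1 (x n v))
    (hx1 : ∀ n v N, |x n v N| ≤ 1)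
    (hdist : ∀ n, 1 ≤ n → (∃ H, P n H) → ∀ (G : SimpleGraph (Fin n)) (L : IncidenceLists G),
      |∑ X, (W n).w (allNbrs L.nbrs) X + ∑ v, x n v L.nbrs - distanceTo (P n) G| ≤ C)
    (h0 : 0 < δ₀) (h1 : δ₀ < 1)
    (hmax : ∀ n, 1 ≤ n → (∃ H, P n H) → ∀ G : SimpleGraph (Fin n),
      (distanceTo (P n) G : ℝ) ≤ 2 * (δ₀ * n)) :
    ∃ A : Estimator, A.EstimatesDistanceTo P ∧
      A.HasQueryComplexity (fun δ p => Real.log (1 / δ) / ((1 - p) * δ ^ d)) := by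
  classical
  -- The factor `9` belongs to the sampling error `δ n / 3`; the other factor bounds the second
  -- moments of `x` and of the scaled shares.
  set M : ℝ := 9 * (1 + (k * B) ^ 2) with hM
  -- With `2 ^ J ≥ R / δ` the omitted sets contribute at most `δ n / 3`.
  set R : ℝ := 3 * (k * B) + 1 with hR
  have hkB : 0 ≤ k * B := by positivity
  obtain ⟨K₁, hK₁⟩ := exists_sampling_budget (M := M) (R := R) (D := D) hd h0 h1 (by linarith)
    (by positivity) (by positivity)
  obtain ⟨K₂, hK₂⟩ := exists_reading_budget (d := d) (C := 3 * C) (by omega) h0 h1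
  -- the algorithm for given parameters
  have main : ∀ (δ p : ℝ) (n : ℕ), ∃ A : RandomizedQueryAlg n,
      0 < δ → δ ≤ 1 → 0 ≤ p → p < 1 → 1 ≤ n →
      ((∃ H, P n H) → ∀ (G : SimpleGraph (Fin n)) (L : IncidenceLists G),
        ENNReal.ofReal p ≤ (A.outputLaw L).toMeasure
          {x : ℝ | |x - (distanceTo (P n) G : ℝ)| ≤ δ * (n : ℝ)}) ∧
      ∀ (G : SimpleGraph (Fin n)) (L : IncidenceLists G), ∀ T ∈ A.support,
        (T.queries L : ℝ) ≤ max K₁ K₂ * (Real.log (1 / δ) / ((1 - p) * δ ^ d)) := by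
    intro δ p n
    by_cases hpar : 0 < δ ∧ δ ≤ 1 ∧ 0 ≤ p ∧ p < 1 ∧ 1 ≤ n
    swap
    · exact ⟨PMF.pure (.output 0), fun h2 h3 h4 h5 h6 => absurd ⟨h2, h3, h4, h5, h6⟩ hpar⟩
    obtain ⟨hδ, hδ1, hp, hp1, hn⟩ := hpar
    have hmeas : ∀ y : ℝ, MeasurableSet {x : ℝ | |x - y| ≤ δ * (n : ℝ)} := fun y =>
      measurableSet_le (by fun_prop) (by fun_prop)
    have hu0 : 0 ≤ Real.log (1 / δ) / ((1 - p) * δ ^ d) := by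
      have : 0 ≤ Real.log (1 / δ) := Real.log_nonneg (by rw [le_div_iff₀ hδ]; linarith)
      have : 0 < 1 - p := by linarith
      positivity
    have hdet : ∀ (T : QueryAlg n) {G : SimpleGraph (Fin n)} (L : IncidenceLists G),
        T.run L ∈ {x : ℝ | |x - (distanceTo (P n) G : ℝ)| ≤ δ * (n : ℝ)} →
        ENNReal.ofReal p ≤ (RandomizedQueryAlg.outputLaw (PMF.pure T) L).toMeasure
          {x : ℝ | |x - (distanceTo (P n) G : ℝ)| ≤ δ * (n : ℝ)} := by
      intro T G L hT
      rw [RandomizedQueryAlg.outputLaw, PMF.pure_map, PMF.toMeasure_pure_apply _ _ (hmeas _),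
        if_pos hT]
      exact ENNReal.ofReal_le_one.2 hp1.le
    -- The distance lies between `0` and `2 δ₀ n`, so the midpoint is accurate enough. No query is
    -- allowed here, as the bound vanishes at `δ = 1`.
    by_cases hbig : δ₀ ≤ δ
    · refine ⟨PMF.pure (.output (δ₀ * n)), fun _ _ _ _ _ => ⟨fun hP G L => hdet _ L ?_, ?_⟩⟩
      · have h2 := hmax n hn hP G
        have h3 : δ₀ * n ≤ δ * n := by gcongr
        simp only [QueryAlg.run, Set.mem_ofPred_eq]
        rw [abs_le]
        constructor <;> [skip; have h4 : (0 : ℝ) ≤ distanceTo (P n) G := Nat.cast_nonneg _] <;>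
          linarith
      · intro G L T hT
        rw [PMF.support_pure, Set.mem_singleton_iff] at hT
        subst hT
        simp only [QueryAlg.queries, Nat.cast_zero]
        -- A negative constant would contradict the sampling budget with `J = 0`, whose left side is
        -- positive.
        by_cases hK : 0 ≤ max K₁ K₂
        · positivity
        · exfalso
          have h2 := hK₂ (δ₀ / 2) 0 0 (by linarith) (by linarith) le_rfl one_pos
          have h3 := hK₁ (δ₀ / 2) 0 0 (by linarith) (by linarith) le_rfl one_pos (by
            rw [le_div_iff₀ (by linarith)]; simp; linarith)
          simp only [Finset.range_zero, Finset.sum_empty, add_zero] at h3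
          have h4 : 0 ≤ Real.log (1 / (δ₀ / 2)) / ((1 - 0) * (δ₀ / 2) ^ d) := by
            have : 0 ≤ Real.log (1 / (δ₀ / 2)) := Real.log_nonneg (by
              rw [le_div_iff₀ (by linarith)]; linarith)
            rw [sub_zero, one_mul]
            positivity
          have h5 : 0 < M / ((1 - 0) * (δ₀ / 2) ^ 2) + 1 := by
            rw [sub_zero, one_mul]; positivity
          have h6 := le_max_left K₁ K₂
          nlinarith
    push Not at hbig
    -- Here `C` may exceed `δ n / 3`, but the whole graph can be read within the budget.
    by_cases hsmall : (n : ℝ) ≤ 3 * C / δ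
    · obtain ⟨T, hT⟩ := exists_exact_algorithm (P n)
      refine ⟨PMF.pure T, fun _ _ _ _ _ => ⟨fun hP G L => hdet _ L ?_, ?_⟩⟩
      · simp only [(hT G L).1, Set.mem_ofPred_eq, sub_self, abs_zero]
        positivity
      · intro G L U hU
        rw [PMF.support_pure, Set.mem_singleton_iff] at hU
        subst hU
        calc (U.queries L : ℝ) ≤ n * n := by exact_mod_cast (hT G L).2
          _ ≤ K₂ * (Real.log (1 / δ) / ((1 - p) * δ ^ d)) := hK₂ δ p n hδ hbig hp hp1 hsmall
          _ ≤ _ := by gcongr; exact le_max_right _ _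
    push Not at hsmall
    have : NeZero n := ⟨by omega⟩
    have hn0 : (0 : ℝ) < n := by exact_mod_cast hn
    have hq : 0 < 1 - p := by linarith
    set σ : ℝ := M / ((1 - p) * δ ^ 2) with hσ
    have hσpos : 0 < σ := by positivity
    set J := Nat.log 2 ⌈R / δ⌉₊ + 1 with hJ
    have hR1 : 1 ≤ R := by linarith
    have hRδ : 1 ≤ R / δ := by rw [le_div_iff₀ hδ]; linarith
    have hJ1 : R / δ ≤ (2 : ℝ) ^ J := by
      have h2 := Nat.lt_pow_succ_log_self (b := 2) (by norm_num) ⌈R / δ⌉₊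
      calc R / δ ≤ ⌈R / δ⌉₊ := Nat.le_ceil _
        _ ≤ (2 ^ J : ℕ) := by exact_mod_cast h2.le
        _ = 2 ^ J := by push_cast; rfl
    have hJ2 : (2 : ℝ) ^ J ≤ 4 * R / δ := by
      have h2 : 2 ^ Nat.log 2 ⌈R / δ⌉₊ ≤ ⌈R / δ⌉₊ :=
        Nat.pow_log_le_self 2 (Nat.ceil_pos.2 (by linarith)).ne'
      have h3 : ((2 ^ Nat.log 2 ⌈R / δ⌉₊ : ℕ) : ℝ) ≤ ⌈R / δ⌉₊ := by exact_mod_cast h2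
      have h4 := Nat.ceil_lt_add_one (by linarith : 0 ≤ R / δ)
      push_cast at h3
      rw [hJ, pow_succ, mul_div_assoc]
      linarith
    choose f hf using fun j v => (W n).exists_queryComputable_share (srch n) a b (hsub n)
      (hcomp n) (hcard n) j v
    let F (i : Option (Fin J)) (v : Fin n) (N : Fin n → List (Fin n)) : ℝ :=
      match i with
      | none => x n v N
      | some j => f j v N
    let c (i : Option (Fin J)) : ℕ :=
      match i with
      | none => 1
      | some j => D * (2 ^ d) ^ (j : ℕ)
    let s (i : Option (Fin J)) : ℕ :=
      match i with
      | none => ⌈σ⌉₊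
      | some j => ⌈σ / 4 ^ (j : ℕ)⌉₊
    obtain ⟨A, hA1, hA2⟩ := exists_sampling_algorithm F c s
      (by
        rintro (_ | j)
        · exact Nat.ceil_pos.2 hσpos
        · exact Nat.ceil_pos.2 (by positivity))
      (by
        rintro (_ | j) v
        · exact hx n v
        · exact (hf j v).1.mono (hcost j)) id
    refine ⟨A, fun _ _ _ _ _ => ⟨fun hP G L => ?_, fun G L T hT => ?_⟩⟩
    · have hsymm := allNbrs_symm L
      have hshare : ∀ j v, f j v L.nbrs = (W n).share (allNbrs L.nbrs) j v :=
        fun j v => (hf j v).2 G L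
      refine hA2 G L (δ * n / 3) p (by positivity) ?_ _ (fun y hy => ?_) (hmeas _)
      · simp only [Fintype.sum_option, F, s]
        have hnone : (n / ⌈σ⌉₊ : ℝ) * ∑ v, x n v L.nbrs ^ 2 ≤ n / σ * n := by
          have h2 : ∑ v, x n v L.nbrs ^ 2 ≤ n := by
            calc ∑ v, x n v L.nbrs ^ 2 ≤ ∑ _v : Fin n, (1 : ℝ) := by
                  refine Finset.sum_le_sum fun v _ => ?_
                  rw [sq_le_one_iff_abs_le_one]
                  exact hx1 n v _
              _ = n := by simp
          have h3 := Nat.le_ceil σ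
          gcongr
        have hsome : ∑ j : Fin J, (n / ⌈σ / 4 ^ (j : ℕ)⌉₊ : ℝ) * ∑ v, f j v L.nbrs ^ 2 ≤
            n / σ * (n * (k * B) ^ 2) := by
          calc ∑ j : Fin J, (n / ⌈σ / 4 ^ (j : ℕ)⌉₊ : ℝ) * ∑ v, f j v L.nbrs ^ 2
              ≤ ∑ j : Fin J, n / σ * ∑ v, 4 ^ (j : ℕ) * f j v L.nbrs ^ 2 := by
                refine Finset.sum_le_sum fun j _ => ?_
                have h3 := Nat.le_ceil (σ / 4 ^ (j : ℕ))
                rw [← Finset.mul_sum, ← mul_assoc]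
                have h4 : (n / ⌈σ / 4 ^ (j : ℕ)⌉₊ : ℝ) ≤ n / σ * 4 ^ (j : ℕ) := by
                  calc (n / ⌈σ / 4 ^ (j : ℕ)⌉₊ : ℝ) ≤ n / (σ / 4 ^ (j : ℕ)) := by gcongr
                    _ = _ := by field_simp
                gcongr
            _ = n / σ * ∑ v, ∑ j ∈ Finset.range J,
                  4 ^ j * (W n).share (allNbrs L.nbrs) j v ^ 2 := by
                rw [← Finset.mul_sum, Finset.sum_comm]
                congr 1
                refine Finset.sum_congr rfl fun v _ => ?_
                simp only [hshare]
                rw [Fin.sum_univ_eq_sum_range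
                  (fun j => 4 ^ j * (W n).share (allNbrs L.nbrs) j v ^ 2)]
            _ ≤ n / σ * ∑ _v : Fin n, (k * B) ^ 2 := by
                gcongr with v
                exact (W n).sum_four_pow_mul_share_sq_le hsymm hB J v
            _ = _ := by simp
        refine (add_le_add hnone hsome).trans (le_of_eq ?_)
        rw [hσ, hM]
        field_simp
        ring
      · simp only [Fintype.sum_option, F, hshare] at hy
        rw [Fin.sum_univ_eq_sum_range
          (fun j => ∑ v, (W n).share (allNbrs L.nbrs) j v)] at hy
        have h2 := (W n).abs_sum_share_sub_le hsymm hB J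
        have h3 := hdist n hn hP G L
        have h4 : k * B * n / 2 ^ J ≤ δ * n / 3 := by
          rw [div_le_iff₀ (by positivity)]
          have h5 : 3 * (k * B) ≤ δ * 2 ^ J := by
            rw [div_le_iff₀ hδ] at hJ1
            linarith
          nlinarith
        have h6 : C ≤ δ * n / 3 := by
          rw [div_lt_iff₀ hδ] at hsmall
          linarith
        simp only [id, Set.mem_ofPred_eq]
        rw [abs_le] at *
        constructor <;> linarith
    · have h2 := hA1 T hT G L
      have h3 : (T.queries L : ℝ) ≤ ∑ j, (s j : ℝ) * c j := by exact_mod_cast h2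
      refine h3.trans ?_
      simp only [Fintype.sum_option, s, c, Nat.cast_one, mul_one]
      have h4 := hK₁ δ p J hδ hbig hp hp1 hJ2
      rw [← Fin.sum_univ_eq_sum_range
        (fun j => (M / ((1 - p) * δ ^ 2) / 4 ^ j + 1) * (D * (2 ^ d) ^ j))] at h4
      refine le_trans (add_le_add ?_ (Finset.sum_le_sum fun j _ => ?_))
        (h4.trans (mul_le_mul_of_nonneg_right (le_max_left _ _) hu0))
      · exact (Nat.ceil_lt_add_one hσpos.le).le
      · push_cast
        gcongr
        exact (Nat.ceil_lt_add_one (by positivity)).le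
  choose A hA using main
  refine ⟨A, fun δ p n h2 h3 h4 h5 h6 hP G L => (hA δ p n h2 h3 h4 h5 h6).1 hP G L,
    max K₁ K₂, fun δ p n h2 h3 h4 h5 h6 => (hA δ p n h2 h3 h4 h5 h6).2⟩

/-! ### Cuts, edits and covering demands -/

section Augmentation

variable {V : Type} [Fintype V] [DecidableEq V]

open Classical in
/-- The neighbourhoods of a graph. -/
noncomputable def nbr (G : SimpleGraph V) (v : V) : Finset V := {w | G.Adj v w}

theorem mem_nbr {G : SimpleGraph V} {v w : V} : w ∈ nbr G v ↔ G.Adj v w := by simp [nbr]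

theorem nbr_symm (G : SimpleGraph V) (x y : V) (h : y ∈ nbr G x) : x ∈ nbr G y := by
  rw [mem_nbr] at h ⊢
  exact h.symm

theorem outCut_mono {N N' : V → Finset V} (h : ∀ v, N v ⊆ N' v) (X : Finset V) :
    outCut N X ≤ outCut N' X :=
  Finset.sum_le_sum fun x _ => Finset.card_le_card (Finset.sdiff_subset_sdiff (h x) le_rfl)

theorem nbr_mono {G H : SimpleGraph V} (h : G ≤ H) (v : V) : nbr G v ⊆ nbr H v := by
  intro w hw
  rw [mem_nbr] at hw ⊢
  exact h hw

theorem outCut_compl {N : V → Finset V} (hN : ∀ x y, y ∈ N x → x ∈ N y) (X : Finset V) :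
    outCut N Xᶜ = outCut N X := by
  have : 2 * outCut N Xᶜ = 2 * outCut N X := by
    rw [two_mul_outCut hN, two_mul_outCut hN]
    simp only [Finset.mem_compl, not_iff_not]
  omega

/-! ### Edge connectivity in terms of cuts -/

theorem le_outCut_of_isEdgeConnected {G : SimpleGraph V} {k : ℕ} (h : G.IsEdgeConnected k)
    {X : Finset V} (hX : X.Nonempty) (hX' : X ≠ Finset.univ) : k ≤ outCut (nbr G) X := by
  by_contra hlt
  push Not at hlt
  obtain ⟨a, ha⟩ := hX
  obtain ⟨b, hb⟩ : ∃ b, b ∉ X := by simpa [Finset.eq_univ_iff_forall] using hX'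
  set s : Finset (Sym2 V) := (X.sigma fun x => nbr G x \ X).image fun p => s(p.1, p.2) with hs
  have hcard : (s : Set (Sym2 V)).encard < k := by
    rw [Set.encard_coe_eq_coe_finsetCard]
    have h1 : s.card ≤ outCut (nbr G) X := by
      rw [outCut, ← Finset.card_sigma]
      exact Finset.card_image_le
    exact_mod_cast lt_of_le_of_lt h1 hlt
  have hr := h a b hcard
  rw [SimpleGraph.reachable_iff_reflTransGen] at hr
  refine hb ?_
  clear hb
  induction hr with
  | refl => exact ha
  | @tail c d _ hcd ih =>
    by_contra hd
    rw [SimpleGraph.deleteEdges_adj] at hcd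
    refine hcd.2 ?_
    simp only [hs, Finset.coe_image, Set.mem_image, Finset.mem_coe]
    exact ⟨⟨c, d⟩, by simp [ih, hd, mem_nbr, hcd.1], rfl⟩

theorem isEdgeConnected_of_le_outCut {G : SimpleGraph V} {k : ℕ}
    (h : ∀ X : Finset V, X.Nonempty → X ≠ Finset.univ → k ≤ outCut (nbr G) X) :
    G.IsEdgeConnected k := by
  classical
  intro u v s hs
  by_contra hv
  set X : Finset V := {w | (G.deleteEdges s).Reachable u w} with hX
  have hXmem (w : V) : w ∈ X ↔ (G.deleteEdges s).Reachable u w := by simp [hX]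
  have h1 := h X ⟨u, (hXmem u).2 (SimpleGraph.Reachable.refl u)⟩ fun hu =>
    hv ((hXmem v).1 (hu ▸ Finset.mem_univ v))
  rw [outCut, ← Finset.card_sigma] at h1
  have h2 : ((X.sigma fun x => nbr G x \ X : Finset (Σ _ : V, V)) : Set (Σ _ : V, V)).encard ≤
      s.encard := by
    refine Set.encard_le_encard_of_injOn (f := fun p => s(p.1, p.2)) ?_ ?_
    · rintro ⟨a, b⟩ hab
      simp only [Finset.mem_coe, Finset.mem_sigma, Finset.mem_sdiff, mem_nbr] at hab
      by_contra hn
      refine hab.2.2 ((hXmem b).2 (((hXmem a).1 hab.1).trans ?_))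
      refine SimpleGraph.Adj.reachable ?_
      rw [SimpleGraph.deleteEdges_adj]
      exact ⟨hab.2.1, hn⟩
    · rintro ⟨a, b⟩ hab ⟨c, d⟩ hcd heq
      simp only [Finset.mem_coe, Finset.mem_sigma, Finset.mem_sdiff] at hab hcd
      simp only [Sym2.eq_iff] at heq
      rcases heq with ⟨rfl, rfl⟩ | ⟨rfl, rfl⟩
      · rfl
      · exact absurd hab.1 hcd.2.2
  rw [Set.encard_coe_eq_coe_finsetCard] at h2
  have h3 := lt_of_le_of_lt h2 hs
  have : (X.sigma fun x => nbr G x \ X).card < k := by exact_mod_cast h3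
  omega

/-! ### Edit distance -/

theorem editCount_triangle (G H K : SimpleGraph V) :
    editCount G K ≤ editCount G H + editCount H K := by
  unfold editCount
  refine (Set.ncard_le_ncard ?_ (Set.toFinite _)).trans (Set.ncard_union_le _ _)
  exact symmDiff_triangle _ _ _

theorem editCount_sup_fromEdgeSet_le (G : SimpleGraph V) (A : Finset (Sym2 V)) :
    editCount G (G ⊔ SimpleGraph.fromEdgeSet (A : Set (Sym2 V))) ≤ A.card := by
  unfold editCount
  rw [← Set.ncard_coe_finset]
  refine Set.ncard_le_ncard ?_ (Set.toFinite _)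
  intro e he
  rw [Set.mem_symmDiff, SimpleGraph.edgeSet_sup, SimpleGraph.edgeSet_fromEdgeSet] at he
  rcases he with ⟨h1, h2⟩ | ⟨h1, h2⟩
  · exact absurd (Or.inl h1) h2
  · rcases h1 with h1 | h1
    · exact absurd h1 h2
    · exact h1.1

theorem distanceTo_le {P : SimpleGraph V → Prop} {G H : SimpleGraph V} (h : P H) :
    distanceTo P G ≤ editCount G H :=
  Nat.sInf_le ⟨H, h, rfl⟩

theorem exists_editCount_eq_distanceTo {P : SimpleGraph V → Prop} (h : ∃ H, P H)
    (G : SimpleGraph V) : ∃ H, P H ∧ editCount G H = distanceTo P G := by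
  obtain ⟨H, hH⟩ := h
  have hne : {m : ℕ | ∃ H : SimpleGraph V, P H ∧ editCount G H = m}.Nonempty := ⟨_, H, hH, rfl⟩
  exact Nat.sInf_mem hne

/-! ### Lower bound -/

theorem sum_card_nbr_sdiff_le (G H : SimpleGraph V) :
    ∑ v, (nbr H v \ nbr G v).card ≤ 2 * editCount G H := by
  classical
  have h1 := (H \ G).sum_degrees_eq_twice_card_edges
  have h2 : ∀ v, (nbr H v \ nbr G v).card = (H \ G).degree v := by
    intro v
    rw [← SimpleGraph.card_neighborFinset_eq_degree]
    congr 1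
    ext w
    simp [mem_nbr]
  simp only [h2, h1]
  gcongr
  rw [editCount, ← Set.ncard_coe_finset, SimpleGraph.coe_edgeFinset, SimpleGraph.edgeSet_sdiff]
  refine Set.ncard_le_ncard ?_ (Set.toFinite _)
  intro e he
  exact Or.inr he

theorem outCut_le_add_sum_sdiff (N N' : V → Finset V) (X : Finset V) :
    outCut N' X ≤ outCut N X + ∑ x ∈ X, (N' x \ N x).card := by
  rw [outCut, outCut, ← Finset.sum_add_distrib]
  refine Finset.sum_le_sum fun x _ => ?_
  refine (Finset.card_le_card ?_).trans (Finset.card_union_le _ _)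
  intro y hy
  simp only [Finset.mem_union, Finset.mem_sdiff] at hy ⊢
  tauto

/-- The gains sum to the demands of disjoint sets. The demand of each proper set is met by ends of
new edges inside it, and every new edge has two ends. The extra `k` pays for the family consisting
of the whole node set, whose demand is never met. -/
theorem sum_gain_le_of_cuts {k : ℕ} {G H : SimpleGraph V}
    (hH : ∀ X : Finset V, X.Nonempty → X ≠ Finset.univ → k ≤ outCut (nbr H) X) :
    ∑ X, gain (outCut (nbr G)) k X ≤ 2 * editCount G H + k := by
  classical
  obtain ⟨S, hS, hd, hs⟩ := exists_pairwiseDisjoint_sum_eq_sum_gain (h := outCut (nbr G)) (k := k)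
    (outCut_sdiff_add_outCut_sdiff_le (nbr_symm G))
    {X | IsExtreme (outCut (nbr G)) k X} (by simp) (by simp)
  have htot : ∑ X, gain (outCut (nbr G)) k X =
      ∑ X with IsExtreme (outCut (nbr G)) k X, gain (outCut (nbr G)) k X := by
    symm
    refine Finset.sum_subset (Finset.subset_univ _) fun X _ hX => gain_of_not_isExtreme ?_
    simpa using hX
  rw [htot, ← hs]
  have hSn : ∀ X ∈ S, X.Nonempty := fun X hX => (Finset.mem_filter.1 (hS hX)).2.1
  by_cases hU : Finset.univ ∈ S
  · have hS1 : S = {Finset.univ} := by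
      refine Finset.eq_singleton_iff_unique_mem.2 ⟨hU, fun X hX => ?_⟩
      by_contra hne
      obtain ⟨x, hx⟩ := hSn X hX
      exact Finset.disjoint_left.1 (hd hX hU hne) hx (Finset.mem_univ x)
    rw [hS1, Finset.sum_singleton]
    omega
  · calc ∑ X ∈ S, (k - outCut (nbr G) X)
        ≤ ∑ X ∈ S, ∑ x ∈ X, (nbr H x \ nbr G x).card := by
          refine Finset.sum_le_sum fun X hX => ?_
          have h1 := hH X (hSn X hX) fun h => hU (h ▸ hX)
          have h2 := outCut_le_add_sum_sdiff (nbr G) (nbr H) X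
          omega
      _ = ∑ x ∈ S.biUnion id, (nbr H x \ nbr G x).card := by
          rw [Finset.sum_biUnion hd]
          rfl
      _ ≤ ∑ x, (nbr H x \ nbr G x).card := Finset.sum_le_sum_of_subset (Finset.subset_univ _)
      _ ≤ 2 * editCount G H := sum_card_nbr_sdiff_le G H
      _ ≤ _ := by omega

theorem sum_gain_le (G : SimpleGraph V) (k : ℕ) :
    ∑ X, gain (outCut (nbr G)) k X ≤ k * Fintype.card V := by
  classical
  obtain ⟨S, hS, hd, hs⟩ := exists_pairwiseDisjoint_sum_eq_sum_gain (h := outCut (nbr G)) (k := k)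
    (outCut_sdiff_add_outCut_sdiff_le (nbr_symm G))
    {X | IsExtreme (outCut (nbr G)) k X} (by simp) (by simp)
  have htot : ∑ X, gain (outCut (nbr G)) k X =
      ∑ X with IsExtreme (outCut (nbr G)) k X, gain (outCut (nbr G)) k X := by
    symm
    refine Finset.sum_subset (Finset.subset_univ _) fun X _ hX => gain_of_not_isExtreme ?_
    simpa using hX
  rw [htot, ← hs]
  calc ∑ X ∈ S, (k - outCut (nbr G) X) ≤ ∑ X ∈ S, k * X.card := by
        refine Finset.sum_le_sum fun X hX => ?_
        have : 0 < X.card := Finset.card_pos.2 (Finset.mem_filter.1 (hS hX)).2.1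
        have : k * 1 ≤ k * X.card := Nat.mul_le_mul_left _ this
        omega
    _ = k * (S.biUnion id).card := by rw [← Finset.mul_sum, Finset.card_biUnion hd]; rfl
    _ ≤ _ := Nat.mul_le_mul_left _ (Finset.card_le_univ _)

/-! ### Demands -/

/-- Every cut of `G` becomes at least `k` if `m v` edges from an additional node to `v` are added
for every node `v`. -/
def Covers (k : ℕ) (G : SimpleGraph V) (m : V → ℕ) : Prop :=
  ∀ X : Finset V, X.Nonempty → X ≠ Finset.univ → k ≤ outCut (nbr G) X + ∑ v ∈ X, m v

/-- A set is tight if its cut is exactly `k` when the edges to the additional node are counted. -/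
def IsTight (k : ℕ) (G : SimpleGraph V) (m : V → ℕ) (X : Finset V) : Prop :=
  X.Nonempty ∧ X ≠ Finset.univ ∧ outCut (nbr G) X + ∑ v ∈ X, m v = k

/-- With the total demand minimal, a positive demand that lay in no tight set could be lowered by
one. -/
theorem exists_minimal_covers (k : ℕ) (G : SimpleGraph V) :
    ∃ m : V → ℕ, Covers k G m ∧ ∀ v, 0 < m v → ∃ X, IsTight k G m X ∧ v ∈ X := by
  classical
  have hne : ∃ s, ∃ m : V → ℕ, Covers k G m ∧ ∑ v, m v = s := by
    refine ⟨_, fun _ => k, fun X hX _ => ?_, rfl⟩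
    have : 0 < X.card := Finset.card_pos.2 hX
    rw [Finset.sum_const, smul_eq_mul]
    have : 1 * k ≤ X.card * k := Nat.mul_le_mul_right _ this
    omega
  obtain ⟨m, hm, hsum⟩ := Nat.find_spec hne
  refine ⟨m, hm, fun v hv => ?_⟩
  by_contra hcon
  push Not at hcon
  have hupd (X : Finset V) : ∑ w ∈ X, Function.update m v (m v - 1) w + (if v ∈ X then 1 else 0) =
      ∑ w ∈ X, m w := by
    split_ifs with h
    · have h1 : ∑ w ∈ X.erase v, Function.update m v (m v - 1) w = ∑ w ∈ X.erase v, m w :=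
        Finset.sum_congr rfl fun w hw => by
          rw [Function.update_of_ne (Finset.ne_of_mem_erase hw)]
      have h2 := Finset.add_sum_erase X (fun w => Function.update m v (m v - 1) w) h
      have h3 := Finset.add_sum_erase X (fun w => m w) h
      simp only [Function.update_self] at h2
      omega
    · rw [add_zero]
      refine Finset.sum_congr rfl fun w hw => ?_
      rw [Function.update_of_ne]
      rintro rfl
      exact h hw
  refine Nat.find_min hne (m := ∑ w, Function.update m v (m v - 1) w) ?_ ⟨_, ?_, rfl⟩
  · have h := hupd Finset.univ
    simp only [Finset.mem_univ, if_true] at h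
    rw [← hsum]
    omega
  · intro X hX hX'
    have h1 := hm X hX hX'
    have h2 := hupd X
    change k ≤ outCut (nbr G) X + ∑ w ∈ X, Function.update m v (m v - 1) w
    split_ifs at h2 with h
    · have h3 : outCut (nbr G) X + ∑ w ∈ X, m w ≠ k := fun h4 => hcon X ⟨hX, hX', h4⟩ h
      omega
    · omega

/-- Uncrossing by submodularity. -/
theorem IsTight.union {k : ℕ} {G : SimpleGraph V} {m : V → ℕ} (hm : Covers k G m)
    {X Y : Finset V} (hX : IsTight k G m X) (hY : IsTight k G m Y) (hXY : (X ∩ Y).Nonempty)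
    (hU : X ∪ Y ≠ Finset.univ) : IsTight k G m (X ∪ Y) := by
  refine ⟨hX.1.mono Finset.subset_union_left, hU, ?_⟩
  have h1 := hm (X ∩ Y) hXY fun h => hX.2.1 (Finset.univ_subset_iff.1
    (h ▸ Finset.inter_subset_left))
  have h2 := hm (X ∪ Y) (hX.1.mono Finset.subset_union_left) hU
  have h3 := outCut_inter_add_outCut_union_le (nbr_symm G) X Y
  have h4 := Finset.sum_union_inter (s₁ := X) (s₂ := Y) (f := m)
  have h5 := hX.2.2
  have h6 := hY.2.2
  omega

/-- When the union is everything, submodularity gives nothing, but posimodularity does, and it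
leaves no demand in the intersection. -/
theorem IsTight.sdiff {k : ℕ} {G : SimpleGraph V} {m : V → ℕ} (hm : Covers k G m)
    {X Y : Finset V} (hX : IsTight k G m X) (hY : IsTight k G m Y)
    (hU : X ∪ Y = Finset.univ) : IsTight k G m (X \ Y) ∧ IsTight k G m (Y \ X) ∧
      ∑ v ∈ X ∩ Y, m v = 0 := by
  have key : ∀ A B : Finset V, A ∪ B = Finset.univ → B ≠ Finset.univ → A ≠ Finset.univ →
      (A \ B).Nonempty ∧ A \ B ≠ Finset.univ := by
    intro A B h1 h2 h3
    refine ⟨Finset.sdiff_nonempty.2 fun h => h2 ?_, fun h => h3 ?_⟩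
    · rw [← h1, Finset.union_eq_right.2 h]
    · exact Finset.univ_subset_iff.1 (h ▸ Finset.sdiff_subset)
  obtain ⟨a1, a2⟩ := key X Y hU hY.2.1 hX.2.1
  obtain ⟨b1, b2⟩ := key Y X (by rw [Finset.union_comm, hU]) hX.2.1 hY.2.1
  have h1 := hm _ a1 a2
  have h2 := hm _ b1 b2
  have h3 := outCut_sdiff_add_outCut_sdiff_le (nbr_symm G) X Y
  have h4 := Finset.sum_inter_add_sum_sdiff X Y m
  have h5 := Finset.sum_inter_add_sum_sdiff Y X m
  rw [Finset.inter_comm Y X] at h5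
  have h6 := hX.2.2
  have h7 := hY.2.2
  exact ⟨⟨a1, a2, by omega⟩, ⟨b1, b2, by omega⟩, by omega⟩

/-- Among the families of tight sets that cover all positive demands, one of least total size is
disjoint, since uncrossing two intersecting members would make it smaller. On disjoint tight sets
the demands of the nodes sum to the demands of the sets. -/
theorem sum_le_sum_gain_of_minimal {k : ℕ} {G : SimpleGraph V} {m : V → ℕ} (hm : Covers k G m)
    (hmin : ∀ v, 0 < m v → ∃ X, IsTight k G m X ∧ v ∈ X) :
    ∑ v, m v ≤ ∑ X, gain (outCut (nbr G)) k X := by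
  classical
  let good (S : Finset (Finset V)) : Prop :=
    (∀ X ∈ S, IsTight k G m X) ∧ ∀ v, 0 < m v → ∃ X ∈ S, v ∈ X
  have hne : ∃ c, ∃ S, good S ∧ ∑ X ∈ S, X.card = c :=
    ⟨_, Finset.univ.filter (IsTight k G m), ⟨by simp, fun v hv => by simpa using hmin v hv⟩, rfl⟩
  obtain ⟨S, ⟨hS1, hS2⟩, hS3⟩ := Nat.find_spec hne
  have hleast : ∀ T, good T → ∑ X ∈ S, X.card ≤ ∑ X ∈ T, X.card := by
    intro T hT
    by_contra hlt
    push Not at hlt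
    exact Nat.find_min hne (hS3 ▸ hlt) ⟨T, hT, rfl⟩
  have hdisj : (S : Set (Finset V)).PairwiseDisjoint id := by
    intro X hX Y hY hne
    by_contra hnd
    rw [Function.onFun, id, id, Finset.not_disjoint_iff_nonempty_inter] at hnd
    have hY' : Y ∈ S.erase X := Finset.mem_erase.2 ⟨Ne.symm hne, hY⟩
    have hsum : ∑ Z ∈ S, Z.card = X.card + (Y.card + ∑ Z ∈ (S.erase X).erase Y, Z.card) := by
      rw [Finset.add_sum_erase _ _ hY', Finset.add_sum_erase _ _ hX]
    have hpos := Finset.card_pos.2 hnd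
    have hins : ∀ (A : Finset V) (T : Finset (Finset V)),
        ∑ Z ∈ insert A T, Z.card ≤ A.card + ∑ Z ∈ T, Z.card := by
      intro A T
      by_cases h : A ∈ T
      · rw [Finset.insert_eq_of_mem h]; omega
      · rw [Finset.sum_insert h]
    by_cases hU : X ∪ Y = Finset.univ
    · obtain ⟨t1, t2, t3⟩ := (hS1 X hX).sdiff hm (hS1 Y hY) hU
      have h1 := hleast (insert (X \ Y) (insert (Y \ X) ((S.erase X).erase Y))) ⟨?_, ?_⟩
      · have h2 := hins (X \ Y) (insert (Y \ X) ((S.erase X).erase Y))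
        have h3 := hins (Y \ X) ((S.erase X).erase Y)
        have h4 := Finset.card_sdiff_add_card_inter X Y
        have h5 := Finset.card_sdiff_add_card_inter Y X
        rw [Finset.inter_comm Y X] at h5
        omega
      · intro Z hZ
        simp only [Finset.mem_insert, Finset.mem_erase] at hZ
        rcases hZ with rfl | rfl | hZ
        exacts [t1, t2, hS1 Z hZ.2.2]
      · intro v hv
        obtain ⟨Z, hZ, hvZ⟩ := hS2 v hv
        have hvXY : ¬ (v ∈ X ∧ v ∈ Y) := by
          rintro ⟨h1, h2⟩
          have := Finset.sum_eq_zero_iff.1 t3 v (Finset.mem_inter.2 ⟨h1, h2⟩)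
          omega
        by_cases hZX : Z = X
        · subst hZX
          exact ⟨Z \ Y, by simp, by simp only [Finset.mem_sdiff]; tauto⟩
        · by_cases hZY : Z = Y
          · subst hZY
            exact ⟨Z \ X, by simp, by simp only [Finset.mem_sdiff]; tauto⟩
          · exact ⟨Z, by simp [hZX, hZY, hZ], hvZ⟩
    · have t := (hS1 X hX).union hm (hS1 Y hY) hnd hU
      have h1 := hleast (insert (X ∪ Y) ((S.erase X).erase Y)) ⟨?_, ?_⟩
      · have h2 := hins (X ∪ Y) ((S.erase X).erase Y)
        have h3 := Finset.card_union_add_card_inter X Y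
        omega
      · intro Z hZ
        simp only [Finset.mem_insert, Finset.mem_erase] at hZ
        rcases hZ with rfl | hZ
        exacts [t, hS1 Z hZ.2.2]
      · intro v hv
        obtain ⟨Z, hZ, hvZ⟩ := hS2 v hv
        by_cases hZX : Z = X
        · subst hZX
          exact ⟨Z ∪ Y, by simp, by simp [hvZ]⟩
        · by_cases hZY : Z = Y
          · subst hZY
            exact ⟨X ∪ Z, by simp, by simp [hvZ]⟩
          · exact ⟨Z, by simp [hZX, hZY, hZ], hvZ⟩
  calc ∑ v, m v ≤ ∑ v ∈ S.biUnion id, m v := by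
        refine (Finset.sum_subset (Finset.subset_univ _) fun v _ hv => ?_).ge
        by_contra h
        obtain ⟨X, hX, hvX⟩ := hS2 v (Nat.pos_of_ne_zero h)
        exact hv (Finset.mem_biUnion.2 ⟨X, hX, hvX⟩)
    _ = ∑ X ∈ S, ∑ v ∈ X, m v := by rw [Finset.sum_biUnion hdisj]; rfl
    _ = ∑ X ∈ S, (k - outCut (nbr G) X) := by
        refine Finset.sum_congr rfl fun X hX => ?_
        have := (hS1 X hX).2.2
        omega
    _ ≤ _ := sum_sub_le_sum_gain _ k S (fun X hX => (hS1 X hX).1) hdisj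

end Augmentation

/-! ### Splitting off -/

section Splitting

variable {V : Type} [Fintype V] [DecidableEq V]

/-- A set that does not allow to split off two edges between it and the additional node. -/
def IsDangerous (k : ℕ) (G : SimpleGraph V) (m : V → ℕ) (X : Finset V) : Prop :=
  X ≠ Finset.univ ∧ outCut (nbr G) X + ∑ v ∈ X, m v ≤ k + 1

/-- The inequality for three cuts, applied with demands included, yields `4 k + 2 q ≤ 3 (k + 1)`,
where `q ≥ m u ≥ 1` is the demand of the common intersection. This is impossible for `k ≥ 2`. -/
theorem not_three_dangerous {k : ℕ} (hk : 2 ≤ k) {G : SimpleGraph V} {m : V → ℕ}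
    (hm : Covers k G m) {u : V} (hu : 0 < m u) {X Y Z : Finset V} (hX : IsDangerous k G m X)
    (hY : IsDangerous k G m Y) (hZ : IsDangerous k G m Z) (uX : u ∈ X) (uY : u ∈ Y) (uZ : u ∈ Z)
    (hX' : (X \ (Y ∪ Z)).Nonempty) (hY' : (Y \ (X ∪ Z)).Nonempty)
    (hZ' : (Z \ (X ∪ Y)).Nonempty) : False := by
  have hne : ∀ A B : Finset V, u ∈ B → A \ B ≠ Finset.univ := by
    intro A B hB h
    exact (Finset.mem_sdiff.1 (h ▸ Finset.mem_univ u)).2 hB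
  have uI : u ∈ X ∩ Y ∩ Z := by simp [uX, uY, uZ]
  have h1 := hm _ hX' (hne _ _ (by simp [uY]))
  have h2 := hm _ hY' (hne _ _ (by simp [uX]))
  have h3 := hm _ hZ' (hne _ _ (by simp [uX]))
  have h4 := hm (X ∩ Y ∩ Z) ⟨u, uI⟩ fun h => hX.1 (Finset.univ_subset_iff.1
    (h ▸ Finset.inter_subset_left.trans Finset.inter_subset_left))
  have h5 := outCut_three_le (nbr_symm G) X Y Z
  have key : ∀ A B : Finset V, X ∩ Y ∩ Z ⊆ A → X ∩ Y ∩ Z ⊆ B →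
      ∑ v ∈ X ∩ Y ∩ Z, m v + ∑ v ∈ A \ B, m v ≤ ∑ v ∈ A, m v := by
    intro A B hA hB
    rw [← Finset.sum_union]
    · exact Finset.sum_le_sum_of_subset (Finset.union_subset hA Finset.sdiff_subset)
    · rw [Finset.disjoint_left]
      exact fun a ha ha' => (Finset.mem_sdiff.1 ha').2 (hB ha)
  have s1 : X ∩ Y ∩ Z ⊆ X := fun a => by simp only [Finset.mem_inter]; tauto
  have s2 : X ∩ Y ∩ Z ⊆ Y := fun a => by simp only [Finset.mem_inter]; tauto
  have s3 : X ∩ Y ∩ Z ⊆ Z := fun a => by simp only [Finset.mem_inter]; tauto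
  have h6 := key X (Y ∪ Z) s1 (s2.trans Finset.subset_union_left)
  have h7 := key Y (X ∪ Z) s2 (s1.trans Finset.subset_union_left)
  have h8 := key Z (X ∪ Y) s3 (s1.trans Finset.subset_union_left)
  have h9 : m u ≤ ∑ v ∈ X ∩ Y ∩ Z, m v :=
    Finset.single_le_sum (f := m) (fun _ _ => Nat.zero_le _) uI
  have h10 := hX.2
  have h11 := hY.2
  have h12 := hZ.2
  omega

theorem sum_biUnion_le_sum_sum {ι : Type*} [DecidableEq ι] (S : Finset ι) (f : ι → Finset V)
    (m : V → ℕ) : ∑ w ∈ S.biUnion f, m w ≤ ∑ i ∈ S, ∑ w ∈ f i, m w := by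
  induction S using Finset.induction_on with
  | empty => simp
  | insert i S hi ih =>
    rw [Finset.biUnion_insert, Finset.sum_insert hi]
    have := Finset.sum_union_inter (s₁ := f i) (s₂ := S.biUnion f) (f := m)
    omega

/-- The total demand of the nodes that are contained in a dangerous set with a given node. -/
theorem sum_dangerous_le {k : ℕ} (hk : 2 ≤ k) {G : SimpleGraph V} {m : V → ℕ}
    (hm : Covers k G m) {u : V} (hu : 0 < m u) (T : Finset V)
    (hT : ∀ w ∈ T, ∃ X, IsDangerous k G m X ∧ u ∈ X ∧ w ∈ X) : ∑ w ∈ T, m w ≤ 2 * (k + 1) := by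
  classical
  let good (S : Finset (Finset V)) : Prop :=
    (∀ X ∈ S, IsDangerous k G m X ∧ u ∈ X) ∧ ∀ w ∈ T, ∃ X ∈ S, w ∈ X
  have hne : ∃ c, ∃ S, good S ∧ S.card = c :=
    ⟨_, Finset.univ.filter fun X => IsDangerous k G m X ∧ u ∈ X, ⟨by simp, fun w hw => by
      obtain ⟨X, h1, h2, h3⟩ := hT w hw
      exact ⟨X, by simp [h1, h2], h3⟩⟩, rfl⟩
  obtain ⟨S, ⟨hS1, hS2⟩, hS3⟩ := Nat.find_spec hne
  -- In a smallest covering family every member has a private node, so three members would have the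
  -- nonempty differences that `not_three_dangerous` excludes.
  have hpriv : ∀ X ∈ S, ∃ w ∈ X, ∀ Y ∈ S, Y ≠ X → w ∉ Y := by
    intro X hX
    by_contra hcon
    push Not at hcon
    refine Nat.find_min hne (m := (S.erase X).card) ?_ ⟨S.erase X, ⟨?_, ?_⟩, rfl⟩
    · rw [← hS3]
      exact Finset.card_erase_lt_of_mem hX
    · exact fun Y hY => hS1 Y (Finset.mem_of_mem_erase hY)
    · intro w hw
      obtain ⟨Y, hY, hwY⟩ := hS2 w hw
      by_cases hYX : Y = X
      · subst hYX
        obtain ⟨Z, hZ, hZY, hwZ⟩ := hcon w hwY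
        exact ⟨Z, Finset.mem_erase.2 ⟨hZY, hZ⟩, hwZ⟩
      · exact ⟨Y, Finset.mem_erase.2 ⟨hYX, hY⟩, hwY⟩
  have hcard : S.card ≤ 2 := by
    by_contra h
    push Not at h
    obtain ⟨X, Y, Z, hX, hY, hZ, hXY, hXZ, hYZ⟩ := Finset.two_lt_card_iff.1 h
    have key : ∀ A B C, A ∈ S → B ∈ S → C ∈ S → B ≠ A → C ≠ A → (A \ (B ∪ C)).Nonempty := by
      intro A B C hA hB hC hBA hCA
      obtain ⟨w, hw, hw'⟩ := hpriv A hA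
      exact ⟨w, by simp [hw, hw' B hB hBA, hw' C hC hCA]⟩
    exact not_three_dangerous hk hm hu (hS1 X hX).1 (hS1 Y hY).1 (hS1 Z hZ).1 (hS1 X hX).2
      (hS1 Y hY).2 (hS1 Z hZ).2 (key X Y Z hX hY hZ hXY.symm hXZ.symm)
      (key Y X Z hY hX hZ hXY hYZ.symm) (key Z X Y hZ hX hY hXZ hYZ)
  calc ∑ w ∈ T, m w ≤ ∑ w ∈ S.biUnion id, m w := Finset.sum_le_sum_of_subset fun w hw => by
        obtain ⟨X, hX, hwX⟩ := hS2 w hw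
        exact Finset.mem_biUnion.2 ⟨X, hX, hwX⟩
    _ ≤ ∑ X ∈ S, ∑ w ∈ X, m w := sum_biUnion_le_sum_sum S id m
    _ ≤ ∑ _X ∈ S, (k + 1) := Finset.sum_le_sum fun X hX => by
        have := (hS1 X hX).1.2
        omega
    _ ≤ 2 * (k + 1) := by
        rw [Finset.sum_const, smul_eq_mul]
        exact Nat.mul_le_mul_right _ hcard

/-- The bound on demands and on demands of neighbours that is kept while edges are split off. -/
def BoundedDemand (k : ℕ) (G : SimpleGraph V) (m : V → ℕ) : Prop :=
  (∀ v, m v ≤ k) ∧ ∀ u, 0 < m u → ∑ w ∈ nbr G u, m w + k * m u ≤ 2 * k * k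

/-- The total demand at which splitting off stops. -/
def demandThreshold (k : ℕ) : ℕ := 2 * (k + 1) + k + 2 * k * k

/-- For a fixed `u`, the partners ruled out are `u` itself, its neighbours and the nodes sharing a
dangerous set with it. Their demands are at most `k`, `2 k²` and `2 (k + 1)`, which is the
threshold. -/
theorem exists_splittable_pair {k : ℕ} (hk : 2 ≤ k) {G : SimpleGraph V} {m : V → ℕ}
    (hm : Covers k G m) (hb : BoundedDemand k G m) (hlarge : demandThreshold k < ∑ v, m v) :
    ∃ u w, u ≠ w ∧ ¬ G.Adj u w ∧ 0 < m u ∧ 0 < m w ∧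
      ∀ X : Finset V, u ∈ X → w ∈ X → X ≠ Finset.univ →
        k + 2 ≤ outCut (nbr G) X + ∑ v ∈ X, m v := by
  classical
  obtain ⟨u, hu⟩ : ∃ u, 0 < m u := by
    by_contra hcon
    push Not at hcon
    have : ∑ v, m v = 0 := Finset.sum_eq_zero fun v _ => Nat.le_zero.1 (hcon v)
    omega
  set T : Finset V := {w | ∃ X, IsDangerous k G m X ∧ u ∈ X ∧ w ∈ X} with hT
  have hsum := sum_dangerous_le hk hm hu T fun w hw => by simpa [hT] using hw
  have hnb := hb.2 u hu
  have hmu := hb.1 u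
  obtain ⟨w, hw1, hw2⟩ : ∃ w, 0 < m w ∧ w ∉ insert u (nbr G u ∪ T) := by
    by_contra hcon
    push Not at hcon
    have h1 : ∑ v, m v ≤ ∑ v ∈ insert u (nbr G u ∪ T), m v := by
      refine (Finset.sum_subset (Finset.subset_univ _) fun v _ hv => ?_).ge
      by_contra h
      exact hv (hcon v (Nat.pos_of_ne_zero h))
    have h2 : ∑ v ∈ insert u (nbr G u ∪ T), m v ≤ m u + ∑ v ∈ nbr G u ∪ T, m v := by
      by_cases h : u ∈ nbr G u ∪ T
      · rw [Finset.insert_eq_of_mem h]; omega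
      · rw [Finset.sum_insert h]
    have h3 := Finset.sum_union_inter (s₁ := nbr G u) (s₂ := T) (f := m)
    unfold demandThreshold at hlarge
    omega
  simp only [Finset.mem_insert, Finset.mem_union, not_or, mem_nbr, hT, Finset.mem_filter,
    Finset.mem_univ, true_and, not_exists, not_and] at hw2
  refine ⟨u, w, Ne.symm hw2.1, hw2.2.1, hu, hw1, fun X huX hwX hX => ?_⟩
  by_contra hlt
  exact hw2.2.2 X ⟨hX, by omega⟩ huX hwX

/-- The demand after an edge has been split off at `u`. -/
def decr (m : V → ℕ) (u : V) : V → ℕ := fun v => if v = u then m v - 1 else m v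

theorem sum_decr {m : V → ℕ} {u : V} (hu : 0 < m u) (X : Finset V) :
    ∑ v ∈ X, decr m u v + (if u ∈ X then 1 else 0) = ∑ v ∈ X, m v := by
  have h : ∀ v, decr m u v + (if v = u then 1 else 0) = m v := by
    intro v
    by_cases hv : v = u
    · subst hv; simp [decr]; omega
    · simp [decr, hv]
  rw [← Finset.sum_congr rfl fun v _ => h v, Finset.sum_add_distrib, Finset.sum_ite_eq']

theorem decr_le (m : V → ℕ) (u v : V) : decr m u v ≤ m v := by
  unfold decr; split_ifs <;> omega

/-- The graph with an additional edge. -/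
def addEdge (G : SimpleGraph V) (u w : V) : SimpleGraph V :=
  G ⊔ SimpleGraph.fromEdgeSet (({s(u, w)} : Finset (Sym2 V)) : Set (Sym2 V))

theorem addEdge_adj {G : SimpleGraph V} {u w a b : V} :
    (addEdge G u w).Adj a b ↔
      G.Adj a b ∨ (((a = u ∧ b = w) ∨ (a = w ∧ b = u)) ∧ a ≠ b) := by
  simp [addEdge, SimpleGraph.fromEdgeSet_adj]

theorem editCount_addEdge_le (G : SimpleGraph V) (u w : V) :
    editCount G (addEdge G u w) ≤ 1 := by
  exact (editCount_sup_fromEdgeSet_le G {s(u, w)}).trans (by simp)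

theorem le_addEdge (G : SimpleGraph V) (u w : V) : G ≤ addEdge G u w := le_sup_left

theorem outCut_addEdge {G : SimpleGraph V} {u w : V} (huw : ¬ G.Adj u w) {X : Finset V}
    (hu : u ∈ X) (hw : w ∉ X) : outCut (nbr G) X + 1 ≤ outCut (nbr (addEdge G u w)) X := by
  have hmono := nbr_mono (le_addEdge G u w)
  have hne : u ≠ w := fun h => hw (h ▸ hu)
  refine Finset.sum_lt_sum (fun x _ => Finset.card_le_card
    (Finset.sdiff_subset_sdiff (hmono x) le_rfl)) ⟨u, hu, Finset.card_lt_card ⟨?_, fun H => ?_⟩⟩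
  · exact Finset.sdiff_subset_sdiff (hmono u) le_rfl
  · have h1 : w ∈ nbr (addEdge G u w) u \ X := by
      rw [Finset.mem_sdiff, mem_nbr, addEdge_adj]
      exact ⟨Or.inr ⟨Or.inl ⟨rfl, rfl⟩, hne⟩, hw⟩
    have h2 := (Finset.mem_sdiff.1 (H h1)).1
    rw [mem_nbr] at h2
    exact huw h2

theorem addEdge_comm (G : SimpleGraph V) (u w : V) : addEdge G u w = addEdge G w u := by
  unfold addEdge
  rw [Sym2.eq_swap]

theorem nbr_addEdge_subset (G : SimpleGraph V) (u w : V) :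
    nbr (addEdge G u w) u ⊆ insert w (nbr G u) := by
  intro x hx
  rw [mem_nbr, addEdge_adj] at hx
  rw [Finset.mem_insert, mem_nbr]
  rcases hx with h | ⟨⟨-, h⟩ | ⟨h1, h2⟩, h3⟩
  · exact Or.inr h
  · exact Or.inl h
  · exact absurd h2.symm h3

theorem nbr_addEdge_of_ne (G : SimpleGraph V) {u w x : V} (hu : x ≠ u) (hw : x ≠ w) :
    nbr (addEdge G u w) x = nbr G x := by
  ext y
  rw [mem_nbr, mem_nbr, addEdge_adj]
  simp [hu, hw]

/-- Each inserted edge uses up two units of demand. The neighbour bound survives: a new neighbour of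
`u` adds at most `k` to the demand around `u`, while `k * m u` drops by `k`. -/
theorem exists_covers_of_splitting {k : ℕ} (hk : 2 ≤ k) (G : SimpleGraph V) (m : V → ℕ)
    (hm : Covers k G m) (hb : BoundedDemand k G m) :
    ∃ (G' : SimpleGraph V) (m' : V → ℕ), Covers k G' m' ∧ ∑ v, m' v ≤ demandThreshold k ∧
      2 * editCount G G' + ∑ v, m' v ≤ ∑ v, m v := by
  induction hs : ∑ v, m v using Nat.strong_induction_on generalizing G m with
  | _ s ih =>
    subst hs
    by_cases hsmall : ∑ v, m v ≤ demandThreshold k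
    · exact ⟨G, m, hm, hsmall, by simp [editCount]⟩
    push Not at hsmall
    obtain ⟨u, w, hne, hadj, hu, hw, hX⟩ := exists_splittable_pair hk hm hb hsmall
    set m' := decr (decr m u) w with hm'
    have hw' : 0 < decr m u w := by simpa [decr, Ne.symm hne] using hw
    have hsum (X : Finset V) : ∑ v ∈ X, m' v + (if w ∈ X then 1 else 0) +
        (if u ∈ X then 1 else 0) = ∑ v ∈ X, m v := by
      rw [hm', sum_decr hw', sum_decr hu]
    have hle : ∀ v, m' v ≤ m v := fun v => (decr_le _ _ _).trans (decr_le _ _ _)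
    have htot := hsum Finset.univ
    simp only [Finset.mem_univ, if_true] at htot
    have hm'u : m' u + 1 = m u := by
      simp [hm', decr, hne]
      omega
    have hm'w : m' w + 1 = m w := by simp [hm', decr, Ne.symm hne]; omega
    have hm1 : Covers k (addEdge G u w) m' := by
      intro X hXn hXu
      have h4 := hsum X
      have h5 := hm X hXn hXu
      have h6 := outCut_mono (nbr_mono (le_addEdge G u w)) X
      by_cases huX : u ∈ X <;> by_cases hwX : w ∈ X <;>
        simp only [huX, hwX, if_true, if_false] at h4
      · have := hX X huX hwX hXu
        omega
      · have := outCut_addEdge hadj huX hwX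
        omega
      · have := outCut_addEdge (fun h => hadj h.symm) hwX huX
        rw [addEdge_comm] at this
        omega
      · omega
    have hb1 : BoundedDemand k (addEdge G u w) m' := by
      refine ⟨fun v => (hle v).trans (hb.1 v), fun x hx => ?_⟩
      have key : ∀ a b, 0 < m a → m' a + 1 = m a → nbr (addEdge G u w) a ⊆ insert b (nbr G a) →
          ∑ y ∈ nbr (addEdge G u w) a, m' y + k * m' a ≤ 2 * k * k := by
        intro a b ha ha' hsub
        have h4 := hb.2 a ha
        have h5 : ∑ y ∈ nbr (addEdge G u w) a, m' y ≤ k + ∑ y ∈ nbr G a, m y := by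
          calc ∑ y ∈ nbr (addEdge G u w) a, m' y ≤ ∑ y ∈ insert b (nbr G a), m' y :=
                Finset.sum_le_sum_of_subset hsub
            _ ≤ ∑ y ∈ insert b (nbr G a), m y := Finset.sum_le_sum fun y _ => hle y
            _ ≤ m b + ∑ y ∈ nbr G a, m y := by
                by_cases h : b ∈ nbr G a
                · rw [Finset.insert_eq_of_mem h]; omega
                · rw [Finset.sum_insert h]
            _ ≤ _ := Nat.add_le_add_right (hb.1 b) _
        have h6 : k * m a = k * m' a + k := by rw [← ha']; ring
        omega
      by_cases hxu : x = u
      · subst hxu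
        exact key x w hu hm'u (nbr_addEdge_subset G x w)
      by_cases hxw : x = w
      · subst hxw
        refine key x u hw hm'w ?_
        rw [addEdge_comm]
        exact nbr_addEdge_subset G x u
      · rw [nbr_addEdge_of_ne G hxu hxw]
        have h4 := hb.2 x (lt_of_lt_of_le hx (hle x))
        have h5 : ∑ y ∈ nbr G x, m' y ≤ ∑ y ∈ nbr G x, m y := Finset.sum_le_sum fun y _ => hle y
        have h6 : k * m' x ≤ k * m x := Nat.mul_le_mul_left _ (hle x)
        omega
    obtain ⟨G', m'', h1, h2, h3⟩ := ih _ (by omega) (addEdge G u w) m' hm1 hb1 rfl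
    refine ⟨G', m'', h1, h2, ?_⟩
    have h4 := editCount_triangle G (addEdge G u w) G'
    have h5 := editCount_addEdge_le G u w
    omega

/-- A bounded demand can be met by a bounded number of edges. -/
theorem exists_le_outCut_of_covers {k : ℕ} (G : SimpleGraph V) (m : V → ℕ)
    (hm : Covers k G m) (hcard : k + 1 ≤ Fintype.card V) :
    ∃ H : SimpleGraph V, (∀ X : Finset V, X.Nonempty → X ≠ Finset.univ → k ≤ outCut (nbr H) X) ∧
      editCount G H ≤ (k + 1 + ∑ v, m v) * (k + 1) := by
  classical
  -- The `k + 1` nodes of `C` serve as hubs, joined to each other and to every node of positive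
  -- demand.
  obtain ⟨C, hC⟩ := Finset.exists_subset_card_eq (s := (Finset.univ : Finset V)) hcard
  set T : Finset V := {v | 0 < m v} with hT
  set A : Finset (Sym2 V) := ((C ∪ T) ×ˢ C).image fun p => s(p.1, p.2) with hA
  set H := G ⊔ SimpleGraph.fromEdgeSet (A : Set (Sym2 V)) with hH
  have hadj : ∀ a ∈ C ∪ T, ∀ c ∈ C, a ≠ c → c ∈ nbr H a := by
    intro a ha c hc hac
    rw [mem_nbr, hH, SimpleGraph.sup_adj, SimpleGraph.fromEdgeSet_adj]
    refine Or.inr ⟨?_, hac⟩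
    simp only [hA, Finset.coe_image, Set.mem_image, Finset.mem_coe]
    exact ⟨(a, c), Finset.mem_product.2 ⟨ha, hc⟩, rfl⟩
  have hle : G ≤ H := le_sup_left
  -- sets without hubs
  have key : ∀ X : Finset V, X.Nonempty → X ≠ Finset.univ → Disjoint X C →
      k ≤ outCut (nbr H) X := by
    intro X hX hX' hd
    by_cases hXT : ∃ u ∈ X, u ∈ T
    · obtain ⟨u, huX, huT⟩ := hXT
      have h1 : C ⊆ nbr H u \ X := by
        intro c hc
        have hcX : c ∉ X := fun h => Finset.disjoint_left.1 hd h hc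
        refine Finset.mem_sdiff.2 ⟨hadj u (Finset.mem_union_right _ huT) c hc ?_, hcX⟩
        rintro rfl
        exact hcX huX
      have h2 := Finset.card_le_card h1
      have h3 : (nbr H u \ X).card ≤ outCut (nbr H) X :=
        Finset.single_le_sum (f := fun x => (nbr H x \ X).card) (fun _ _ => Nat.zero_le _) huX
      omega
    · push Not at hXT
      have h1 : ∑ v ∈ X, m v = 0 := Finset.sum_eq_zero fun v hv => by
        have := hXT v hv
        simp only [hT, Finset.mem_filter, Finset.mem_univ, true_and] at this
        omega
      have h2 := hm X hX hX'
      have h3 := outCut_mono (nbr_mono hle) X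
      omega
  refine ⟨H, fun X hX hX' => ?_, ?_⟩
  · by_cases h1 : Disjoint X C
    · exact key X hX hX' h1
    by_cases h2 : Disjoint Xᶜ C
    · rw [← outCut_compl (nbr_symm H)]
      refine key _ ?_ ?_ h2
      · rw [Finset.nonempty_iff_ne_empty]
        simpa using hX'
      · rw [Ne, Finset.compl_eq_univ_iff]
        exact hX.ne_empty
    · have hi : 0 < (C ∩ X).card := by
        rw [Finset.card_pos, ← Finset.not_disjoint_iff_nonempty_inter]
        exact fun h => h1 h.symm
      have ho : 0 < (C \ X).card := by
        rw [Finset.card_pos]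
        obtain ⟨c, hc1, hc2⟩ := Finset.not_disjoint_iff.1 h2
        exact ⟨c, Finset.mem_sdiff.2 ⟨hc2, Finset.mem_compl.1 hc1⟩⟩
      have hsum := Finset.card_inter_add_card_sdiff C X
      have hcut : (C ∩ X).card * (C \ X).card ≤ outCut (nbr H) X := by
        calc (C ∩ X).card * (C \ X).card = ∑ _x ∈ C ∩ X, (C \ X).card := by
              rw [Finset.sum_const, smul_eq_mul]
          _ ≤ ∑ x ∈ C ∩ X, (nbr H x \ X).card := by
              refine Finset.sum_le_sum fun x hx => Finset.card_le_card fun c hc => ?_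
              rw [Finset.mem_inter] at hx
              rw [Finset.mem_sdiff] at hc ⊢
              refine ⟨hadj x (Finset.mem_union_left _ hx.1) c hc.1 ?_, hc.2⟩
              rintro rfl
              exact hc.2 hx.2
          _ ≤ outCut (nbr H) X := Finset.sum_le_sum_of_subset Finset.inter_subset_right
      -- Two positive numbers with sum `k + 1` have product at least `k`, so a set that separates
      -- hubs has a large enough cut.
      have : (C ∩ X).card + (C \ X).card ≤ (C ∩ X).card * (C \ X).card + 1 := by
        obtain ⟨i, hi'⟩ := Nat.exists_eq_succ_of_ne_zero hi.ne'
        obtain ⟨o, ho'⟩ := Nat.exists_eq_succ_of_ne_zero ho.ne'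
        rw [hi', ho']
        simp only [Nat.succ_eq_add_one]
        nlinarith [Nat.zero_le (i * o)]
      have hC' : C.card = k + 1 := hC.2
      omega
  · refine (editCount_sup_fromEdgeSet_le G A).trans (Finset.card_image_le.trans ?_)
    rw [Finset.card_product, hC.2]
    refine Nat.mul_le_mul_right _ ((Finset.card_union_le _ _).trans ?_)
    rw [hC.2]
    refine Nat.add_le_add_left ?_ _
    rw [Finset.card_eq_sum_ones]
    calc ∑ _v ∈ T, 1 ≤ ∑ v ∈ T, m v := Finset.sum_le_sum fun v hv => by
          simp only [hT, Finset.mem_filter, Finset.mem_univ, true_and] at hv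
          omega
      _ ≤ _ := Finset.sum_le_sum_of_subset (Finset.subset_univ _)

/-- In a tight set `X` around `u`, the neighbours inside have total demand at most that of `X`, and
those outside number at most the cut of `X`, each with demand at most `k`. -/
theorem boundedDemand_of_minimal {k : ℕ} {G : SimpleGraph V} {m : V → ℕ}
    (hmin : ∀ v, 0 < m v → ∃ X, IsTight k G m X ∧ v ∈ X) : BoundedDemand k G m := by
  have hk : ∀ v, m v ≤ k := by
    intro v
    by_cases hv : 0 < m v
    · obtain ⟨X, hX, hvX⟩ := hmin v hv
      have h1 : m v ≤ ∑ w ∈ X, m w := Finset.single_le_sum (f := m) (fun _ _ => Nat.zero_le _) hvX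
      have h2 := hX.2.2
      omega
    · omega
  refine ⟨hk, fun u hu => ?_⟩
  obtain ⟨X, hX, huX⟩ := hmin u hu
  have h1 := Finset.sum_inter_add_sum_sdiff (nbr G u) X m
  have h2 : ∑ w ∈ nbr G u ∩ X, m w ≤ ∑ w ∈ X, m w :=
    Finset.sum_le_sum_of_subset Finset.inter_subset_right
  have h3 : ∑ w ∈ nbr G u \ X, m w ≤ (nbr G u \ X).card * k := by
    rw [← smul_eq_mul, ← Finset.sum_const]
    exact Finset.sum_le_sum fun w _ => hk w
  have h4 : (nbr G u \ X).card ≤ outCut (nbr G) X :=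
    Finset.single_le_sum (f := fun x => (nbr G x \ X).card) (fun _ _ => Nat.zero_le _) huX
  have h5 := hX.2.2
  have h6 : m u ≤ ∑ w ∈ X, m w := Finset.single_le_sum (f := m) (fun _ _ => Nat.zero_le _) huX
  have h7 : 1 ≤ k := by omega
  have h8 : (nbr G u \ X).card * k ≤ outCut (nbr G) X * k := Nat.mul_le_mul_right _ h4
  have h9 : ∑ w ∈ X, m w ≤ (∑ w ∈ X, m w) * k := Nat.le_mul_of_pos_right _ h7
  have h10 : outCut (nbr G) X * k + (∑ w ∈ X, m w) * k = k * k := by rw [← add_mul, h5]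
  have h11 : k * m u ≤ k * k := Nat.mul_le_mul_left _ (hk u)
  have h12 : 2 * k * k = k * k + k * k := by ring
  omega

/-- The additive error of the augmentation formula. -/
def augmentationError (k : ℕ) : ℕ := (k + 1 + demandThreshold k) * (k + 1) + k

theorem two_mul_distanceTo_isEdgeConnected_le {k : ℕ} (hk : 2 ≤ k) (G : SimpleGraph V)
    (hcard : k + 1 ≤ Fintype.card V) :
    2 * distanceTo (fun G => G.IsEdgeConnected k) G ≤
      ∑ X, gain (outCut (nbr G)) k X + 2 * augmentationError k := by
  obtain ⟨m, hm, hmin⟩ := exists_minimal_covers k G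
  obtain ⟨G', m', h1, h2, h3⟩ := exists_covers_of_splitting hk G m hm (boundedDemand_of_minimal hmin)
  obtain ⟨H, hH, hedit⟩ := exists_le_outCut_of_covers G' m' h1 hcard
  have h4 := sum_le_sum_gain_of_minimal hm hmin
  have h5 := distanceTo_le (P := fun G => G.IsEdgeConnected k) (G := G)
    (isEdgeConnected_of_le_outCut hH)
  have h6 := editCount_triangle G G' H
  have h7 : (k + 1 + ∑ v, m' v) * (k + 1) ≤ (k + 1 + demandThreshold k) * (k + 1) := by gcongr
  unfold augmentationError
  omega

theorem sum_gain_le_distanceTo {k : ℕ} (hP : ∃ H : SimpleGraph V, H.IsEdgeConnected k)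
    (G : SimpleGraph V) : ∑ X, gain (outCut (nbr G)) k X ≤
      2 * distanceTo (fun G => G.IsEdgeConnected k) G + k := by
  obtain ⟨H, hH, hedit⟩ := exists_editCount_eq_distanceTo hP G
  rw [← hedit]
  exact sum_gain_le_of_cuts fun X hX hX' => le_outCut_of_isEdgeConnected hH hX hX'

/-- A node needs `k` neighbours. A single node is the exception, being `k`-edge-connected for every
`k`. -/
theorem succ_le_card_of_isEdgeConnected {k : ℕ} {H : SimpleGraph V} (hH : H.IsEdgeConnected k)
    (hcard : 2 ≤ Fintype.card V) : k + 1 ≤ Fintype.card V := by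
  obtain ⟨v⟩ : Nonempty V := Fintype.card_pos_iff.1 (by omega)
  have h1 := le_outCut_of_isEdgeConnected hH (X := {v}) (by simp) fun h => by
    have := congrArg Finset.card h
    rw [Finset.card_singleton, Finset.card_univ] at this
    omega
  have h2 : outCut (nbr H) {v} ≤ (Finset.univ.erase v).card := by
    rw [outCut, Finset.sum_singleton]
    refine Finset.card_le_card fun w hw => ?_
    rw [Finset.mem_sdiff] at hw
    simpa using hw.2
  rw [Finset.card_erase_of_mem (Finset.mem_univ v), Finset.card_univ] at h2
  omega

theorem distanceTo_isEdgeConnected_of_subsingleton [Subsingleton V] (k : ℕ) (G : SimpleGraph V) :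
    distanceTo (fun G => G.IsEdgeConnected k) G = 0 := by
  have := distanceTo_le (P := fun G => G.IsEdgeConnected k) (G := G) (H := G)
    SimpleGraph.IsEdgeConnected.of_subsingleton
  simpa [editCount] using this

end Splitting

theorem nbr_eq_allNbrs {n : ℕ} {G : SimpleGraph (Fin n)} (L : IncidenceLists G) :
    allNbrs L.nbrs = nbr G := by
  funext v
  ext w
  rw [mem_allNbrs, mem_nbr]

/-! ### Adding a wheel -/

/-- The edges of the wheel with hub `0` and rim `1, …, n`. -/
def wheelEdges (n : ℕ) : Finset (Sym2 (Fin (n + 3 + 1))) :=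
  Finset.univ.image (fun i : Fin (n + 3) => s(0, i.succ)) ∪
    Finset.univ.image (fun i : Fin (n + 3) => s(i.succ, (i + 1).succ))

theorem card_wheelEdges_le (n : ℕ) : (wheelEdges n).card ≤ 2 * (n + 3) := by
  refine (Finset.card_union_le _ _).trans ?_
  have h1 := Finset.card_image_le (s := (Finset.univ : Finset (Fin (n + 3))))
    (f := fun i => s((0 : Fin (n + 3 + 1)), i.succ))
  have h2 := Finset.card_image_le (s := (Finset.univ : Finset (Fin (n + 3))))
    (f := fun i => s(i.succ, (i + 1).succ))
  rw [Finset.card_univ, Fintype.card_fin] at h1 h2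
  omega

/-- A set that avoids the hub has an edge to it from each of its nodes, which suffices for three or
more nodes; for one or two nodes the degrees are used. -/
theorem isEdgeConnected_of_hub {V : Type} [Fintype V] [DecidableEq V] {H : SimpleGraph V} {k : ℕ}
    (hk : k ≤ 3) (z : V)
    (hz : ∀ v, v ≠ z → H.Adj v z) (hd : ∀ v, v ≠ z → k ≤ (nbr H v).card) :
    H.IsEdgeConnected k := by
  have key : ∀ X : Finset V, X.Nonempty → z ∉ X → k ≤ outCut (nbr H) X := by
    intro X hX hzX
    have hpos : 0 < X.card := Finset.card_pos.2 hX
    have hne : ∀ x ∈ X, x ≠ z := fun x hx h => hzX (h ▸ hx)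
    have h1 : ∀ x ∈ X, 1 ≤ (nbr H x \ X).card := fun x hx => Finset.card_pos.2
      ⟨z, Finset.mem_sdiff.2 ⟨mem_nbr.2 (hz x (hne x hx)), hzX⟩⟩
    have h2 : ∀ x ∈ X, k + 1 - X.card ≤ (nbr H x \ X).card := by
      intro x hx
      have h3 := hd x (hne x hx)
      have h4 : (nbr H x ∩ X).card ≤ (X.erase x).card := by
        refine Finset.card_le_card fun y hy => ?_
        rw [Finset.mem_inter, mem_nbr] at hy
        exact Finset.mem_erase.2 ⟨hy.1.ne', hy.2⟩
      rw [Finset.card_erase_of_mem hx] at h4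
      have h5 := Finset.card_inter_add_card_sdiff (nbr H x) X
      omega
    have h3 : X.card * 1 ≤ outCut (nbr H) X := by
      rw [← smul_eq_mul, ← Finset.sum_const]
      exact Finset.sum_le_sum h1
    have h4 : X.card * (k + 1 - X.card) ≤ outCut (nbr H) X := by
      rw [← smul_eq_mul, ← Finset.sum_const]
      exact Finset.sum_le_sum h2
    rcases (by omega : X.card = 1 ∨ X.card = 2 ∨ 3 ≤ X.card) with h | h | h
    · rw [h] at h4; omega
    · rw [h] at h4 h3; omega
    · omega
  refine isEdgeConnected_of_le_outCut fun X hX hX' => ?_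
  by_cases hzX : z ∈ X
  · rw [← outCut_compl (nbr_symm H)]
    refine key _ ?_ (by simpa using hzX)
    rw [Finset.nonempty_iff_ne_empty, Ne, Finset.compl_eq_empty_iff]
    exact hX'
  · exact key X hX hzX

/-- Inserting a wheel, or a triangle when `n = 3`, is enough. That the bound is below `2 n` matters
when `δ` is close to `1`. -/
theorem distanceTo_isEdgeConnected_le_two_mul {n k : ℕ} (hk : k ≤ 3) (hn : k + 1 ≤ n) (hn' : 3 ≤ n)
    (G : SimpleGraph (Fin n)) : distanceTo (fun G => G.IsEdgeConnected k) G ≤ 2 * (n - 1) := by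
  obtain rfl | h4 := hn'.eq_or_lt
  · let A : Finset (Sym2 (Fin 3)) := {s(0, 1), s(0, 2), s(1, 2)}
    have hadj : ∀ a b, a ≠ b → (G ⊔ SimpleGraph.fromEdgeSet (A : Set (Sym2 (Fin 3)))).Adj a b := by
      intro a b hab
      rw [SimpleGraph.sup_adj, SimpleGraph.fromEdgeSet_adj]
      refine Or.inr ⟨?_, hab⟩
      fin_cases a <;> fin_cases b <;> simp_all [A]
    refine (distanceTo_le (P := fun G => G.IsEdgeConnected k) (G := G)
      (H := G ⊔ SimpleGraph.fromEdgeSet (A : Set (Sym2 (Fin 3)))) ?_).trans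
        ((editCount_sup_fromEdgeSet_le _ _).trans (Finset.card_le_three.trans (by norm_num)))
    refine isEdgeConnected_of_hub hk 0 (fun v hv => hadj v 0 hv) fun v _ => ?_
    have h2 : (Finset.univ.erase v).card ≤
        (nbr (G ⊔ SimpleGraph.fromEdgeSet (A : Set (Sym2 (Fin 3)))) v).card :=
      Finset.card_le_card fun w hw => mem_nbr.2 (hadj v w (Finset.ne_of_mem_erase hw).symm)
    rw [Finset.card_erase_of_mem (Finset.mem_univ v), Finset.card_univ, Fintype.card_fin] at h2
    omega
  · obtain ⟨m, rfl⟩ : ∃ m, n = m + 3 + 1 := ⟨n - 4, by omega⟩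
    refine (distanceTo_le (P := fun G => G.IsEdgeConnected k) (G := G)
      (H := G ⊔ SimpleGraph.fromEdgeSet (wheelEdges m : Set (Sym2 (Fin (m + 3 + 1))))) ?_).trans
      ((editCount_sup_fromEdgeSet_le _ _).trans ((card_wheelEdges_le m).trans (by omega)))
    have hadj : ∀ e ∈ wheelEdges m, ∀ a b, e = s(a, b) → a ≠ b →
        (G ⊔ SimpleGraph.fromEdgeSet (wheelEdges m : Set (Sym2 (Fin (m + 3 + 1))))).Adj a b := by
      intro e he a b hab hne
      rw [SimpleGraph.sup_adj, SimpleGraph.fromEdgeSet_adj]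
      exact Or.inr ⟨hab ▸ he, hne⟩
    have hhub : ∀ i : Fin (m + 3),
        (G ⊔ SimpleGraph.fromEdgeSet (wheelEdges m : Set (Sym2 (Fin (m + 3 + 1))))).Adj i.succ 0 := fun i =>
      (hadj _ (Finset.mem_union_left _ (Finset.mem_image_of_mem _ (Finset.mem_univ i))) 0 i.succ rfl
        (Fin.succ_ne_zero i).symm).symm
    have hone : ∀ i : Fin (m + 3), i ≠ i + 1 := by
      intro i h
      have : (1 : Fin (m + 3)) = 0 := by simpa using h.symm
      simp at this
    have hrim : ∀ i : Fin (m + 3),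
        (G ⊔ SimpleGraph.fromEdgeSet (wheelEdges m : Set (Sym2 (Fin (m + 3 + 1))))).Adj i.succ (i + 1).succ := fun i =>
      hadj _ (Finset.mem_union_right _ (Finset.mem_image_of_mem _ (Finset.mem_univ i))) _ _ rfl
        fun h => hone i (Fin.succ_injective _ h)
    refine isEdgeConnected_of_hub hk 0 (fun v hv => ?_) fun v hv => ?_
    · obtain ⟨i, rfl⟩ := Fin.exists_succ_eq.2 hv
      exact hhub i
    · obtain ⟨i, rfl⟩ := Fin.exists_succ_eq.2 hv
      have hsub : ({0, (i + 1).succ, (i - 1).succ} : Finset (Fin (m + 3 + 1))) ⊆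
          nbr (G ⊔ SimpleGraph.fromEdgeSet (wheelEdges m : Set (Sym2 (Fin (m + 3 + 1))))) i.succ := by
        intro w hw
        rw [mem_nbr]
        simp only [Finset.mem_insert, Finset.mem_singleton] at hw
        rcases hw with rfl | rfl | rfl
        · exact hhub i
        · exact hrim i
        · have := hrim (i - 1)
          rw [sub_add_cancel] at this
          exact this.symm
      refine hk.trans (le_trans (le_of_eq ?_) (Finset.card_le_card hsub))
      rw [eq_comm, Finset.card_eq_three]
      refine ⟨_, _, _, (Fin.succ_ne_zero _).symm, (Fin.succ_ne_zero _).symm, fun h => ?_, rfl⟩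
      have h1 := Fin.succ_injective _ h
      rw [eq_sub_iff_add_eq, add_assoc, add_eq_left] at h1
      have h2 : ((1 : Fin (m + 3)) + 1).val = 2 := by
        rw [Fin.val_add]
        simp
      rw [h1] at h2
      simp at h2

/-! ### The weight of a gain -/

theorem gain_outCut_congr {V : Type} [Fintype V] [DecidableEq V] {N N' : V → Finset V} {k : ℕ}
    {X : Finset V} (h : ∀ x ∈ X, N x = N' x) : gain (outCut N) k X = gain (outCut N') k X :=
  gain_congr fun _ hY => by rw [outCut_congr fun x hx => h x (hY hx)]

theorem gain_firstNbrs {n : ℕ} {k c : ℕ} {L : Fin n → List (Fin n)} (hL : ∀ v, (L v).Nodup)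
    {X : Finset (Fin n)} (hc : X.card + k ≤ c) :
    gain (outCut (firstNbrs c L)) k X = gain (outCut (allNbrs L)) k X :=
  gain_congr fun _ hY => min_outCut_firstNbrs hL
    ((Nat.add_le_add_right (Finset.card_le_card hY) k).trans hc)

/-- Half of the gain as a local weight. -/
noncomputable def halfGain (n k : ℕ) : LocalWeight n k (k / 2) where
  w N X := gain (outCut N) k X / 2
  congr N N' X h := by rw [gain_outCut_congr h]
  first c L X hL hc := by rw [gain_firstNbrs hL hc]
  extreme N X h := .of_gain_ne_zero fun h' => h (by simp [h'])
  nonneg N X := by positivity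
  le N X := by
    have : (gain (outCut N) k X : ℝ) ≤ k := by exact_mod_cast gain_le _ _ _
    linarith

/-! ### Estimating the distance to edge connectivity -/

theorem abs_sum_halfGain_sub_le {n k : ℕ} (hk : 2 ≤ k) (hn : 1 ≤ n)
    (hP : ∃ H : SimpleGraph (Fin n), H.IsEdgeConnected k) {G : SimpleGraph (Fin n)}
    (L : IncidenceLists G) :
    |∑ X, (halfGain n k).w (allNbrs L.nbrs) X -
      distanceTo (fun G : SimpleGraph (Fin n) => G.IsEdgeConnected k) G| ≤
      augmentationError k + k := by
  have hsum : ∑ X, (halfGain n k).w (allNbrs L.nbrs) X =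
      ((∑ X, gain (outCut (nbr G)) k X : ℕ) : ℝ) / 2 := by
    rw [nbr_eq_allNbrs, Nat.cast_sum, Finset.sum_div]
    rfl
  have h1 := sum_gain_le_distanceTo hP G
  have h2 : 2 * distanceTo (fun G : SimpleGraph (Fin n) => G.IsEdgeConnected k) G ≤
      ∑ X, gain (outCut (nbr G)) k X + 2 * augmentationError k := by
    obtain rfl | hn' := hn.eq_or_lt
    · rw [distanceTo_isEdgeConnected_of_subsingleton]
      omega
    · obtain ⟨H, hH⟩ := hP
      exact two_mul_distanceTo_isEdgeConnected_le hk G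
        (succ_le_card_of_isEdgeConnected hH (by rw [Fintype.card_fin]; omega))
  rw [hsum, abs_le]
  have h1' : ((∑ X, gain (outCut (nbr G)) k X : ℕ) : ℝ) ≤
    2 * (distanceTo (fun G : SimpleGraph (Fin n) => G.IsEdgeConnected k) G : ℝ) + k := by
    exact_mod_cast h1
  have h2' : 2 * (distanceTo (fun G : SimpleGraph (Fin n) => G.IsEdgeConnected k) G : ℝ) ≤
    ((∑ X, gain (outCut (nbr G)) k X : ℕ) : ℝ) + 2 * augmentationError k := by
    exact_mod_cast h2
  constructor <;> linarith [Nat.cast_nonneg (α := ℝ) k, Nat.cast_nonneg (α := ℝ) (augmentationError k)]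

/-- The wheel gives `2 n - 2`, the augmentation formula `3 n / 2 + E`. The first is used up to `n =
2 E + 4` and the second beyond, where the two bounds agree. -/
theorem distanceTo_isEdgeConnected_le_mul {n k : ℕ} (hk : 2 ≤ k) (hk' : k ≤ 3) (hn : 1 ≤ n)
    (hP : ∃ H : SimpleGraph (Fin n), H.IsEdgeConnected k) (G : SimpleGraph (Fin n)) :
    (distanceTo (fun G : SimpleGraph (Fin n) => G.IsEdgeConnected k) G : ℝ) ≤
      2 * ((1 - 1 / (2 * augmentationError k + 4)) * n) := by
  set E := augmentationError k
  have hE : (0 : ℝ) ≤ E := Nat.cast_nonneg _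
  have hN : (0 : ℝ) < 2 * E + 4 := by linarith
  obtain rfl | hn' := hn.eq_or_lt
  · rw [distanceTo_isEdgeConnected_of_subsingleton]
    have : 1 / (2 * (E : ℝ) + 4) ≤ 1 := by rw [div_le_one hN]; linarith
    simp only [Nat.cast_zero, Nat.cast_one, mul_one]
    linarith
  have hcard : k + 1 ≤ n := by
    obtain ⟨H, hH⟩ := hP
    have := succ_le_card_of_isEdgeConnected hH (by rw [Fintype.card_fin]; omega)
    rwa [Fintype.card_fin] at this
  have h1 := distanceTo_isEdgeConnected_le_two_mul hk' hcard (by omega) G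
  have h2 := two_mul_distanceTo_isEdgeConnected_le hk G (by rwa [Fintype.card_fin])
  have h3 := sum_gain_le G k
  rw [Fintype.card_fin] at h3
  have h4 : k * n ≤ 3 * n := Nat.mul_le_mul_right _ hk'
  generalize distanceTo (fun G : SimpleGraph (Fin n) => G.IsEdgeConnected k) G = dist at *
  have h5 : (dist : ℝ) ≤ 2 * n - 2 := by
    have : dist + 2 ≤ 2 * n := by omega
    have : (dist : ℝ) + 2 ≤ 2 * n := by exact_mod_cast this
    linarith
  have h6 : 2 * (dist : ℝ) ≤ 3 * n + 2 * E := by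
    have : 2 * dist ≤ 3 * n + 2 * E := by omega
    exact_mod_cast this
  have h7 : 2 * ((1 - 1 / (2 * (E : ℝ) + 4)) * n) = 2 * n - 2 * n / (2 * E + 4) := by
    field_simp
  rw [h7]
  rcases le_total (n : ℝ) (2 * E + 4) with h | h
  · have : 2 * (n : ℝ) / (2 * E + 4) ≤ 2 := by rw [div_le_iff₀ hN]; linarith
    linarith
  · have : 2 * (n : ℝ) / (2 * E + 4) ≤ n / 2 - E := by
      rw [div_le_iff₀ hN]
      nlinarith
    linarith

theorem exists_estimator_isEdgeConnected_two :
    ∃ A : Estimator, A.EstimatesDistanceTo (fun _ G => G.IsEdgeConnected 2) ∧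
      A.HasQueryComplexity (fun δ p => Real.log (1 / δ) / ((1 - p) * δ ^ 2)) := by
  have hE : (0 : ℝ) ≤ augmentationError 2 := Nat.cast_nonneg _
  refine exists_estimator (P := fun _ G => G.IsEdgeConnected 2) (k := 2) (D := 200)
    (B := ((2 : ℕ) : ℝ) / 2)
    (C := augmentationError 2 + (2 : ℕ)) (δ₀ := 1 - 1 / (2 * augmentationError 2 + 4)) (.inl rfl)
    (by norm_num) (fun n => halfGain n 2) (fun _ => search) (fun t => 5 * t + 3)
    (fun t => 3 * t + 1) (fun n N v X t hX ht hc => hX.subset_search ht (by omega))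
    (fun n c N hN v t => queryComputable_search hN v t) (fun n N v t => card_search_le N v t) ?_
    (fun _ _ _ => 0) (fun _ _ => .mono (.const _) (by omega)) (by simp)
    (fun n hn hP G L => by simpa using abs_sum_halfGain_sub_le le_rfl hn hP L) ?_ ?_
    fun n hn hP G => distanceTo_isEdgeConnected_le_mul le_rfl (by norm_num) hn hP G
  · intro j
    have h1 : (2 ^ 2 : ℕ) ^ j = 2 ^ j * 2 ^ j := by rw [← mul_pow]; norm_num
    have h2 : 1 ≤ 2 ^ j := Nat.one_le_two_pow
    rw [h1, pow_succ]
    nlinarith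
  · rw [sub_pos, div_lt_one] <;> linarith
  · rw [sub_lt_self_iff]
    positivity

theorem exists_estimator_isEdgeConnected_three :
    ∃ A : Estimator, A.EstimatesDistanceTo (fun _ G => G.IsEdgeConnected 3) ∧
      A.HasQueryComplexity (fun δ p => Real.log (1 / δ) / ((1 - p) * δ ^ 3)) := by
  have hE : (0 : ℝ) ≤ augmentationError 3 := Nat.cast_nonneg _
  refine exists_estimator (P := fun _ G => G.IsEdgeConnected 3) (k := 3) (D := 2000)
    (B := ((3 : ℕ) : ℝ) / 2)
    (C := augmentationError 3 + (3 : ℕ)) (δ₀ := 1 - 1 / (2 * augmentationError 3 + 4)) (.inr rfl)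
    (by norm_num) (fun n => halfGain n 3) (fun _ => search₂) (fun t => (t + 2) * (5 * t + 3))
    (fun t => (t + 1) * (3 * t + 1)) (fun n N v X t hX ht hc => hX.subset_search₂ ht (by omega))
    (fun n c N hN v t => queryComputable_search₂ hN v t) (fun n N v t => card_search₂_le N v t) ?_
    (fun _ _ _ => 0) (fun _ _ => .mono (.const _) (by omega)) (by simp)
    (fun n hn hP G L => by simpa using abs_sum_halfGain_sub_le (by norm_num) hn hP L) ?_ ?_
    fun n hn hP G => distanceTo_isEdgeConnected_le_mul (by norm_num) le_rfl hn hP G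
  · intro j
    have h1 : (2 ^ 3 : ℕ) ^ j = 2 ^ j * 2 ^ j * 2 ^ j := by
      rw [← mul_pow, ← mul_pow]
      norm_num
    have h2 : 1 ≤ 2 ^ j := Nat.one_le_two_pow
    rw [h1, pow_succ]
    generalize 2 ^ j = y at *
    obtain ⟨z, rfl⟩ := Nat.exists_eq_add_of_le h2
    ring_nf
    nlinarith [Nat.zero_le z, Nat.zero_le (z ^ 2), Nat.zero_le (z ^ 3)]
  · rw [sub_pos, div_lt_one] <;> linarith
  · rw [sub_lt_self_iff]
    positivity

/-! ### Connected components -/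

section Components

variable {V : Type} [Fintype V] [DecidableEq V]

open Classical in
/-- The set of nodes of the connected component of a node. -/
noncomputable def comp (G : SimpleGraph V) (v : V) : Finset V := {w | G.Reachable v w}

theorem mem_comp {G : SimpleGraph V} {v w : V} : w ∈ comp G v ↔ G.Reachable v w := by simp [comp]

theorem self_mem_comp (G : SimpleGraph V) (v : V) : v ∈ comp G v := mem_comp.2 .rfl

theorem comp_eq_of_mem {G : SimpleGraph V} {v w : V} (h : w ∈ comp G v) : comp G w = comp G v := by
  ext x
  rw [mem_comp] at h
  rw [mem_comp, mem_comp]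
  exact ⟨h.trans, h.symm.trans⟩

/-- No edge leaves the set `X`. -/
def IsClosedUnder (G : SimpleGraph V) (X : Finset V) : Prop := ∀ x ∈ X, ∀ y, G.Adj x y → y ∈ X

theorem outCut_eq_zero_iff {G : SimpleGraph V} {X : Finset V} :
    outCut (nbr G) X = 0 ↔ IsClosedUnder G X := by
  rw [outCut, Finset.sum_eq_zero_iff]
  refine forall₂_congr fun x _ => ?_
  rw [Finset.card_eq_zero, Finset.sdiff_eq_empty_iff_subset]
  exact forall_congr' fun y => by rw [mem_nbr]

theorem IsClosedUnder.mem_of_reachable {G : SimpleGraph V} {X : Finset V} (hX : IsClosedUnder G X)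
    {x y : V} (hx : x ∈ X) (h : G.Reachable x y) : y ∈ X := by
  rw [SimpleGraph.reachable_iff_reflTransGen] at h
  induction h with
  | refl => exact hx
  | tail _ hab ih => exact hX _ ih _ hab

theorem IsClosedUnder.union {G : SimpleGraph V} {X Y : Finset V} (hX : IsClosedUnder G X)
    (hY : IsClosedUnder G Y) : IsClosedUnder G (X ∪ Y) := by
  intro x hx y hxy
  rw [Finset.mem_union] at hx ⊢
  exact hx.imp (fun h => hX x h y hxy) fun h => hY x h y hxy

theorem isClosedUnder_comp (G : SimpleGraph V) (v : V) : IsClosedUnder G (comp G v) := by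
  intro x hx y hxy
  rw [mem_comp] at hx ⊢
  exact hx.trans hxy.reachable

/-- For `k = 1` an extreme set is a minimal nonempty set that no edge leaves. Hence the general
machinery also serves sums over components. -/
theorem isExtreme_one_iff {G : SimpleGraph V} {X : Finset V} :
    IsExtreme (outCut (nbr G)) 1 X ↔ ∃ v, comp G v = X := by
  constructor
  · rintro ⟨⟨v, hv⟩, h1, h2⟩
    have hX : IsClosedUnder G X := outCut_eq_zero_iff.1 (by omega)
    refine ⟨v, ?_⟩
    have hsub : comp G v ⊆ X := fun w hw => hX.mem_of_reachable hv (mem_comp.1 hw)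
    by_contra hne
    have h3 := h2 _ (hsub.ssubset_of_ne hne) ⟨v, self_mem_comp G v⟩
    rw [outCut_eq_zero_iff.2 (isClosedUnder_comp G v)] at h3
    omega
  · rintro ⟨v, rfl⟩
    have h0 := outCut_eq_zero_iff.2 (isClosedUnder_comp G v)
    refine ⟨⟨v, self_mem_comp G v⟩, by omega, fun Y hY ⟨y, hy⟩ => ?_⟩
    rw [h0, Nat.pos_iff_ne_zero, Ne, outCut_eq_zero_iff]
    refine fun hc => hY.2 fun w hw => hc.mem_of_reachable hy ?_
    rw [← comp_eq_of_mem (hY.1 hy), mem_comp] at hw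
    exact hw

theorem comp_notMem_image {G : SimpleGraph V} {S : Finset V} (hS : IsClosedUnder G S) {y : V}
    (hy : y ∉ S) : comp G y ∉ S.image (comp G) := by
  intro h
  obtain ⟨x, hx, hxy⟩ := Finset.mem_image.1 h
  refine hy (hS.mem_of_reachable hx (mem_comp.1 ?_))
  rw [hxy]
  exact self_mem_comp G y

theorem image_comp_union (G : SimpleGraph V) (S : Finset V) (y : V) :
    (S ∪ comp G y).image (comp G) = insert (comp G y) (S.image (comp G)) := by
  rw [Finset.image_union, Finset.insert_eq, Finset.union_comm]
  congr 1
  ext C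
  rw [Finset.mem_image, Finset.mem_singleton]
  constructor
  · rintro ⟨x, hx, rfl⟩
    exact comp_eq_of_mem hx
  · rintro rfl
    exact ⟨y, self_mem_comp G y, rfl⟩

theorem disjoint_comp {G : SimpleGraph V} {S : Finset V} (hS : IsClosedUnder G S) {y : V}
    (hy : y ∉ S) : Disjoint S (comp G y) := by
  rw [Finset.disjoint_left]
  intro x hx hxy
  exact hy (hS.mem_of_reachable hx (mem_comp.1 hxy).symm)

theorem sum_isExtreme_one (G : SimpleGraph V) {M : Type*} [AddCommMonoid M] (f : Finset V → M)
    [DecidablePred (IsExtreme (outCut (nbr G)) 1)] :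
    ∑ X, (if IsExtreme (outCut (nbr G)) 1 X then f X else 0) =
      ∑ X ∈ Finset.univ.image (comp G), f X := by
  rw [← Finset.sum_filter]
  refine Finset.sum_congr ?_ fun _ _ => rfl
  ext X
  simp [isExtreme_one_iff]

theorem sum_image_comp {M : Type*} [AddCommMonoid M] (G : SimpleGraph V) (g : V → M) :
    ∑ X ∈ Finset.univ.image (comp G), ∑ v ∈ X, g v = ∑ v, g v := by
  rw [← Finset.sum_fiberwise_of_maps_to (s := Finset.univ) (t := Finset.univ.image (comp G))
    (g := comp G) (fun v _ => Finset.mem_image_of_mem _ (Finset.mem_univ v))]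
  refine Finset.sum_congr rfl fun X hX => Finset.sum_congr ?_ fun _ _ => rfl
  obtain ⟨v, -, rfl⟩ := Finset.mem_image.1 hX
  ext w
  simp only [Finset.mem_filter, Finset.mem_univ, true_and]
  exact ⟨comp_eq_of_mem, fun h => h ▸ self_mem_comp G w⟩

/-- A property of sets that holds for some component and is inherited by suitable unions with
a further component holds for the set of all nodes. -/
theorem closed_induction (G : SimpleGraph V) {p : Finset V → Prop} (v : V) (h0 : p (comp G v))
    (step : ∀ S, S.Nonempty → IsClosedUnder G S → S ≠ Finset.univ → p S →
      ∃ y, y ∉ S ∧ p (S ∪ comp G y)) : p Finset.univ := by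
  suffices ∀ m, ∀ S : Finset V, (Sᶜ).card = m → S.Nonempty → IsClosedUnder G S → p S →
      p Finset.univ from
    this _ _ rfl ⟨v, self_mem_comp G v⟩ (isClosedUnder_comp G v) h0
  intro m
  induction m using Nat.strong_induction_on with
  | _ m ih =>
    intro S hm hn hS hp
    by_cases hu : S = Finset.univ
    · rwa [← hu]
    · obtain ⟨y, hy, hp'⟩ := step S hn hS hu hp
      refine ih _ ?_ (S ∪ comp G y) rfl (hn.mono Finset.subset_union_left)
        (hS.union (isClosedUnder_comp G y)) hp'
      rw [← hm]
      refine Finset.card_lt_card ⟨?_, fun h => ?_⟩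
      · exact Finset.compl_subset_compl.2 Finset.subset_union_left
      · have := h (Finset.mem_compl.2 hy)
        rw [Finset.mem_compl] at this
        exact this (Finset.mem_union_right _ (self_mem_comp G y))

/-! ### Connectivity -/

theorem exists_adj_of_connected {H : SimpleGraph V} (hH : H.Connected) {S : Finset V}
    (hS : S.Nonempty) (hu : S ≠ Finset.univ) : ∃ x ∈ S, ∃ y ∉ S, H.Adj x y := by
  by_contra hcon
  push Not at hcon
  obtain ⟨x, hx⟩ := hS
  have hc : IsClosedUnder H S := fun x hx y hxy => by_contra fun hy => hcon x hx y hy hxy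
  exact hu (Finset.eq_univ_iff_forall.2 fun y => hc.mem_of_reachable hx (hH.preconnected x y))

/-- Grow a union of components of `G` along edges of `H`: each further component is reached by an
edge that is missing in `G` and was not inside the union before. -/
theorem card_comp_le_editCount {G H : SimpleGraph V} (hH : H.Connected) :
    (Finset.univ.image (comp G)).card ≤ editCount G H + 1 := by
  classical
  obtain ⟨v⟩ := hH.nonempty
  let D : Finset V → Finset (Sym2 V) := fun S =>
    {e | e ∈ symmDiff G.edgeSet H.edgeSet ∧ ∀ x ∈ e, x ∈ S}
  have h := closed_induction G (p := fun S => (S.image (comp G)).card ≤ (D S).card + 1) v ?_ ?_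
  · refine h.trans (Nat.add_le_add_right ?_ 1)
    rw [editCount, ← Set.ncard_coe_finset]
    exact Set.ncard_le_ncard (fun e he => by simpa [D] using he) (Set.toFinite _)
  · have : (comp G v).image (comp G) = {comp G v} := by
      have := image_comp_union G ∅ v
      rwa [Finset.empty_union, Finset.image_empty, insert_empty_eq] at this
    rw [this, Finset.card_singleton]
    omega
  · intro S hn hS hu hp
    obtain ⟨x, hx, y, hy, hxy⟩ := exists_adj_of_connected hH hn hu
    refine ⟨y, hy, ?_⟩
    rw [image_comp_union, Finset.card_insert_of_notMem (comp_notMem_image hS hy)]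
    refine (Nat.add_le_add_right hp 1).trans (Nat.add_le_add_right ?_ 1)
    refine Finset.card_lt_card ⟨fun e he => ?_, fun h => ?_⟩
    · simp only [D, Finset.mem_filter, Finset.mem_univ, true_and] at he ⊢
      exact ⟨he.1, fun x hx => Finset.mem_union_left _ (he.2 x hx)⟩
    · have h1 : s(x, y) ∈ D (S ∪ comp G y) := by
        simp only [D, Finset.mem_filter, Finset.mem_univ, true_and]
        refine ⟨Or.inr ⟨hxy, fun hG => hy (hS x hx y hG)⟩, fun z hz => ?_⟩
        rw [Sym2.mem_iff] at hz
        rcases hz with rfl | rfl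
        · exact Finset.mem_union_left _ hx
        · exact Finset.mem_union_right _ (self_mem_comp G z)
      have h2 := h h1
      simp only [D, Finset.mem_filter, Finset.mem_univ, true_and] at h2
      exact hy (h2.2 y (Sym2.mem_mk_right x y))

end Components

/-! ### Degree parities and closed trails -/

section Euler

variable {V : Type} [Fintype V] [DecidableEq V]

theorem nbr_card_eq_degree (G : SimpleGraph V) [DecidableRel G.Adj] (v : V) :
    (nbr G v).card = G.degree v := by
  rw [← SimpleGraph.card_neighborFinset_eq_degree]
  congr 1
  ext w
  simp [mem_nbr]

open Classical in
/-- The set of nodes of odd degree. -/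
noncomputable def oddNodes (G : SimpleGraph V) : Finset V := {v | Odd (nbr G v).card}

theorem mem_oddNodes {G : SimpleGraph V} {v : V} : v ∈ oddNodes G ↔ Odd (nbr G v).card := by
  simp [oddNodes]

/-! ### Euler's theorem -/

theorem oddNodes_eq_empty_of_isEulerianGraph {G : SimpleGraph V} (h : IsEulerianGraph G) :
    oddNodes G = ∅ := by
  classical
  obtain ⟨-, v, w, hw⟩ := h
  rw [Finset.eq_empty_iff_forall_notMem]
  intro x hx
  rw [mem_oddNodes, nbr_card_eq_degree, ← Nat.not_even_iff_odd] at hx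
  exact hx (hw.even_degree_iff.2 fun h => absurd rfl h)

theorem countP_edges_eq_card_nbr {G : SimpleGraph V} {u v : V} {p : G.Walk u v} (hp : p.IsTrail)
    (x : V) (h : ∀ w, G.Adj w x → s(w, x) ∈ p.edges) :
    p.edges.countP (fun e => x ∈ e) = (nbr G x).card := by
  have h1 : p.edges.countP (fun e => x ∈ e) = (p.edges.toFinset.filter (x ∈ ·)).card := by
    rw [List.countP_eq_length_filter, ← List.toFinset_card_of_nodup (hp.edges_nodup.filter _),
      List.toFinset_filter]
    simp
  have h2 : p.edges.toFinset.filter (x ∈ ·) = (nbr G x).image fun w => s(w, x) := by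
    ext e
    simp only [Finset.mem_filter, List.mem_toFinset, Finset.mem_image, mem_nbr]
    constructor
    · rintro ⟨he, hx⟩
      obtain ⟨w, rfl⟩ := Sym2.mem_iff_exists.1 hx
      exact ⟨w, p.adj_of_mem_edges he, Sym2.eq_swap⟩
    · rintro ⟨w, hw, rfl⟩
      exact ⟨h w hw.symm, Sym2.mem_mk_right _ _⟩
  rw [h1, h2, Finset.card_image_of_injective]
  intro a b hab
  exact Sym2.congr_left.1 hab

/-- Euler's theorem. -/
theorem isEulerianGraph_of_oddNodes_eq_empty {G : SimpleGraph V} (hG : G.Connected)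
    (h : oddNodes G = ∅) : IsEulerianGraph G := by
  classical
  refine ⟨hG, ?_⟩
  have := hG.nonempty
  -- A longest trail uses all edges at its start. If it were not closed, it would use an odd number
  -- of edges there, against even degrees. Rotating it then shows that all edges at every visited
  -- node are used.
  obtain ⟨u, v, p, hp, hmax⟩ :=
    SimpleGraph.Walk.exists_isTrail_forall_isTrail_length_le_length G
  have hext : ∀ {a b : V} (q : G.Walk a b), q.IsTrail → p.length ≤ q.length →
      ∀ w, G.Adj w a → s(w, a) ∈ q.edges := by
    intro a b q hq hl w hw
    by_contra hn
    have := hmax _ _ (.cons hw q) ((SimpleGraph.Walk.isTrail_cons _ _).2 ⟨hq, hn⟩)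
    rw [SimpleGraph.Walk.length_cons] at this
    omega
  have huv : u = v := by
    by_contra hne
    have h1 := countP_edges_eq_card_nbr hp u (hext p hp le_rfl)
    have h2 := hp.even_countP_edges_iff u
    rw [h1] at h2
    have h3 : u ∉ oddNodes G := by rw [h]; simp
    rw [mem_oddNodes, Nat.not_odd_iff_even] at h3
    exact (h2.1 h3 hne).1 rfl
  subst huv
  have hedge : ∀ a ∈ p.support, ∀ w, G.Adj w a → s(w, a) ∈ p.edges := by
    intro a ha w hw
    have := hext (p.rotate a ha) ((SimpleGraph.Walk.isTrail_rotate ha).2 hp) (by simp) w hw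
    exact (p.rotate_edges a ha).perm.mem_iff.1 this
  refine ⟨u, p, hp.isEulerian_of_forall_mem fun e he => ?_⟩
  have hclosed : IsClosedUnder G p.support.toFinset := by
    intro x hx y hxy
    rw [List.mem_toFinset] at hx ⊢
    exact p.fst_mem_support_of_mem_edges (hedge x hx y hxy.symm)
  induction e using Sym2.ind with
  | _ a b =>
    refine hedge b ?_ a he
    rw [← List.mem_toFinset]
    exact hclosed.mem_of_reachable (List.mem_toFinset.2 p.start_mem_support) (hG.preconnected u b)

/-! ### Flipping edges -/

/-- The graph in which the adjacency of `u` and `w` is flipped. -/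
def flipEdge (G : SimpleGraph V) (u w : V) : SimpleGraph V := symmDiff G (SimpleGraph.edge u w)

theorem flipEdge_adj {G : SimpleGraph V} {u w a b : V} (huw : u ≠ w) :
    (flipEdge G u w).Adj a b ↔ Xor (G.Adj a b) (s(a, b) = s(u, w)) := by
  have : (SimpleGraph.edge u w).Adj a b ↔ s(a, b) = s(u, w) := by
    rw [SimpleGraph.adj_edge]
    constructor
    · exact fun h => h.1.symm
    · refine fun h => ⟨h.symm, fun hab => huw ?_⟩
      subst hab
      rw [Sym2.eq_iff] at h
      rcases h with ⟨rfl, rfl⟩ | ⟨rfl, rfl⟩ <;> rfl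
  rw [flipEdge, symmDiff_def, SimpleGraph.sup_adj, SimpleGraph.sdiff_adj, SimpleGraph.sdiff_adj,
    this]
  rfl

theorem flipEdge_comm (G : SimpleGraph V) (u w : V) : flipEdge G u w = flipEdge G w u := by
  rw [flipEdge, SimpleGraph.edge_comm, flipEdge]

theorem editCount_flipEdge_le (G : SimpleGraph V) (u w : V) : editCount G (flipEdge G u w) ≤ 1 := by
  rw [← Set.ncard_singleton s(u, w), editCount]
  refine Set.ncard_le_ncard ?_ (Set.toFinite _)
  intro e he
  induction e using Sym2.ind with
  | _ a b =>
    by_contra hne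
    rw [Set.mem_singleton_iff] at hne
    have : (flipEdge G u w).Adj a b ↔ G.Adj a b := by
      rw [flipEdge, symmDiff_def, SimpleGraph.sup_adj, SimpleGraph.sdiff_adj,
        SimpleGraph.sdiff_adj, SimpleGraph.adj_edge]
      have : ¬ s(u, w) = s(a, b) := fun h => hne h.symm
      tauto
    rcases he with ⟨h1, h2⟩ | ⟨h1, h2⟩
    · exact h2 (this.2 h1)
    · exact h2 (this.1 h1)

theorem nbr_flipEdge_left {G : SimpleGraph V} {u w : V} (huw : u ≠ w) :
    nbr (flipEdge G u w) u = symmDiff (nbr G u) {w} := by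
  ext x
  rw [mem_nbr, flipEdge_adj huw, Finset.mem_symmDiff, mem_nbr, Finset.mem_singleton,
    Sym2.congr_right]
  rfl

theorem nbr_flipEdge_of_ne {G : SimpleGraph V} {u w x : V} (huw : u ≠ w) (hu : x ≠ u) (hw : x ≠ w) :
    nbr (flipEdge G u w) x = nbr G x := by
  ext y
  rw [mem_nbr, flipEdge_adj huw, mem_nbr, Sym2.eq_iff]
  simp [hu, hw, Xor]

theorem odd_card_symmDiff_singleton (A : Finset V) (w : V) :
    Odd (symmDiff A {w}).card ↔ ¬ Odd A.card := by
  by_cases hw : w ∈ A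
  · have : symmDiff A {w} = A.erase w := by
      ext x
      rw [Finset.mem_symmDiff, Finset.mem_erase, Finset.mem_singleton]
      by_cases h : x = w
      · simp [h, hw]
      · simp [h]
    have hpos := Finset.card_pos.2 ⟨w, hw⟩
    rw [this, Finset.card_erase_of_mem hw, Nat.odd_sub hpos]
    simp
  · have : symmDiff A {w} = insert w A := by
      ext x
      rw [Finset.mem_symmDiff, Finset.mem_insert, Finset.mem_singleton]
      by_cases h : x = w
      · simp [h, hw]
      · simp [h]
    rw [this, Finset.card_insert_of_notMem hw, Nat.odd_add_one]

theorem mem_oddNodes_flipEdge {G : SimpleGraph V} {u w x : V} (huw : u ≠ w) :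
    x ∈ oddNodes (flipEdge G u w) ↔ Xor (x ∈ oddNodes G) (x = u ∨ x = w) := by
  rw [mem_oddNodes, mem_oddNodes]
  by_cases hu : x = u
  · subst hu
    rw [nbr_flipEdge_left huw, odd_card_symmDiff_singleton]
    simp [Xor]
  by_cases hw : x = w
  · subst hw
    rw [flipEdge_comm, nbr_flipEdge_left (Ne.symm huw), odd_card_symmDiff_singleton]
    simp [Xor]
  · rw [nbr_flipEdge_of_ne huw hu hw]
    simp [hu, hw, Xor]

end Euler

/-! ### The distance to eulerianity -/

section Merging

variable {V : Type} [Fintype V] [DecidableEq V]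

/-- The number of half-edges that a component needs in order to become part of an eulerian graph. -/
noncomputable def parityDemand (G : SimpleGraph V) (X : Finset V) : ℕ :=
  max 2 (oddNodes G ∩ X).card

theorem oddNodes_flipEdge_inter {G : SimpleGraph V} {u w : V} (huw : u ≠ w) {S T : Finset V}
    (hST : Disjoint S T) (hu : u ∈ S) (hw : w ∈ T) :
    oddNodes (flipEdge G u w) ∩ (S ∪ T) =
      symmDiff (oddNodes G ∩ S) {u} ∪ symmDiff (oddNodes G ∩ T) {w} := by
  ext x
  have h1 := Finset.disjoint_left.1 hST
  have h2 : x = u → x ∈ S := fun h => h ▸ hu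
  have h3 : x = w → x ∈ T := fun h => h ▸ hw
  have h4 : x ∈ S → x ∉ T := fun h => h1 h
  rw [Finset.mem_inter, mem_oddNodes_flipEdge huw, Finset.mem_union, Finset.mem_union,
    Finset.mem_symmDiff, Finset.mem_symmDiff, Finset.mem_inter, Finset.mem_inter,
    Finset.mem_singleton, Finset.mem_singleton, Xor]
  tauto

theorem exists_mem_card_symmDiff {A S : Finset V} (hS : S.Nonempty) :
    ∃ u ∈ S, (symmDiff (A ∩ S) {u}).card = if (A ∩ S).card = 0 then 1 else (A ∩ S).card - 1 := by
  by_cases h : (A ∩ S).card = 0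
  · obtain ⟨u, hu⟩ := hS
    refine ⟨u, hu, ?_⟩
    rw [if_pos h, Finset.card_eq_zero.1 h, ← Finset.bot_eq_empty, bot_symmDiff,
      Finset.card_singleton]
  · obtain ⟨u, hu⟩ := Finset.card_pos.1 (Nat.pos_of_ne_zero h)
    refine ⟨u, Finset.mem_of_mem_inter_right hu, ?_⟩
    rw [if_neg h, symmDiff_def, Finset.sup_eq_union,
      Finset.sdiff_eq_empty_iff_subset.2 (Finset.singleton_subset_iff.2 hu), Finset.union_empty,
      Finset.sdiff_singleton_eq_erase, Finset.card_erase_of_mem hu]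

theorem reachable_of_forall_adj {G H : SimpleGraph V}
    (h : ∀ a b, G.Adj a b → H.Reachable a b) {x y : V} (hxy : G.Reachable x y) :
    H.Reachable x y := by
  rw [SimpleGraph.reachable_iff_reflTransGen] at hxy
  induction hxy with
  | refl => rfl
  | tail _ hab ih => exact ih.trans (h _ _ hab)

theorem le_flipEdge {G : SimpleGraph V} {u w : V} (h : ¬ G.Adj u w) : G ≤ flipEdge G u w := by
  intro a b hab
  refine Or.inl ⟨hab, fun h' => h ?_⟩
  rw [SimpleGraph.adj_edge, Sym2.eq_iff] at h'
  rcases h'.1 with ⟨rfl, rfl⟩ | ⟨rfl, rfl⟩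
  · exact hab
  · exact hab.symm

/-- Components are merged one at a time by an edge whose ends are odd nodes wherever possible. Every
such edge lowers the total parity demand by at least two. -/
theorem exists_connected_of_merging [Nonempty V] (G : SimpleGraph V) :
    ∃ H : SimpleGraph V, H.Connected ∧
      editCount G H + 1 ≤ (Finset.univ.image (comp G)).card ∧
      2 * editCount G H + max 2 (oddNodes H).card ≤
        ∑ X ∈ Finset.univ.image (comp G), parityDemand G X := by
  obtain ⟨v⟩ := ‹Nonempty V›
  have h := closed_induction G (p := fun S => ∃ H : SimpleGraph V,
    (∀ x, x ∉ S → nbr H x = nbr G x) ∧ (∀ x ∈ S, ∀ y ∈ S, H.Reachable x y) ∧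
      editCount G H + 1 ≤ (S.image (comp G)).card ∧
      2 * editCount G H + parityDemand H S ≤ ∑ X ∈ S.image (comp G), parityDemand G X) v ?_ ?_
  · obtain ⟨H, -, h1, h2, h3⟩ := h
    refine ⟨H, ?_, h2, ?_⟩
    · have : Nonempty V := ⟨v⟩
      exact ⟨fun x y => h1 x (Finset.mem_univ x) y (Finset.mem_univ y)⟩
    · rwa [parityDemand, Finset.inter_univ] at h3
  · have himg : (comp G v).image (comp G) = {comp G v} := by
      have := image_comp_union G ∅ v
      rwa [Finset.empty_union, Finset.image_empty, insert_empty_eq] at this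
    refine ⟨G, fun _ _ => rfl, fun x hx y hy => ?_, ?_, ?_⟩
    · exact (mem_comp.1 hx).symm.trans (mem_comp.1 hy)
    · rw [himg]
      simp [editCount]
    · rw [himg]
      simp [editCount]
  · rintro S hn hS hu ⟨H, h1, h2, h3, h4⟩
    obtain ⟨y, hy⟩ : ∃ y, y ∉ S := by simpa [Finset.eq_univ_iff_forall] using hu
    refine ⟨y, hy, ?_⟩
    have hd := disjoint_comp hS hy
    have hdl := Finset.disjoint_left.1 hd
    have hdr := Finset.disjoint_right.1 hd
    obtain ⟨u, huS, hcu⟩ := exists_mem_card_symmDiff (A := oddNodes H) hn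
    obtain ⟨w, hwC, hcw⟩ := exists_mem_card_symmDiff (A := oddNodes H) (S := comp G y)
      ⟨y, self_mem_comp G y⟩
    have huw : u ≠ w := fun h => hdl huS (h ▸ hwC)
    have hadj : ¬ H.Adj u w := by
      intro hadj
      have h5 := mem_nbr.2 hadj.symm
      rw [h1 w (hdr hwC), mem_nbr] at h5
      exact hdl huS (isClosedUnder_comp G y w hwC u h5)
    have hle := le_flipEdge hadj
    have hadj' : (flipEdge H u w).Adj u w := (flipEdge_adj huw).2 (Or.inr ⟨rfl, hadj⟩)
    have hodd : oddNodes H ∩ comp G y = oddNodes G ∩ comp G y := by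
      ext x
      rw [Finset.mem_inter, Finset.mem_inter, and_congr_left_iff]
      intro hx
      rw [mem_oddNodes, mem_oddNodes, h1 x (hdr hx)]
    have htri := editCount_triangle G H (flipEdge H u w)
    have hone := editCount_flipEdge_le H u w
    have hreach : ∀ x ∈ comp G y, (flipEdge H u w).Reachable y x := by
      intro x hx
      have hx' := mem_comp.1 hx
      rw [SimpleGraph.reachable_iff_reflTransGen] at hx'
      clear hx
      induction hx' with
      | refl => rfl
      | @tail a b ha hab ih =>
        refine ih.trans (SimpleGraph.Adj.reachable (hle ?_))
        rw [← mem_nbr, h1 a, mem_nbr]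
        · exact hab
        · refine hdr (mem_comp.2 ?_)
          rwa [SimpleGraph.reachable_iff_reflTransGen]
    have hto : ∀ x ∈ S ∪ comp G y, (flipEdge H u w).Reachable u x := by
      intro x hx
      rcases Finset.mem_union.1 hx with hx | hx
      · exact (h2 u huS x hx).mono hle
      · exact hadj'.reachable.trans ((hreach w hwC).symm.trans (hreach x hx))
    refine ⟨flipEdge H u w, fun x hx => ?_, fun a ha b hb => (hto a ha).symm.trans (hto b hb), ?_, ?_⟩
    · rw [Finset.mem_union, not_or] at hx
      rw [nbr_flipEdge_of_ne huw (ne_of_mem_of_not_mem huS hx.1).symm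
        (ne_of_mem_of_not_mem hwC hx.2).symm, h1 x hx.1]
    · rw [image_comp_union, Finset.card_insert_of_notMem (comp_notMem_image hS hy)]
      omega
    · rw [image_comp_union, Finset.sum_insert (comp_notMem_image hS hy)]
      have hcard : (oddNodes (flipEdge H u w) ∩ (S ∪ comp G y)).card ≤
          (symmDiff (oddNodes H ∩ S) {u}).card + (symmDiff (oddNodes H ∩ comp G y) {w}).card := by
        rw [oddNodes_flipEdge_inter huw hd huS hwC]
        exact Finset.card_union_le _ _
      rw [hcu, hcw, hodd] at hcard
      unfold parityDemand at h4 ⊢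
      split_ifs at hcard <;> omega

/-! ### Lower bound -/

theorem even_card_oddNodes (G : SimpleGraph V) : Even (oddNodes G).card := by
  classical
  have h := G.even_card_odd_degree_vertices
  simp only [← nbr_card_eq_degree] at h
  exact h

/-- The handshake lemma for the graph that keeps only the edges inside `X`. -/
theorem even_card_oddNodes_inter (G : SimpleGraph V) {X : Finset V} (hX : IsClosedUnder G X) :
    Even (oddNodes G ∩ X).card := by
  let H : SimpleGraph V :=
    { Adj := fun a b => G.Adj a b ∧ a ∈ X
      symm := ⟨fun a b h => ⟨h.1.symm, hX a h.2 b h.1⟩⟩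
      loopless := ⟨fun a h => G.loopless.irrefl a h.1⟩ }
  have h : oddNodes H = oddNodes G ∩ X := by
    ext x
    rw [Finset.mem_inter, mem_oddNodes, mem_oddNodes]
    by_cases hx : x ∈ X
    · have : nbr H x = nbr G x := by
        ext y
        rw [mem_nbr, mem_nbr]
        exact and_iff_left hx
      rw [this]
      tauto
    · have : nbr H x = ∅ := by
        rw [Finset.eq_empty_iff_forall_notMem]
        exact fun y hy => hx (mem_nbr.1 hy).2
      rw [this]
      simp [hx]
  rw [← h]
  exact even_card_oddNodes H

theorem sum_card_symmDiff_nbr_le (G H : SimpleGraph V) :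
    ∑ v, (symmDiff (nbr G v) (nbr H v)).card ≤ 2 * editCount G H := by
  classical
  have h1 := (symmDiff G H).sum_degrees_eq_twice_card_edges
  have h2 : ∀ v, (symmDiff (nbr G v) (nbr H v)).card = (symmDiff G H).degree v := by
    intro v
    rw [← SimpleGraph.card_neighborFinset_eq_degree]
    congr 1
    ext w
    rw [SimpleGraph.mem_neighborFinset, Finset.mem_symmDiff, mem_nbr, mem_nbr, symmDiff_def,
      SimpleGraph.sup_adj, SimpleGraph.sdiff_adj, SimpleGraph.sdiff_adj]
  simp only [h2, h1]
  gcongr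
  rw [editCount, ← Set.ncard_coe_finset, SimpleGraph.coe_edgeFinset, symmDiff_def,
    SimpleGraph.edgeSet_sup, SimpleGraph.edgeSet_sdiff, SimpleGraph.edgeSet_sdiff]
  rfl

theorem odd_card_symmDiff (A B : Finset V) :
    Odd (symmDiff A B).card ↔ Xor (Odd A.card) (Odd B.card) := by
  have h1 : (symmDiff A B).card = (A \ B).card + (B \ A).card := by
    rw [symmDiff_def, Finset.sup_eq_union, Finset.card_union_of_disjoint disjoint_sdiff_sdiff]
  have h2 := Finset.card_sdiff_add_card_inter A B
  have h3 := Finset.card_sdiff_add_card_inter B A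
  rw [Finset.inter_comm] at h3
  rw [h1, ← h2, ← h3, Nat.odd_add, Nat.odd_add, Nat.odd_add, ← Nat.not_odd_iff_even,
    ← Nat.not_odd_iff_even, Xor]
  tauto

/-- At an odd node an odd number of edges changes. A component without odd nodes is left by an edge
of `H`, and at its end inside an even, hence at least two, number of edges changes. Only a connected
`G` need not be left, which costs the extra `2`. -/
theorem sum_parityDemand_le_editCount {G H : SimpleGraph V} (hH : H.Connected)
    (hodd : oddNodes H = ∅) :
    ∑ X ∈ Finset.univ.image (comp G), parityDemand G X ≤ 2 * editCount G H + 2 := by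
  have hd : ∀ v, Odd (symmDiff (nbr G v) (nbr H v)).card ↔ v ∈ oddNodes G := by
    intro v
    have : v ∉ oddNodes H := by rw [hodd]; simp
    rw [mem_oddNodes] at this
    rw [odd_card_symmDiff, mem_oddNodes]
    simp [this, Xor]
  have hlow : ∀ X, (oddNodes G ∩ X).card ≤ ∑ v ∈ X, (symmDiff (nbr G v) (nbr H v)).card := by
    intro X
    rw [Finset.card_eq_sum_ones]
    calc ∑ _v ∈ oddNodes G ∩ X, 1
        ≤ ∑ v ∈ oddNodes G ∩ X, (symmDiff (nbr G v) (nbr H v)).card :=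
          Finset.sum_le_sum fun v hv =>
            ((hd v).2 (Finset.mem_of_mem_inter_left hv)).pos
      _ ≤ _ := Finset.sum_le_sum_of_subset Finset.inter_subset_right
  have htot := sum_card_symmDiff_nbr_le G H
  rw [← sum_image_comp G] at htot
  by_cases hcon : ∃ v, comp G v = Finset.univ
  · obtain ⟨v, hv⟩ := hcon
    have himg : Finset.univ.image (comp G) = {Finset.univ} := by
      ext C
      rw [Finset.mem_image, Finset.mem_singleton]
      constructor
      · rintro ⟨x, -, rfl⟩
        rw [← hv]
        exact comp_eq_of_mem (hv ▸ Finset.mem_univ x)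
      · rintro rfl
        exact ⟨v, Finset.mem_univ v, hv⟩
    rw [himg, Finset.sum_singleton] at htot ⊢
    have := hlow Finset.univ
    unfold parityDemand
    omega
  · push Not at hcon
    refine le_trans (le_trans (Finset.sum_le_sum fun X hX => ?_) htot) (Nat.le_add_right _ _)
    obtain ⟨v, -, rfl⟩ := Finset.mem_image.1 hX
    refine max_le ?_ (hlow _)
    by_cases h0 : oddNodes G ∩ comp G v = ∅
    · obtain ⟨x, hx, y, hy, hxy⟩ := exists_adj_of_connected hH ⟨v, self_mem_comp G v⟩ (hcon v)
      have hmem : y ∈ symmDiff (nbr G x) (nbr H x) := by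
        rw [Finset.mem_symmDiff, mem_nbr, mem_nbr]
        exact Or.inr ⟨hxy, fun h => hy (isClosedUnder_comp G v x hx y h)⟩
      have hpos := Finset.card_pos.2 ⟨y, hmem⟩
      have heven : ¬ Odd (symmDiff (nbr G x) (nbr H x)).card := by
        rw [hd]
        intro h
        have : x ∈ oddNodes G ∩ comp G v := Finset.mem_inter.2 ⟨h, hx⟩
        rw [h0] at this
        simp at this
      have h2 : 2 ≤ (symmDiff (nbr G x) (nbr H x)).card := by
        by_contra hlt
        have : (symmDiff (nbr G x) (nbr H x)).card = 1 := by omega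
        rw [this] at heven
        exact heven odd_one
      exact h2.trans (Finset.single_le_sum (f := fun v => (symmDiff (nbr G v) (nbr H v)).card)
        (fun _ _ => Nat.zero_le _) hx)
    · have h1 := Finset.card_pos.2 (Finset.nonempty_iff_ne_empty.2 h0)
      have h2 := even_card_oddNodes_inter G (isClosedUnder_comp G v)
      have h3 := hlow (comp G v)
      rw [Nat.even_iff] at h2
      omega

/-! ### Making a connected graph eulerian -/

theorem connected_of_forall_reachable {G H : SimpleGraph V} (hG : G.Connected)
    (h : ∀ a b, G.Adj a b → H.Reachable a b) : H.Connected :=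
  have := hG.nonempty
  ⟨fun x y => reachable_of_forall_adj h (hG.preconnected x y)⟩

/-- Flipping an edge that is not a bridge. -/
theorem connected_flipEdge {G : SimpleGraph V} (hG : G.Connected) {u w : V} (huw : u ≠ w)
    (h : (flipEdge G u w).Reachable u w) : (flipEdge G u w).Connected := by
  refine connected_of_forall_reachable hG fun a b hab => ?_
  by_cases he : s(a, b) = s(u, w)
  · rw [Sym2.eq_iff] at he
    rcases he with ⟨rfl, rfl⟩ | ⟨rfl, rfl⟩
    · exact h
    · exact h.symm
  · exact SimpleGraph.Adj.reachable ((flipEdge_adj huw).2 (Or.inl ⟨hab, he⟩))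

theorem connected_flipEdge_of_not_adj {G : SimpleGraph V} (hG : G.Connected) {u w : V}
    (h : ¬ G.Adj u w) : (flipEdge G u w).Connected :=
  hG.mono (le_flipEdge h)

theorem connected_flipEdge_of_common_neighbour {G : SimpleGraph V} (hG : G.Connected) {u w x : V}
    (huw : u ≠ w) (h1 : G.Adj u x) (h2 : G.Adj x w) : (flipEdge G u w).Connected := by
  refine connected_flipEdge hG huw ?_
  have hx1 := h1.ne'
  have hx2 := h2.ne
  refine (SimpleGraph.Adj.reachable ?_ : (flipEdge G u w).Reachable u x).trans
    (SimpleGraph.Adj.reachable ?_)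
  · refine (flipEdge_adj huw).2 (Or.inl ⟨h1, ?_⟩)
    rw [Sym2.eq_iff]
    tauto
  · refine (flipEdge_adj huw).2 (Or.inl ⟨h2, ?_⟩)
    rw [Sym2.eq_iff]
    tauto

theorem flipEdge_right_comm (G : SimpleGraph V) (a b c d : V) :
    flipEdge (flipEdge G a b) c d = flipEdge (flipEdge G c d) a b :=
  symmDiff_right_comm _ _ _

/-- Flipping `xw` and `xu` changes the parities at `u` and `w` only. It replaces flipping `uw` when
that edge may be a bridge. -/
theorem connected_flipEdge_flipEdge {G : SimpleGraph V} (hG : G.Connected) {u w x : V}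
    (huw : G.Adj u w) (hxw : ¬ G.Adj x w) (hu : x ≠ u) (hw : x ≠ w) :
    (flipEdge (flipEdge G x w) x u).Connected := by
  have hc := connected_flipEdge_of_not_adj hG hxw
  by_cases h : (flipEdge G x w).Adj x u
  · exact connected_flipEdge_of_common_neighbour hc hu
      ((flipEdge_adj hw).2 (Or.inr ⟨rfl, hxw⟩)) (le_flipEdge hxw huw.symm)
  · exact connected_flipEdge_of_not_adj hc h

theorem oddNodes_flipEdge_of_mem {G : SimpleGraph V} {u w : V} (huw : u ≠ w) (hu : u ∈ oddNodes G)
    (hw : w ∈ oddNodes G) : (oddNodes (flipEdge G u w)).card + 2 = (oddNodes G).card := by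
  have : oddNodes (flipEdge G u w) = oddNodes G \ {u, w} := by
    ext x
    rw [mem_oddNodes_flipEdge huw, Finset.mem_sdiff, Finset.mem_insert, Finset.mem_singleton, Xor]
    have h1 : x = u → x ∈ oddNodes G := fun h => h ▸ hu
    have h2 : x = w → x ∈ oddNodes G := fun h => h ▸ hw
    tauto
  have hsub : ({u, w} : Finset V) ⊆ oddNodes G := by
    rw [Finset.insert_subset_iff, Finset.singleton_subset_iff]
    exact ⟨hu, hw⟩
  have h2 := Finset.card_le_card hsub
  rw [this, Finset.card_sdiff_of_subset hsub]
  rw [Finset.card_pair huw] at h2 ⊢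
  omega

/-- Flip pairs of odd nodes without losing connectivity. With four or more odd nodes there is a
nonadjacent pair, or all are adjacent and a third is a common neighbour. For the last pair a detour
through a third node may cost one edit more, covered by the extra `2`. -/
theorem exists_eulerian_of_connected (hn : 3 ≤ Fintype.card V) (G : SimpleGraph V)
    (hG : G.Connected) : ∃ H : SimpleGraph V, IsEulerianGraph H ∧
      2 * editCount G H ≤ max 2 (oddNodes G).card + 2 := by
  induction hm : (oddNodes G).card using Nat.strong_induction_on generalizing G with
  | _ m ih =>
    subst hm
    have heven := even_card_oddNodes G
    rw [Nat.even_iff] at heven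
    have step : ∀ u w, u ≠ w → u ∈ oddNodes G → w ∈ oddNodes G → (flipEdge G u w).Connected →
        4 ≤ (oddNodes G).card → ∃ H : SimpleGraph V, IsEulerianGraph H ∧
          2 * editCount G H ≤ max 2 (oddNodes G).card + 2 := by
      intro u w huw hu hw hc h4
      have hcard := oddNodes_flipEdge_of_mem huw hu hw
      obtain ⟨H, hH, hedit⟩ := ih _ (by omega) (flipEdge G u w) hc rfl
      have := editCount_triangle G (flipEdge G u w) H
      have := editCount_flipEdge_le G u w
      exact ⟨H, hH, by omega⟩
    rcases (by omega : (oddNodes G).card = 0 ∨ (oddNodes G).card = 2 ∨ 4 ≤ (oddNodes G).card) with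
      h | h | h
    · exact ⟨G, isEulerianGraph_of_oddNodes_eq_empty hG (Finset.card_eq_zero.1 h), by
        simp [editCount]⟩
    · obtain ⟨u, w, huw, huw'⟩ := Finset.card_eq_two.1 h
      have hu : u ∈ oddNodes G := by rw [huw']; simp
      have hw : w ∈ oddNodes G := by rw [huw']; simp
      have fin1 : (flipEdge G u w).Connected → ∃ H : SimpleGraph V, IsEulerianGraph H ∧
          2 * editCount G H ≤ max 2 (oddNodes G).card + 2 := by
        intro hc
        have hcard := oddNodes_flipEdge_of_mem huw hu hw
        refine ⟨_, isEulerianGraph_of_oddNodes_eq_empty hc (Finset.card_eq_zero.1 (by omega)), ?_⟩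
        have := editCount_flipEdge_le G u w
        omega
      obtain ⟨x, -, hx⟩ := Finset.exists_mem_notMem_of_card_lt_card
        (s := {u, w}) (t := (Finset.univ : Finset V)) (by
          rw [Finset.card_pair huw, Finset.card_univ]; omega)
      have hxu : x ≠ u := fun h => hx (by simp [h])
      have hxw : x ≠ w := fun h => hx (by simp [h])
      by_cases hadj : G.Adj u w
      swap
      · exact fin1 (connected_flipEdge_of_not_adj hG hadj)
      have fin2 : (flipEdge (flipEdge G x w) x u).Connected → ∃ H : SimpleGraph V,
          IsEulerianGraph H ∧ 2 * editCount G H ≤ max 2 (oddNodes G).card + 2 := by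
        intro hc
        refine ⟨_, isEulerianGraph_of_oddNodes_eq_empty hc ?_, ?_⟩
        · rw [Finset.eq_empty_iff_forall_notMem]
          intro y
          rw [mem_oddNodes_flipEdge hxu, mem_oddNodes_flipEdge hxw, huw', Finset.mem_insert,
            Finset.mem_singleton, Xor, Xor]
          have h1 : y = x → y ≠ u := fun h => h ▸ hxu
          have h2 : y = x → y ≠ w := fun h => h ▸ hxw
          have h3 : y = u → y ≠ w := fun h => h ▸ huw
          tauto
        · have h1 := editCount_triangle G (flipEdge G x w) (flipEdge (flipEdge G x w) x u)
          have h2 := editCount_flipEdge_le G x w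
          have h3 := editCount_flipEdge_le (flipEdge G x w) x u
          omega
      by_cases haw : G.Adj x w
      · by_cases hau : G.Adj x u
        · exact fin1 (connected_flipEdge_of_common_neighbour hG huw hau.symm haw)
        · rw [flipEdge_right_comm] at fin2
          exact fin2 (connected_flipEdge_flipEdge hG hadj.symm hau hxw hxu)
      · exact fin2 (connected_flipEdge_flipEdge hG hadj haw hxu hxw)
    · by_cases hex : ∃ u ∈ oddNodes G, ∃ w ∈ oddNodes G, u ≠ w ∧ ¬ G.Adj u w
      · obtain ⟨u, hu, w, hw, huw, hadj⟩ := hex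
        exact step u w huw hu hw (connected_flipEdge_of_not_adj hG hadj) h
      · push Not at hex
        obtain ⟨u, hu, w, hw, x, hx, huw, hux, hwx⟩ := Finset.two_lt_card.1
          (by omega : 2 < (oddNodes G).card)
        exact step u w huw hu hw (connected_flipEdge_of_common_neighbour hG huw (hex u hu x hx hux)
          (hex x hx w hw hwx.symm)) h

end Merging

/-! ### The weight of a component -/

theorem isExtreme_outCut_congr {V : Type} [DecidableEq V] {N N' : V → Finset V} {k : ℕ}
    {X : Finset V} (h : ∀ x ∈ X, N x = N' x) :
    IsExtreme (outCut N) k X ↔ IsExtreme (outCut N') k X :=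
  isExtreme_congr fun _ hY => by rw [outCut_congr fun x hx => h x (hY hx)]

open Classical in
/-- The weight `1` for the components all of whose nodes have a degree with the property `Q`. -/
noncomputable def componentWeight (Q : ℕ → Prop) (n : ℕ) : LocalWeight n 1 1 where
  w N X := if IsExtreme (outCut N) 1 X then (if ∀ x ∈ X, Q (N x).card then 1 else 0) else 0
  congr N N' X h := by
    simp only [isExtreme_outCut_congr h]
    congr 1
    refine if_congr (forall₂_congr fun x hx => ?_) rfl rfl
    rw [h x hx]
  first c L X hL hc := by
    have hiff : IsExtreme (outCut (firstNbrs c L)) 1 X ↔ IsExtreme (outCut (allNbrs L)) 1 X :=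
      isExtreme_congr fun Y hY => min_outCut_firstNbrs hL
        ((Nat.add_le_add_right (Finset.card_le_card hY) 1).trans hc)
    by_cases hX : IsExtreme (outCut (allNbrs L)) 1 X
    · rw [if_pos hX, if_pos (hiff.2 hX)]
      refine if_congr (forall₂_congr fun x hx => ?_) rfl rfl
      rcases firstNbrs_eq_or (c := c) (hL x) with h | ⟨-, h⟩
      · rw [h]
      -- A node whose list is cut off has too many neighbours to lie in a component as small as `X`.
      · have := le_outCut_of_le_card (N := allNbrs L) hx (k := 1) (by omega)
        have := hX.2.1
        omega
    · rw [if_neg hX, if_neg (fun h => hX (hiff.1 h))]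
  extreme N X h := by
    by_contra hX
    rw [if_neg hX] at h
    exact h rfl
  nonneg N X := by split_ifs <;> norm_num
  le N X := by split_ifs <;> norm_num

theorem sum_componentWeight (Q : ℕ → Prop) [DecidablePred Q] {n : ℕ} {G : SimpleGraph (Fin n)}
    (L : IncidenceLists G) : ∑ X, (componentWeight Q n).w (allNbrs L.nbrs) X =
      ∑ X ∈ Finset.univ.image (comp G), if ∀ x ∈ X, Q (nbr G x).card then 1 else 0 := by
  classical
  rw [nbr_eq_allNbrs, ← sum_isExtreme_one]
  refine Finset.sum_congr rfl fun X _ => ?_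
  simp only [componentWeight]
  congr

/-- The estimator for a property given by weights of components and by degrees. -/
theorem exists_estimator_of_componentWeight {P : ∀ n, SimpleGraph (Fin n) → Prop} {C δ₀ : ℝ}
    (Q : ℕ → Prop) (y : ℕ → ℝ) (hy : ∀ i, |y i| ≤ 1)
    (hdist : ∀ n, 1 ≤ n → (∃ H, P n H) → ∀ (G : SimpleGraph (Fin n)) (L : IncidenceLists G),
      |∑ X, (componentWeight Q n).w (allNbrs L.nbrs) X + ∑ v, y (nbr G v).card -
        distanceTo (P n) G| ≤ C)
    (h0 : 0 < δ₀) (h1 : δ₀ < 1)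
    (hmax : ∀ n, 1 ≤ n → (∃ H, P n H) → ∀ G : SimpleGraph (Fin n),
      (distanceTo (P n) G : ℝ) ≤ 2 * (δ₀ * n)) :
    ∃ A : Estimator, A.EstimatesDistanceTo P ∧
      A.HasQueryComplexity (fun δ p => Real.log (1 / δ) / ((1 - p) * δ ^ 2)) := by
  refine exists_estimator (k := 1) (D := 200) (C := C) (.inl rfl) zero_le_one (componentWeight Q)
    (fun _ => search) (fun t => 5 * t + 3) (fun t => 3 * t + 1)
    (fun n N v X t hX ht hc => hX.subset_search ht (by omega))
    (fun n c N hN v t => queryComputable_search hN v t) (fun n N v t => card_search_le N v t) ?_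
    (fun _ v L => y (L v).length) (fun n v => (QueryComputable.degree v).map y)
    (fun _ _ _ => hy _) (fun n hn hP G L => ?_) h0 h1 hmax
  · intro j
    have h1 : (2 ^ 2 : ℕ) ^ j = 2 ^ j * 2 ^ j := by
      rw [← mul_pow]
      norm_num
    have h2 : 1 ≤ 2 ^ j := Nat.one_le_two_pow
    rw [h1, pow_succ]
    nlinarith
  · have hlen : ∀ v, (L.nbrs v).length = (nbr G v).card := fun v => by
      rw [← nbr_eq_allNbrs L, allNbrs, List.toFinset_card_of_nodup (L.nodup v)]
    simp only [hlen]
    exact hdist n hn hP G L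

/-! ### Connectivity -/

section Distances

variable {V : Type} [Fintype V] [DecidableEq V]

theorem distanceTo_connected_add_one [Nonempty V] (G : SimpleGraph V) :
    distanceTo (fun G => G.Connected) G + 1 = (Finset.univ.image (comp G)).card := by
  obtain ⟨H, hH, h1, -⟩ := exists_connected_of_merging G
  refine le_antisymm ((Nat.add_le_add_right (distanceTo_le (P := fun G => G.Connected) hH) 1).trans
    h1) ?_
  obtain ⟨H', hH', h2⟩ := exists_editCount_eq_distanceTo (P := fun G => G.Connected) ⟨H, hH⟩ G
  rw [← h2]
  exact card_comp_le_editCount hH'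

/-- The number of odd nodes in a component is even, hence zero or at least two. This separates the
demand into a local weight of components and a function of single degrees, which one degree query
evaluates. -/
theorem sum_parityDemand_eq (G : SimpleGraph V)
    [∀ X : Finset V, Decidable (∀ x ∈ X, Even (nbr G x).card)] :
    ∑ X ∈ Finset.univ.image (comp G), parityDemand G X =
      2 * ∑ X ∈ Finset.univ.image (comp G), (if ∀ x ∈ X, Even (nbr G x).card then 1 else 0) +
        (oddNodes G).card := by
  have h1 : (oddNodes G).card = ∑ X ∈ Finset.univ.image (comp G), (oddNodes G ∩ X).card := by
    have := sum_image_comp G fun v => if v ∈ oddNodes G then 1 else 0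
    simp only [Finset.sum_ite_mem, Finset.univ_inter, Finset.sum_const, smul_eq_mul, mul_one] at this
    rw [← this]
    exact Finset.sum_congr rfl fun X _ => by rw [Finset.inter_comm]
  rw [h1, Finset.mul_sum, ← Finset.sum_add_distrib]
  refine Finset.sum_congr rfl fun X hX => ?_
  obtain ⟨v, -, rfl⟩ := Finset.mem_image.1 hX
  have h2 : (∀ x ∈ comp G v, Even (nbr G x).card) ↔ (oddNodes G ∩ comp G v).card = 0 := by
    rw [Finset.card_eq_zero, Finset.eq_empty_iff_forall_notMem]
    refine forall_congr' fun x => ?_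
    rw [Finset.mem_inter, mem_oddNodes, ← Nat.not_even_iff_odd]
    tauto
  have h3 := even_card_oddNodes_inter G (isClosedUnder_comp G v)
  rw [Nat.even_iff] at h3
  simp only [h2, parityDemand]
  split_ifs <;> omega

theorem sum_parityDemand_le (G : SimpleGraph V) :
    ∑ X ∈ Finset.univ.image (comp G), parityDemand G X ≤ 2 * Fintype.card V := by
  have h := sum_image_comp G fun _ => 2
  rw [Finset.sum_const, Finset.card_univ, smul_eq_mul] at h
  rw [mul_comm, ← h]
  refine Finset.sum_le_sum fun X hX => ?_
  obtain ⟨v, -, rfl⟩ := Finset.mem_image.1 hX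
  have h1 := Finset.card_pos.2 ⟨v, self_mem_comp G v⟩
  have h2 : (oddNodes G ∩ comp G v).card ≤ (comp G v).card :=
    Finset.card_le_card Finset.inter_subset_right
  rw [Finset.sum_const, smul_eq_mul, parityDemand]
  omega

theorem two_mul_distanceTo_eulerian_le (hn : 3 ≤ Fintype.card V) (G : SimpleGraph V) :
    2 * distanceTo (fun G => IsEulerianGraph G) G ≤
      ∑ X ∈ Finset.univ.image (comp G), parityDemand G X + 2 := by
  have : Nonempty V := Fintype.card_pos_iff.1 (by omega)
  obtain ⟨H, hH, -, h1⟩ := exists_connected_of_merging G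
  obtain ⟨H', hH', h2⟩ := exists_eulerian_of_connected hn H hH
  have h3 := distanceTo_le (P := fun G => IsEulerianGraph G) (G := G) hH'
  have h4 := editCount_triangle G H H'
  omega

theorem sum_parityDemand_le_distanceTo (hP : ∃ H : SimpleGraph V, IsEulerianGraph H)
    (G : SimpleGraph V) : ∑ X ∈ Finset.univ.image (comp G), parityDemand G X ≤
      2 * distanceTo (fun G => IsEulerianGraph G) G + 2 := by
  obtain ⟨H, hH, h⟩ := exists_editCount_eq_distanceTo (P := fun G => IsEulerianGraph G) hP G
  rw [← h]
  exact sum_parityDemand_le_editCount hH.1 (oddNodes_eq_empty_of_isEulerianGraph hH)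

theorem distanceTo_eulerian_of_subsingleton [Subsingleton V] [Nonempty V] (G : SimpleGraph V) :
    distanceTo (fun G => IsEulerianGraph G) G = 0 := by
  have hG : IsEulerianGraph G := by
    refine isEulerianGraph_of_oddNodes_eq_empty ⟨fun x y => ?_⟩ ?_
    · rw [Subsingleton.elim x y]
    · rw [Finset.eq_empty_iff_forall_notMem]
      intro v hv
      obtain ⟨w, hw⟩ := Finset.card_pos.1 (mem_oddNodes.1 hv).pos
      exact (mem_nbr.1 hw).ne (Subsingleton.elim _ _)
  have := distanceTo_le (P := fun G => IsEulerianGraph G) (G := G) hG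
  simpa [editCount] using this

theorem card_ne_two_of_isEulerianGraph {H : SimpleGraph V} (hH : IsEulerianGraph H) :
    Fintype.card V ≠ 2 := by
  intro h2
  obtain ⟨v⟩ := hH.1.nonempty
  obtain ⟨x, hx, y, hy, hxy⟩ := exists_adj_of_connected hH.1 (S := {v}) (by simp) fun h => by
    have := congrArg Finset.card h
    rw [Finset.card_singleton, Finset.card_univ] at this
    omega
  have h : x ∉ oddNodes H := by
    rw [oddNodes_eq_empty_of_isEulerianGraph hH]
    simp
  rw [mem_oddNodes] at h
  have hpos := Finset.card_pos.2 ⟨y, mem_nbr.2 hxy⟩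
  have hle : (nbr H x).card ≤ (Finset.univ.erase x).card :=
    Finset.card_le_card fun w hw => by simpa using (mem_nbr.1 hw).ne'
  rw [Finset.card_erase_of_mem (Finset.mem_univ x), Finset.card_univ, h2] at hle
  have : (nbr H x).card = 1 := by omega
  rw [this] at h
  exact h odd_one

end Distances

/-! ### The estimators for connectivity and eulerianity -/

theorem exists_estimator_connected :
    ∃ A : Estimator, A.EstimatesDistanceTo (fun _ G => G.Connected) ∧
      A.HasQueryComplexity (fun δ p => Real.log (1 / δ) / ((1 - p) * δ ^ 2)) := by
  refine exists_estimator_of_componentWeight (C := 1) (δ₀ := 1 / 2) (fun _ => True) (fun _ => 0)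
    (by simp) (fun n hn _ G L => ?_) (by norm_num) (by norm_num) fun n hn _ G => ?_
  · have : Nonempty (Fin n) := ⟨⟨0, hn⟩⟩
    rw [sum_componentWeight]
    have h := distanceTo_connected_add_one G
    simp [← h]
  · have : Nonempty (Fin n) := ⟨⟨0, hn⟩⟩
    have h1 := distanceTo_connected_add_one G
    have h2 := Finset.card_image_le (s := Finset.univ) (f := comp G)
    rw [Finset.card_univ, Fintype.card_fin] at h2
    have h3 : distanceTo (fun G : SimpleGraph (Fin n) => G.Connected) G ≤ n := by omega
    have h4 : (distanceTo (fun G : SimpleGraph (Fin n) => G.Connected) G : ℝ) ≤ n := by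
      exact_mod_cast h3
    linarith

theorem exists_estimator_eulerian :
    ∃ A : Estimator, A.EstimatesDistanceTo (fun _ G => IsEulerianGraph G) ∧
      A.HasQueryComplexity (fun δ p => Real.log (1 / δ) / ((1 - p) * δ ^ 2)) := by
  have hcases : ∀ n, 1 ≤ n → (∃ H : SimpleGraph (Fin n), IsEulerianGraph H) → n = 1 ∨ 3 ≤ n := by
    rintro n hn ⟨H, hH⟩
    have := card_ne_two_of_isEulerianGraph hH
    rw [Fintype.card_fin] at this
    omega
  -- For `n ≥ 3` the distance is at most `n + 1 ≤ 4 n / 3`, whence `δ₀ = 2 / 3`. No graph on two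
  -- nodes is eulerian, and for `n = 1` the distance is zero.
  refine exists_estimator_of_componentWeight (C := 1) (δ₀ := 2 / 3) Even
    (fun i => if Odd i then 1 / 2 else 0) (fun i => ?_) (fun n hn hP G L => ?_)
    (by norm_num) (by norm_num) fun n hn hP G => ?_
  · split_ifs <;> norm_num [abs_le]
  · have h1 := sum_parityDemand_le_distanceTo hP G
    have h2 : 2 * distanceTo (fun G : SimpleGraph (Fin n) => IsEulerianGraph G) G ≤
        ∑ X ∈ Finset.univ.image (comp G), parityDemand G X + 2 := by
      rcases hcases n hn hP with rfl | h3
      · rw [distanceTo_eulerian_of_subsingleton]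
        omega
      · exact two_mul_distanceTo_eulerian_le (by rwa [Fintype.card_fin]) G
    rw [sum_parityDemand_eq] at h1 h2
    have h3 : ∑ v, (if Odd (nbr G v).card then (1 : ℝ) / 2 else 0) = (oddNodes G).card / 2 := by
      rw [← Finset.sum_filter, Finset.sum_const, nsmul_eq_mul, mul_one_div, oddNodes]
    rw [sum_componentWeight, h3]
    have h4 : ∑ X ∈ Finset.univ.image (comp G),
        (if ∀ x ∈ X, Even (nbr G x).card then (1 : ℝ) else 0) =
        ((∑ X ∈ Finset.univ.image (comp G),
          (if ∀ x ∈ X, Even (nbr G x).card then 1 else 0) : ℕ) : ℝ) := by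
      push_cast
      rfl
    rw [h4]
    generalize (∑ X ∈ Finset.univ.image (comp G),
          (if ∀ x ∈ X, Even (nbr G x).card then 1 else 0) : ℕ) = q at *
    generalize distanceTo (fun G : SimpleGraph (Fin n) => IsEulerianGraph G) G = dist at *
    have h1' : 2 * (q : ℝ) + (oddNodes G).card ≤ 2 * dist + 2 := by exact_mod_cast h1
    have h2' : 2 * (dist : ℝ) ≤ 2 * q + (oddNodes G).card + 2 := by exact_mod_cast h2
    rw [abs_le]
    constructor <;> linarith
  · rcases hcases n hn hP with rfl | h3
    · rw [distanceTo_eulerian_of_subsingleton]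
      norm_num
    · have h1 := two_mul_distanceTo_eulerian_le (by rwa [Fintype.card_fin]) G
      have h2 := sum_parityDemand_le G
      rw [Fintype.card_fin] at h2
      have h4 : 3 * distanceTo (fun G : SimpleGraph (Fin n) => IsEulerianGraph G) G ≤ 4 * n := by
        omega
      have h5 : 3 * (distanceTo (fun G : SimpleGraph (Fin n) => IsEulerianGraph G) G : ℝ) ≤
        4 * n := by exact_mod_cast h4
      linarith

end GraphDistance

theorem mainTheorem2 :
    (∃ A : Estimator, A.EstimatesDistanceTo (fun _ G => G.Connected) ∧
      A.HasQueryComplexity (fun δ p => Real.log (1 / δ) / ((1 - p) * δ ^ 2))) ∧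
    (∃ A : Estimator, A.EstimatesDistanceTo (fun _ G => G.IsEdgeConnected 2) ∧
      A.HasQueryComplexity (fun δ p => Real.log (1 / δ) / ((1 - p) * δ ^ 2))) ∧
    (∃ A : Estimator, A.EstimatesDistanceTo (fun _ G => IsEulerianGraph G) ∧
      A.HasQueryComplexity (fun δ p => Real.log (1 / δ) / ((1 - p) * δ ^ 2))) ∧
    (∃ A : Estimator, A.EstimatesDistanceTo (fun _ G => G.IsEdgeConnected 3) ∧
      A.HasQueryComplexity (fun δ p => Real.log (1 / δ) / ((1 - p) * δ ^ 3))) :=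
  ⟨GraphDistance.exists_estimator_connected, GraphDistance.exists_estimator_isEdgeConnected_two,
    GraphDistance.exists_estimator_eulerian, GraphDistance.exists_estimator_isEdgeConnected_three⟩
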